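/- **Conventions.** Let $W$ be either the plane $\mathbb R^2$ or a (piecewise linear) disk in the plane, and let $B$ be a finite set of points on the frontier of $W$ (so $B=\emptyset$ if $W=\mathbb R^2$); let $I=[0,1]$. All curves, surfaces, homeomorphisms and disks are piecewise linear. *The category.* A *smoothing* with boundary $B$ is a compact embedded 1-manifold $\mathcal O\subset W$ (a disjoint union of arcs and simple closed curves) with boundary $B$, meeting the frontier of $W$ exactly in $B$. A *cobordism* $C:\mathcal O\to\mathcal O'$ is a compact surface embedded in the cylinder $W\times I$ with boundary $(\mathcal O\times\{0\})\cup(B\times I)\cup(\mathcal O'\times\{1\})$, meeting the boundary of the cylinder only there, and equal to a product near $W\times\{0\}$ and $W\times\{1\}$; such a surface is automatically orientable, and no orientation is part of the data. Cobordisms are considered up to boundary preserving ambient isotopy of $W\times I$ (through homeomorphisms that fix $W\times\{0,1\}$ pointwise and move points of $\partial W\times I$ only vertically). Smoothings and isotopy classes of cobordisms form a category, with composition by placing one cobordism on top of the other and renormalizing vertically. $\mathrm{Cob}(B)$ is the preadditive category with the smoothings as objects and with the free abelian groups on the isotopy classes of cobordisms as Hom-groups. *Local relations.* $\mathrm{Cob}_{/l}(B)$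 is the quotient of $\mathrm{Cob}(B)$ by the ideal generated by the following relations. * ($S$) $C=0$ if $C$ has a connected component isotopic to a standard sphere. * ($T$) $C=2C'$ if $C$ has a connected component isotopic to a standard (unknotted) torus and $C'$ is the result of removing it. * ($4Tu$) $C_{12}+C_{34}=C_{13}+C_{24}$, if $C$ meets an embedded ball in the interior of the cylinder in four disks $D_1,\dots,D_4$ in standard position, and $C_{ij}$ is the result of removing $D_i$ and $D_j$ from $C$ and replacing them by a standard tube in the ball, with the same boundary and disjoint from the other two disks. *Planar composition.* A planar arc diagram $D$ with $n$ inputs consists of pairwise disjoint disks $W_1,\dots,W_n$ in the interior of $W$ and a compact embedded 1-manifold $A\subset W\setminus\bigcup_i\operatorname{int}W_i$ with boundary $B\cup\bigcup_iB_i$, where $B=A\cap\partial W$ and $B_i=A\cap\partial W_i$. For cobordisms $C_i$ in $W_i\times I$ between smoothings with boundary $B_i$, let $D(C_1,\dots,C_n)=(A\times I)\cup\bigcup_iC_i$, a cobordism in $W\times I$ between smoothings with boundary $B$. *Graded categories.* A *graded category* is a preadditive category such that (1) the Hom-groups are $\mathbb Z$-graded abelian groups, composition adds degrees, and identities have degree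 $0$; and (2) there is a $\mathbb Z$-action $(m,\mathcal O)\mapsto\mathcal O\{m\}$ on the objects that leaves the groups of morphisms and their composition unchanged, such that a morphism of degree $d$ from $\mathcal O_1$ to $\mathcal O_2$ has degree $d+m_2-m_1$ as a morphism from $\mathcal O_1\{m_1\}$ to $\mathcal O_2\{m_2\}$. A preadditive category with property (1) is extended to a graded category by adjoining formal copies $\mathcal O\{m\}$, $m\in\mathbb Z$, of its objects; the extension is denoted by the same name. **Proposition.** For a cobordism $C$ in $W\times I$ with $|B|$ vertical boundary components put $\deg C:=\chi(C)-\tfrac12|B|$, where $\chi$ is the Euler characteristic (the alternating number of simplices of a finite triangulation). Then: 1. every cobordism has a finite triangulation, and $\chi(C)$ does not depend on it; $\deg C$ is an integer and depends only on the isotopy class of $C$; 2. the degree is additive under vertical composition: $\deg(C'\circ C)=\deg C+\deg C'$; 3. the degree is additive under planar composition: $\deg D(C_1,\dots,C_n)=\sum_i\deg C_i$ for every planar arc diagram $D$; 4. the relations $S$, $T$ and $4Tu$ are homogeneous: $C$, respectively $C-2C'$, respectively $C_{12}+C_{34}-C_{13}-C_{24}$, is a combination of cobordisms of one and the same degree;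 5. $\mathrm{Cob}(B)$, with the grading in which the morphisms of degree $d$ are the integral combinations of cobordisms of degree $d$, and $\mathrm{Cob}_{/l}(B)$, with the induced grading, are graded categories (after adjoining the formal shifts $\mathcal O\{m\}$). -/

import Mathlib

open Set CategoryTheory

/-! Piecewise linear topology -/
namespace PL

section
variable {E F : Type*} [AddCommGroup E] [Module ℝ E] [AddCommGroup F] [Module ℝ F]

/-- A convex polyhedral set: the solution set of finitely many affine inequalities. -/
def IsConvexPolyhedron (Q : Set E) : Prop :=
  ∃ A : Set (E →ᵃ[ℝ] ℝ), A.Finite ∧ Q = {x | ∀ f ∈ A, 0 ≤ f x}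

/-- A compact polyhedron: a compact finite union of convex polyhedral sets. -/
def IsPolyhedron [TopologicalSpace E] (P : Set E) : Prop :=
  IsCompact P ∧ ∃ 𝒬 : Set (Set E), 𝒬.Finite ∧ (∀ Q ∈ 𝒬, IsConvexPolyhedron Q) ∧ P = ⋃₀ 𝒬

/-- `f` is piecewise linear on `S`: finitely many convex polyhedral sets cover `S`, and `f` agrees
with an affine map on the part of `S` in each of them. -/
def IsPLOn (f : E → F) (S : Set E) : Prop :=
  ∃ 𝒬 : Set (Set E), 𝒬.Finite ∧ (∀ Q ∈ 𝒬, IsConvexPolyhedron Q) ∧ S ⊆ ⋃₀ 𝒬 ∧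
    ∀ Q ∈ 𝒬, ∃ A : E →ᵃ[ℝ] F, EqOn f A (S ∩ Q)

open Classical in
/-- The Euler characteristic of a compact polyhedron: the alternating number of simplices of a
finite triangulation. -/
noncomputable def eulerChar (P : Set E) : ℤ :=
  if h : ∃ K : Geometry.SimplicialComplex ℝ E, K.faces.Finite ∧ K.space = P then
    ∑ᶠ s ∈ h.choose.faces, (-1) ^ (s.card - 1)
  else 0

theorem IsConvexPolyhedron.inter {P Q : Set E} (hP : IsConvexPolyhedron P)
    (hQ : IsConvexPolyhedron Q) : IsConvexPolyhedron (P ∩ Q) := by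
  obtain ⟨A, hA, rfl⟩ := hP
  obtain ⟨A', hA', rfl⟩ := hQ
  refine ⟨A ∪ A', hA.union hA', ?_⟩
  ext x
  simp only [mem_inter_iff, mem_ofPred_eq, mem_union]
  exact ⟨fun h f hf => hf.elim (h.1 f) (h.2 f), fun h => ⟨fun f hf => h f (.inl hf),
    fun f hf => h f (.inr hf)⟩⟩

theorem IsConvexPolyhedron.univ : IsConvexPolyhedron (Set.univ : Set E) :=
  ⟨∅, Set.finite_empty, by simp⟩

theorem IsConvexPolyhedron.preimage {Q : Set F} (hQ : IsConvexPolyhedron Q) (g : E →ᵃ[ℝ] F) :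
    IsConvexPolyhedron (g ⁻¹' Q) := by
  obtain ⟨A, hA, rfl⟩ := hQ
  exact ⟨(fun f => f.comp g) '' A, hA.image _, by ext x; simp⟩

theorem IsConvexPolyhedron.nonneg (f : E →ᵃ[ℝ] ℝ) : IsConvexPolyhedron {x | 0 ≤ f x} :=
  ⟨{f}, Set.finite_singleton _, by simp⟩

theorem IsPolyhedron.union [TopologicalSpace E] {P Q : Set E} (hP : IsPolyhedron P)
    (hQ : IsPolyhedron Q) : IsPolyhedron (P ∪ Q) := by
  obtain ⟨hPc, 𝒬₁, hf, hc, rfl⟩ := hP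
  obtain ⟨hQc, 𝒬, hf', hc', rfl⟩ := hQ
  exact ⟨hPc.union hQc, 𝒬₁ ∪ 𝒬, hf.union hf', fun R hR => hR.elim (hc R) (hc' R),
    (sUnion_union _ _).symm⟩

theorem IsPolyhedron.empty [TopologicalSpace E] : IsPolyhedron (∅ : Set E) :=
  ⟨isCompact_empty, ∅, Set.finite_empty, by simp, by simp⟩

theorem IsPolyhedron.iUnion [TopologicalSpace E] {n : ℕ} {P : Fin n → Set E}
    (h : ∀ i, IsPolyhedron (P i)) : IsPolyhedron (⋃ i, P i) := by
  choose hc 𝒬 hf hq he using h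
  refine ⟨isCompact_iUnion hc, ⋃ i, 𝒬 i, Set.finite_iUnion hf, ?_, ?_⟩
  · intro Q hQ
    obtain ⟨i, hi⟩ := mem_iUnion.1 hQ
    exact hq i Q hi
  · rw [sUnion_iUnion]
    exact iUnion_congr he

theorem IsPolyhedron.image [TopologicalSpace E] [TopologicalSpace F] {P : Set E}
    (hP : IsPolyhedron P) {f : E → F} (hf : Continuous f) (g : F →ᵃ[ℝ] E) (hgf : ∀ x, g (f x) = x)
    (hfg : ∀ y, f (g y) = y) : IsPolyhedron (f '' P) := by
  obtain ⟨hPc, 𝒬, hfin, hq, rfl⟩ := hP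
  refine ⟨hPc.image hf, (fun Q => f '' Q) '' 𝒬, hfin.image _, ?_, ?_⟩
  · rintro _ ⟨Q, hQ, rfl⟩
    show IsConvexPolyhedron (f '' Q)
    rw [image_eq_preimage_of_inverse hgf hfg]
    exact (hq Q hQ).preimage g
  · rw [sUnion_image, sUnion_eq_biUnion, image_iUnion₂]

theorem IsPolyhedron.prod_Icc [TopologicalSpace E] {P : Set E}
    (hP : IsPolyhedron P) (a b : ℝ) : IsPolyhedron (P ×ˢ Icc a b) := by
  obtain ⟨hPc, 𝒬, hf, hq, rfl⟩ := hP
  refine ⟨hPc.prod isCompact_Icc, (fun Q => Q ×ˢ Icc a b) '' 𝒬, hf.image _, ?_, ?_⟩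
  · rintro _ ⟨Q, hQ, rfl⟩
    have h1 := (hq Q hQ).preimage (LinearMap.fst ℝ E ℝ).toAffineMap
    have h2 := IsConvexPolyhedron.nonneg
      ((LinearMap.snd ℝ E ℝ).toAffineMap - AffineMap.const ℝ (E × ℝ) a)
    have h3 := IsConvexPolyhedron.nonneg
      (AffineMap.const ℝ (E × ℝ) b - (LinearMap.snd ℝ E ℝ).toAffineMap)
    convert h1.inter (h2.inter h3) using 1
    ext ⟨x, t⟩
    simp
  · ext ⟨x, t⟩
    simp only [mem_prod, mem_sUnion, mem_image, exists_exists_and_eq_and]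
    constructor
    · rintro ⟨⟨Q, h1, h2⟩, h3⟩; exact ⟨Q, h1, h2, h3⟩
    · rintro ⟨Q, h1, h2, h3⟩; exact ⟨⟨Q, h1, h2⟩, h3⟩

end

/-! Manifolds with boundary, by charts -/
section
variable {X M : Type*} [TopologicalSpace X] [TopologicalSpace M]

/-- A neighbourhood of `p` in `S` is homeomorphic to an open subset of the half-space `0 ≤ h`, and
the points of `D` are those that go to the boundary `h = 0`. -/
def HasHalfChart (h : M → ℝ) (S D : Set X) (p : X) : Prop :=
  ∃ (U : Set X) (V : Set M), IsOpen U ∧ p ∈ U ∧ IsOpen V ∧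
    ∃ e : ↥(S ∩ U) ≃ₜ ↥(V ∩ {y | 0 ≤ h y}), ∀ q, q.1 ∈ D ↔ h (e q).1 = 0

/-- `S` is a topological 1-manifold with boundary `D`. -/
def IsCurve (S D : Set X) : Prop :=
  D ⊆ S ∧ ∀ p ∈ S, HasHalfChart (fun y : ℝ => y) S D p

/-- `S` is a topological 2-manifold with boundary `D`. -/
def IsSurface (S D : Set X) : Prop :=
  D ⊆ S ∧ ∀ p ∈ S, HasHalfChart (fun y : ℝ × ℝ => y.2) S D p

/-- The data of a half-space chart, by maps of the ambient spaces. -/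
structure HalfChart (h : M → ℝ) (S D U : Set X) where
  V : Set M
  f : X → M
  g : M → X
  isOpen_V : IsOpen V
  cf : ContinuousOn f (S ∩ U)
  cg : ContinuousOn g (V ∩ {y | 0 ≤ h y})
  mf : ∀ q ∈ S ∩ U, f q ∈ V ∩ {y | 0 ≤ h y}
  mg : ∀ y ∈ V ∩ {y | 0 ≤ h y}, g y ∈ S ∩ U
  gf : ∀ q ∈ S ∩ U, g (f q) = q
  fg : ∀ y ∈ V ∩ {y | 0 ≤ h y}, f (g y) = y
  bd : ∀ q ∈ S ∩ U, q ∈ D ↔ h (f q) = 0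

theorem HalfChart.hasHalfChart {h : M → ℝ} {S D U : Set X} (c : HalfChart h S D U)
    (hU : IsOpen U) {p : X} (hp : p ∈ U) : HasHalfChart h S D p := by
  refine ⟨U, c.V, hU, hp, c.isOpen_V, ⟨⟨fun q => ⟨c.f q, c.mf q q.2⟩, fun y => ⟨c.g y, c.mg y y.2⟩,
    fun q => Subtype.ext (c.gf q q.2), fun y => Subtype.ext (c.fg y y.2)⟩, ?_, ?_⟩, ?_⟩
  · exact (continuousOn_iff_continuous_domRestrict.1 c.cf).subtype_mk _
  · exact (continuousOn_iff_continuous_domRestrict.1 c.cg).subtype_mk _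
  · intro q
    exact c.bd q q.2

theorem HasHalfChart.exists_halfChart {h : M → ℝ} {S D : Set X} {p : X}
    (hc : HasHalfChart h S D p) (hpS : p ∈ S) {N : Set X} (hN : IsOpen N) (hpN : p ∈ N) :
    ∃ U ⊆ N, IsOpen U ∧ p ∈ U ∧ ∀ U' ⊆ U, IsOpen U' → p ∈ U' →
      Nonempty (HalfChart h S D U') := by
  classical
  obtain ⟨U, V, hU, hpU, hV, e, he⟩ := hc
  refine ⟨U ∩ N, inter_subset_right, hU.inter hN, ⟨hpU, hpN⟩, fun U' hU' hoU' hpU' => ?_⟩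
  have hUU : U' ⊆ U := fun x hx => (hU' hx).1
  let f : X → M := fun x => if hx : x ∈ S ∩ U then (e ⟨x, hx⟩).1 else (e ⟨p, hpS, hpU⟩).1
  let g : M → X := fun y => if hy : y ∈ V ∩ {y | 0 ≤ h y} then (e.symm ⟨y, hy⟩).1 else p
  have hf : ∀ x (hx : x ∈ S ∩ U), f x = (e ⟨x, hx⟩).1 := fun x hx => dif_pos hx
  have hg : ∀ y (hy : y ∈ V ∩ {y | 0 ≤ h y}), g y = (e.symm ⟨y, hy⟩).1 := fun y hy => dif_pos hy
  have cf : ContinuousOn f (S ∩ U) := by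
    rw [continuousOn_iff_continuous_domRestrict]
    have : (S ∩ U).domRestrict f = fun x => (e x).1 := by ext x; exact hf x x.2
    rw [this]; exact continuous_subtype_val.comp e.continuous
  have cg : ContinuousOn g (V ∩ {y | 0 ≤ h y}) := by
    rw [continuousOn_iff_continuous_domRestrict]
    have : (V ∩ {y | 0 ≤ h y}).domRestrict g = fun x => (e.symm x).1 := by ext x; exact hg x x.2
    rw [this]; exact continuous_subtype_val.comp e.symm.continuous
  have hmf : ∀ x (hx : x ∈ S ∩ U), f x ∈ V ∩ {y | 0 ≤ h y} := fun x hx => by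
    rw [hf x hx]; exact (e _).2
  have hmg : ∀ y (hy : y ∈ V ∩ {y | 0 ≤ h y}), g y ∈ S ∩ U := fun y hy => by
    rw [hg y hy]; exact (e.symm _).2
  have hgf : ∀ x (hx : x ∈ S ∩ U), g (f x) = x := fun x hx => by
    rw [hg _ (hmf x hx)]
    have : (⟨f x, hmf x hx⟩ : ↥(V ∩ {y | 0 ≤ h y})) = e ⟨x, hx⟩ := Subtype.ext (hf x hx)
    rw [this, e.symm_apply_apply]
  have hfg : ∀ y (hy : y ∈ V ∩ {y | 0 ≤ h y}), f (g y) = y := fun y hy => by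
    rw [hf _ (hmg y hy)]
    have : (⟨g y, hmg y hy⟩ : ↥(S ∩ U)) = e.symm ⟨y, hy⟩ := Subtype.ext (hg y hy)
    rw [this, e.apply_symm_apply]
  obtain ⟨O, hO, hO'⟩ := continuousOn_iff'.1 cg U' hoU'
  have key : ∀ y, y ∈ V ∩ {y | 0 ≤ h y} → (y ∈ O ↔ g y ∈ U') := fun y hy => by
    have := Set.ext_iff.1 hO' y
    simp only [mem_inter_iff, mem_preimage] at this hy
    tauto
  exact ⟨{ V := V ∩ O, f := f, g := g, isOpen_V := hV.inter hO
           cf := cf.mono (inter_subset_inter_right _ hUU)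
           cg := cg.mono (fun y hy => ⟨hy.1.1, hy.2⟩)
           mf := fun q hq => by
            have h1 : q ∈ S ∩ U := ⟨hq.1, hUU hq.2⟩
            have h2 := hmf q h1
            refine ⟨⟨h2.1, (key _ h2).2 ?_⟩, h2.2⟩
            rw [hgf q h1]; exact hq.2
           mg := fun y hy => by
            have h2 : y ∈ V ∩ {y | 0 ≤ h y} := ⟨hy.1.1, hy.2⟩
            exact ⟨(hmg y h2).1, (key y h2).1 hy.1.2⟩
           gf := fun q hq => hgf q ⟨hq.1, hUU hq.2⟩
           fg := fun y hy => hfg y ⟨hy.1.1, hy.2⟩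
           bd := fun q hq => by
            have h1 : q ∈ S ∩ U := ⟨hq.1, hUU hq.2⟩
            rw [hf q h1]; exact he ⟨q, h1⟩ }⟩

/-- Having a half-space chart is local. -/
theorem HasHalfChart.congr {h : M → ℝ} {S D S' D' : Set X} {p : X} (hc : HasHalfChart h S D p)
    (hpS : p ∈ S) {N : Set X} (hN : IsOpen N) (hpN : p ∈ N) (hS : ∀ q ∈ N, q ∈ S ↔ q ∈ S')
    (hD : ∀ q ∈ N, q ∈ D ↔ q ∈ D') : HasHalfChart h S' D' p := by
  obtain ⟨U, hUN, hU, hpU, H⟩ := hc.exists_halfChart hpS hN hpN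
  obtain ⟨c⟩ := H U subset_rfl hU hpU
  have hSU : S' ∩ U = S ∩ U := by
    ext q; constructor
    · rintro ⟨a, b⟩; exact ⟨(hS q (hUN b)).2 a, b⟩
    · rintro ⟨a, b⟩; exact ⟨(hS q (hUN b)).1 a, b⟩
  have c' : HalfChart h S' D' U := 
    { V := c.V, f := c.f, g := c.g, isOpen_V := c.isOpen_V
      cf := hSU ▸ c.cf, cg := c.cg, mf := hSU ▸ c.mf, mg := hSU ▸ c.mg, gf := hSU ▸ c.gf
      fg := c.fg
      bd := fun q hq => by rw [← hD q (hUN hq.2)]; exact c.bd q (hSU ▸ hq) }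
  exact c'.hasHalfChart hU hpU

theorem HasHalfChart.image {Y : Type*} [TopologicalSpace Y] {h : M → ℝ} {S D : Set X} {p : X}
    (hc : HasHalfChart h S D p) (hpS : p ∈ S) (e : X ≃ₜ Y) :
    HasHalfChart h (e '' S) (e '' D) (e p) := by
  obtain ⟨U, -, hU, hpU, H⟩ := hc.exists_halfChart hpS isOpen_univ (mem_univ p)
  obtain ⟨c⟩ := H U subset_rfl hU hpU
  have hmem : ∀ {T : Set X} q, q ∈ e '' T ↔ e.symm q ∈ T := fun q => by
    constructor
    · rintro ⟨x, hx, rfl⟩; simpa using hx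
    · intro hq; exact ⟨_, hq, by simp⟩
  have c' : HalfChart h (e '' S) (e '' D) (e '' U) :=
    { V := c.V, f := c.f ∘ e.symm, g := e ∘ c.g, isOpen_V := c.isOpen_V
      cf := c.cf.comp e.symm.continuous.continuousOn (fun q hq => by
        exact ⟨(hmem q).1 hq.1, (hmem q).1 hq.2⟩)
      cg := e.continuous.comp_continuousOn c.cg
      mf := fun q hq => c.mf _ ⟨(hmem q).1 hq.1, (hmem q).1 hq.2⟩
      mg := fun y hy => ⟨⟨_, (c.mg y hy).1, rfl⟩, ⟨_, (c.mg y hy).2, rfl⟩⟩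
      gf := fun q hq => by
        simp [c.gf _ ⟨(hmem q).1 hq.1, (hmem q).1 hq.2⟩]
      fg := fun y hy => by simp [c.fg y hy]
      bd := fun q hq => by
        rw [hmem]; exact c.bd _ ⟨(hmem q).1 hq.1, (hmem q).1 hq.2⟩ }
  exact c'.hasHalfChart (e.isOpenMap U hU) ⟨p, hpU, rfl⟩

/-- The product of a curve with an interval is a surface. -/
theorem IsCurve.prod_Icc {O B : Set X} (hO : IsCurve O B) :
    IsSurface (O ×ˢ Icc (0 : ℝ) 1) (O ×ˢ {0} ∪ B ×ˢ Icc 0 1 ∪ O ×ˢ {1}) := by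
  -- charts in which `k t` is the distance of the height `t` to one of the ends
  have main : ∀ k : ℝ → ℝ, Continuous k → (∀ t, k (k t) = t) → (∀ t, t ∈ Icc (0 : ℝ) 1 ↔
      k t ∈ Icc (0 : ℝ) 1) → ∀ p ∈ O ×ˢ Icc (0 : ℝ) 1, k p.2 < 1 →
      HasHalfChart (fun y : ℝ × ℝ => y.2) (O ×ˢ Icc (0 : ℝ) 1)
        {q | q.1 ∈ O ∧ q.2 ∈ Icc (0 : ℝ) 1 ∧ (k q.2 = 0 ∨ q.1 ∈ B)} p := by
    intro k hk hkk hkI p hp hp1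
    obtain ⟨U, -, hU, hpU, H⟩ := (hO.2 p.1 hp.1).exists_halfChart hp.1 isOpen_univ (mem_univ _)
    obtain ⟨c⟩ := H U subset_rfl hU hpU
    have hmin : ∀ a b : ℝ, min a b + max (a - b) 0 = a := fun a b => by
      rcases le_total a b with h | h
      · rw [min_eq_left h, max_eq_right (by linarith)]; ring
      · rw [min_eq_right h, max_eq_left (by linarith)]; ring
    have hmin' : ∀ a b : ℝ, min a b + max (-(a - b)) 0 = b := fun a b => by
      rcases le_total a b with h | h
      · rw [min_eq_left h, max_eq_left (by linarith)]; ring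
      · rw [min_eq_right h, max_eq_right (by linarith)]; ring
    have hmin2 : ∀ u v : ℝ, min (v + max u 0) (v + max (-u) 0) = v := fun u v => by
      rcases le_total u 0 with h | h
      · rw [max_eq_right h, max_eq_left (by linarith), min_eq_left (by linarith)]; ring
      · rw [max_eq_left h, max_eq_right (by linarith), min_eq_right (by linarith)]; ring
    have hdiff : ∀ u v : ℝ, (v + max u 0) - (v + max (-u) 0) = u := fun u v => by
      rcases le_total u 0 with h | h
      · rw [max_eq_right h, max_eq_left (by linarith)]; ring
      · rw [max_eq_left h, max_eq_right (by linarith)]; ring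
    have hadd : ∀ u v : ℝ, 0 ≤ v → 0 ≤ v + max u 0 := fun u v hv =>
      add_nonneg hv (le_max_right _ _)
    have c' : HalfChart (fun y : ℝ × ℝ => y.2) (O ×ˢ Icc (0 : ℝ) 1)
        {q | q.1 ∈ O ∧ q.2 ∈ Icc (0 : ℝ) 1 ∧ (k q.2 = 0 ∨ q.1 ∈ B)} {q | q.1 ∈ U ∧ k q.2 < 1} :=
      { V := {y | y.2 + max y.1 0 ∈ c.V ∧ y.2 + max (-y.1) 0 < 1}
        f := fun q => (c.f q.1 - k q.2, min (c.f q.1) (k q.2))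
        g := fun y => (c.g (y.2 + max y.1 0), k (y.2 + max (-y.1) 0))
        isOpen_V := by
          have h1 : Continuous fun y : ℝ × ℝ => y.2 + max y.1 0 := by fun_prop
          have h2 : Continuous fun y : ℝ × ℝ => y.2 + max (-y.1) 0 := by fun_prop
          exact (c.isOpen_V.preimage h1).inter (isOpen_lt h2 continuous_const)
        cf := by
          have h1 : ContinuousOn (fun q : X × ℝ => c.f q.1)
              (O ×ˢ Icc (0 : ℝ) 1 ∩ {q | q.1 ∈ U ∧ k q.2 < 1}) :=
            c.cf.comp continuousOn_fst (fun q hq => ⟨hq.1.1, hq.2.1⟩)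
          have h2 : Continuous (fun q : X × ℝ => k q.2) := by fun_prop
          exact (h1.sub h2.continuousOn).prodMk (h1.inf h2.continuousOn)
        cg := by
          refine ContinuousOn.prodMk (c.cg.comp (by fun_prop) ?_) (by fun_prop)
          rintro y ⟨hy, hy2⟩
          exact ⟨hy.1, hadd _ _ hy2⟩
        mf := fun q hq => by
          have h1 := c.mf q.1 ⟨hq.1.1, hq.2.1⟩
          have h2 := (hkI _).1 hq.1.2
          refine ⟨⟨?_, ?_⟩, le_min h1.2 h2.1⟩
          · simp only [hmin]; exact h1.1
          · simp only [hmin']; exact hq.2.2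
        mg := fun y hy => by
          have h1 := c.mg (y.2 + max y.1 0) ⟨hy.1.1, hadd _ _ hy.2⟩
          have h3 : y.2 + max (-y.1) 0 < 1 := hy.1.2
          have h4 : 0 ≤ y.2 + max (-y.1) 0 := add_nonneg hy.2 (le_max_right _ _)
          refine ⟨⟨h1.1, (hkI _).2 ?_⟩, h1.2, ?_⟩
          · simp only [hkk]; exact ⟨h4, h3.le⟩
          · simp only [hkk]; exact h3
        gf := fun q hq => by
          simp only [hmin, hmin', hkk, c.gf q.1 ⟨hq.1.1, hq.2.1⟩]
        fg := fun y hy => by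
          have h1 := c.fg (y.2 + max y.1 0) ⟨hy.1.1, hadd _ _ hy.2⟩
          simp only [hkk, h1, hmin2, hdiff]
        bd := fun q hq => by
          have h1 := c.bd q.1 ⟨hq.1.1, hq.2.1⟩
          have h2 : 0 ≤ c.f q.1 := (c.mf q.1 ⟨hq.1.1, hq.2.1⟩).2
          have h3 := ((hkI _).1 hq.1.2).1
          simp only [mem_ofPred_eq, h1, hq.1.1, hq.1.2, true_and]
          constructor
          · rintro (h | h)
            · rw [h]; exact min_eq_right h2
            · rw [h]; exact min_eq_left h3
          · intro h
            rcases min_choice (c.f q.1) (k q.2) with h' | h'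
            · exact .inr (h'.symm.trans h)
            · exact .inl (h'.symm.trans h) }
    exact c'.hasHalfChart ((hU.preimage continuous_fst).inter
      (isOpen_lt (hk.comp continuous_snd) continuous_const)) ⟨hpU, hp1⟩
  refine ⟨?_, ?_⟩
  · rintro ⟨x, t⟩ ((⟨h1, h2⟩ | ⟨h1, h2⟩) | ⟨h1, h2⟩)
    · exact ⟨h1, by rw [show t = 0 from h2]; simp⟩
    · exact ⟨hO.1 h1, h2⟩
    · exact ⟨h1, by rw [show t = 1 from h2]; simp⟩
  · rintro p hp
    rcases lt_or_ge p.2 1 with h | h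
    · refine (main id continuous_id (fun _ => rfl) (fun _ => Iff.rfl) p hp h).congr hp
        (N := {q | q.2 < 1}) (isOpen_lt continuous_snd continuous_const) h (fun _ _ => Iff.rfl) ?_
      rintro ⟨x, t⟩ ht
      have ht : t < 1 := ht
      simp only [id, mem_ofPred_eq, mem_union, mem_prod, mem_singleton_iff, ht.ne, and_false,
        or_false]
      constructor
      · rintro ⟨h1, h2, h3 | h3⟩
        exacts [.inl ⟨h1, h3⟩, .inr ⟨h3, h2⟩]
      · rintro (⟨h1, rfl⟩ | ⟨h1, h2⟩)
        exacts [⟨h1, by simp, .inl rfl⟩, ⟨hO.1 h1, h2, .inr h1⟩]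
    · refine (main (fun t => 1 - t) (by fun_prop) (fun _ => by ring) (fun t => ?_) p hp
        (by linarith)).congr hp (N := {q | 0 < q.2}) (isOpen_lt continuous_const continuous_snd)
        (by simp only [mem_ofPred_eq]; linarith) (fun _ _ => Iff.rfl) ?_
      · simp only [mem_Icc]; constructor <;> rintro ⟨h1, h2⟩ <;> constructor <;> linarith
      rintro ⟨x, t⟩ ht
      have ht : 0 < t := ht
      simp only [mem_ofPred_eq, mem_union, mem_prod, mem_singleton_iff, ht.ne', and_false,
        false_or, sub_eq_zero]
      constructor
      · rintro ⟨h1, h2, h3 | h3⟩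
        exacts [.inr ⟨h1, h3.symm⟩, .inl ⟨h3, h2⟩]
      · rintro (⟨h1, h2⟩ | ⟨h1, rfl⟩)
        exacts [⟨hO.1 h1, h2, .inr h1⟩, ⟨h1, by simp, .inl rfl⟩]

end
section glue
variable {X M : Type*} [TopologicalSpace X] [TopologicalSpace M]

theorem continuousOn_of_closed_cover {Y : Type*} [TopologicalSpace Y]
    {f : X → Y} {S A C : Set X} (hA : IsClosed A) (hC : IsClosed C) (hS : S ⊆ A ∪ C)
    (h1 : ContinuousOn f (S ∩ A)) (h2 : ContinuousOn f (S ∩ C)) : ContinuousOn f S := by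
  have hS' : S = (S ∩ A) ∪ (S ∩ C) := by rw [← inter_union_distrib_left, inter_eq_left.2 hS]
  have aux : ∀ T : Set X, IsClosed T → ContinuousOn f (S ∩ T) → ∀ x ∈ S,
      ContinuousWithinAt f (S ∩ T) x := fun T hT hc x hx => by
    by_cases hxT : x ∈ T
    · exact hc x ⟨hx, hxT⟩
    · refine continuousWithinAt_of_notMem_closure fun hcl => hxT ?_
      exact hT.closure_subset_iff.2 inter_subset_right hcl
  intro x hx
  rw [hS']
  exact (aux A hA h1 x hx).union (aux C hC h2 x hx)

/-- Away from the boundary it is enough to have a chart to an open subset of the model space, which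
is itself homeomorphic to the open half-space. -/
theorem hasHalfChart_of_open {h : M → ℝ} (E L : M → M) (hE : Continuous E)
    (hho : IsOpen {y | 0 < h y}) (hL : ContinuousOn L {y | 0 < h y}) (hLE : ∀ y, L (E y) = y)
    (hhE : ∀ y, 0 < h (E y)) (hEL : ∀ y, 0 < h y → E (L y) = y)
    {S D U : Set X} {V : Set M} {f : X → M} {g : M → X} {p : X} (hU : IsOpen U) (hp : p ∈ U)
    (hV : IsOpen V) (cf : ContinuousOn f (S ∩ U)) (cg : ContinuousOn g V)
    (mf : ∀ q ∈ S ∩ U, f q ∈ V) (mg : ∀ y ∈ V, g y ∈ S ∩ U) (gf : ∀ q ∈ S ∩ U, g (f q) = q)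
    (fg : ∀ y ∈ V, f (g y) = y) (hD : ∀ q ∈ U, q ∉ D) : HasHalfChart h S D p := by
  have c : HalfChart h S D U :=
    { V := {y | 0 < h y} ∩ L ⁻¹' V, f := E ∘ f, g := g ∘ L
      isOpen_V := hL.isOpen_inter_preimage hho hV
      cf := hE.comp_continuousOn cf
      cg := cg.comp (hL.mono fun y hy => hy.1.1) fun y hy => hy.1.2
      mf := fun q hq => ⟨⟨hhE _, by
        show L (E (f q)) ∈ V
        rw [hLE]; exact mf q hq⟩, (hhE _).le⟩
      mg := fun y hy => mg _ hy.1.2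
      gf := fun q hq => by
        show g (L (E (f q))) = q
        rw [hLE, gf q hq]
      fg := fun y hy => by
        show E (f (g (L y))) = y
        rw [fg _ hy.1.2, hEL y hy.1.1]
      bd := fun q hq => iff_of_false (hD q hq.2) (hhE _).ne' }
  exact c.hasHalfChart hU hp

/-- Two curves glued at a common end point. -/
theorem hasHalfChart_glue_curve {S₁ S₂ D₁ D₂ D : Set X} {b : X} (h₁ : IsClosed S₁)
    (h₂ : IsClosed S₂) (c₁ : HasHalfChart (fun y : ℝ => y) S₁ D₁ b)
    (c₂ : HasHalfChart (fun y : ℝ => y) S₂ D₂ b) (hb₁ : b ∈ S₁) (hb₂ : b ∈ S₂) {N : Set X}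
    (hN : IsOpen N) (hbN : b ∈ N) (hS : ∀ q ∈ N, q ∈ S₁ → q ∈ S₂ → q = b)
    (hD₁ : b ∈ D₁) (hD₂ : ∀ q ∈ N, q ∈ D₂ ↔ q = b) (hD : ∀ q ∈ N, q ∉ D) :
    HasHalfChart (fun y : ℝ => y) (S₁ ∪ S₂) D b := by
  classical
  obtain ⟨U₁, hUN, hU₁, hbU₁, H₁⟩ := c₁.exists_halfChart hb₁ hN hbN
  obtain ⟨U₂, -, hU₂, hbU₂, H₂⟩ := c₂.exists_halfChart hb₂ hN hbN
  obtain ⟨e⟩ := H₁ (U₁ ∩ U₂) inter_subset_left (hU₁.inter hU₂) ⟨hbU₁, hbU₂⟩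
  obtain ⟨e'⟩ := H₂ (U₁ ∩ U₂) inter_subset_right (hU₁.inter hU₂) ⟨hbU₁, hbU₂⟩
  set U := U₁ ∩ U₂ with hUdef
  have hbU : b ∈ U := ⟨hbU₁, hbU₂⟩
  have hU : IsOpen U := hU₁.inter hU₂
  have hUN : U ⊆ N := fun q hq => hUN hq.1
  have f0 : e.f b = 0 := (e.bd b ⟨hb₁, hbU⟩).1 hD₁
  have f0' : e'.f b = 0 := (e'.bd b ⟨hb₂, hbU⟩).1 ((hD₂ b hbN).2 rfl)
  have z : (0 : ℝ) ∈ e.V := f0 ▸ (e.mf b ⟨hb₁, hbU⟩).1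
  have z' : (0 : ℝ) ∈ e'.V := f0' ▸ (e'.mf b ⟨hb₂, hbU⟩).1
  have g0 : e.g 0 = b := by rw [← f0, e.gf b ⟨hb₁, hbU⟩]
  have g0' : e'.g 0 = b := by rw [← f0', e'.gf b ⟨hb₂, hbU⟩]
  have pos' : ∀ q ∈ S₂ ∩ U, q ∉ S₁ → 0 < e'.f q := fun q hq hq1 => by
    have h1 : 0 ≤ e'.f q := (e'.mf q hq).2
    refine h1.lt_of_ne fun h2 => hq1 ?_
    rw [(hD₂ q (hUN hq.2)).1 ((e'.bd q hq).2 h2.symm)]; exact hb₁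
  let F : X → ℝ := fun q => if q ∈ S₁ then e.f q else - e'.f q
  let G : ℝ → X := fun y => if 0 ≤ y then e.g y else e'.g (-y)
  have F2 : ∀ q ∈ S₂ ∩ U, F q = - e'.f q := fun q hq => by
    by_cases h : q ∈ S₁
    · obtain rfl := hS q (hUN hq.2) h hq.1
      simp only [F, if_pos h, f0, f0', neg_zero]
    · exact if_neg h
  have G2 : ∀ y ≤ 0, G y = e'.g (-y) := fun y hy => by
    rcases hy.lt_or_eq with h | rfl
    · exact if_neg (not_le.2 h)
    · simp only [G, le_refl, if_true, neg_zero, g0, g0']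
  let A : Set ℝ := {y | -y ∈ e'.V}
  have hA : IsOpen A := e'.isOpen_V.preimage continuous_neg
  let V : Set ℝ := (e.V ∩ {y | 0 < y}) ∪ (e.V ∩ A) ∪ (A ∩ {y | y < 0})
  have hV : IsOpen V := ((e.isOpen_V.inter isOpen_Ioi).union (e.isOpen_V.inter hA)).union
    (hA.inter isOpen_Iio)
  have V1 : ∀ y ∈ V, 0 ≤ y → y ∈ e.V := by
    rintro y ((h | h) | h) hy
    exacts [h.1, h.1, absurd h.2 (not_lt.2 hy)]
  have V2 : ∀ y ∈ V, y ≤ 0 → -y ∈ e'.V := by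
    rintro y ((h | h) | h) hy
    exacts [absurd h.2 (not_lt.2 hy), h.2, h.1]
  refine hasHalfChart_of_open (V := V) (f := F) (g := G) (fun y : ℝ => Real.exp y) Real.log
    (by fun_prop) isOpen_Ioi (Real.continuousOn_log.mono fun y hy => (ne_of_gt hy)) Real.log_exp
    Real.exp_pos (fun y hy => Real.exp_log hy) hU hbU hV ?_ ?_ ?_ ?_ ?_ ?_
    (fun q hq => hD q (hUN hq))
  · refine continuousOn_of_closed_cover h₁ h₂ (fun q hq => hq.1) ?_ ?_
    · exact (e.cf.mono fun q hq => ⟨hq.2, hq.1.2⟩).congr fun q hq => if_pos hq.2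
    · exact (e'.cf.mono fun q hq => ⟨hq.2, hq.1.2⟩).neg.congr fun q hq => F2 q ⟨hq.2, hq.1.2⟩
  · refine continuousOn_of_closed_cover isClosed_Ici isClosed_Iic
      (fun y _ => (le_total 0 y).imp id id) ?_ ?_ (A := Ici 0) (C := Iic 0)
    · exact (e.cg.mono fun y hy => ⟨V1 y hy.1 hy.2, hy.2⟩).congr fun y hy => if_pos hy.2
    · refine (e'.cg.comp (f := fun y : ℝ => -y) continuousOn_neg fun y hy =>
        ⟨V2 y hy.1 hy.2, ?_⟩).congr fun y hy => G2 y hy.2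
      have : y ≤ 0 := hy.2
      show 0 ≤ -y
      linarith
  · rintro q ⟨hq, hqU⟩
    by_cases h : q ∈ S₁
    · rw [show F q = e.f q from if_pos h]
      have h1 := e.mf q ⟨h, hqU⟩
      have h2 : 0 ≤ e.f q := h1.2
      rcases h2.lt_or_eq with h3 | h3
      · exact .inl (.inl ⟨h1.1, h3⟩)
      · exact .inl (.inr ⟨h1.1, by rw [← h3]; show -0 ∈ e'.V; rwa [neg_zero]⟩)
    · have hq2 : q ∈ S₂ ∩ U := ⟨hq.resolve_left h, hqU⟩
      rw [F2 q hq2]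
      refine .inr ⟨?_, ?_⟩
      · show - - e'.f q ∈ e'.V
        rw [neg_neg]; exact (e'.mf q hq2).1
      · have := pos' q hq2 h
        show - e'.f q < 0
        linarith
  · intro y hy
    rcases le_or_gt 0 y with h | h
    · rw [show G y = e.g y from if_pos h]
      have := e.mg y ⟨V1 y hy h, h⟩
      exact ⟨.inl this.1, this.2⟩
    · rw [G2 y h.le]
      have := e'.mg (-y) ⟨V2 y hy h.le, by show 0 ≤ -y; linarith⟩
      exact ⟨.inr this.1, this.2⟩
  · rintro q ⟨hq, hqU⟩
    by_cases h : q ∈ S₁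
    · have h2 : 0 ≤ e.f q := (e.mf q ⟨h, hqU⟩).2
      rw [show F q = e.f q from if_pos h, show G (e.f q) = e.g (e.f q) from if_pos h2]
      exact e.gf q ⟨h, hqU⟩
    · have hq2 : q ∈ S₂ ∩ U := ⟨hq.resolve_left h, hqU⟩
      have := pos' q hq2 h
      rw [F2 q hq2, G2 _ (by linarith), neg_neg, e'.gf q hq2]
  · intro y hy
    rcases le_or_gt 0 y with h | h
    · rw [show G y = e.g y from if_pos h]
      have := e.mg y ⟨V1 y hy h, h⟩
      rw [show F (e.g y) = e.f (e.g y) from if_pos this.1]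
      exact e.fg y ⟨V1 y hy h, h⟩
    · have hy' : -y ∈ e'.V ∩ {y | 0 ≤ y} := ⟨V2 y hy h.le, by show 0 ≤ -y; linarith⟩
      rw [G2 y h.le, F2 _ (e'.mg _ hy'), e'.fg _ hy', neg_neg]

/-- A surface glued to a vertical curtain along a vertical boundary line. -/
theorem hasHalfChart_glue_surface {S₁ D₁ D : Set (X × ℝ)} {S₂ D₂ : Set X} {b : X} {t : ℝ}
    (h₁ : IsClosed S₁) (h₂ : IsClosed S₂)
    (c₁ : HasHalfChart (fun y : ℝ × ℝ => y.2) S₁ D₁ (b, t))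
    (c₂ : HasHalfChart (fun y : ℝ => y) S₂ D₂ b) (hb₁ : (b, t) ∈ S₁) (hb₂ : b ∈ S₂) {N : Set X}
    (hN : IsOpen N) (hbN : b ∈ N) (ht0 : 0 < t) (ht1 : t < 1)
    (hS : ∀ q ∈ N ×ˢ Ioo (0 : ℝ) 1, q ∈ S₁ → q.1 ∈ S₂ → q.1 = b)
    (hDS : D₁ ⊆ S₁)
    (hD₁ : ∀ q ∈ N ×ˢ Ioo (0 : ℝ) 1, q ∈ D₁ ↔ q.1 = b)
    (hD₂ : ∀ q ∈ N, q ∈ D₂ ↔ q = b) (hD : ∀ q ∈ N ×ˢ Ioo (0 : ℝ) 1, q ∉ D) :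
    HasHalfChart (fun y : ℝ × ℝ => y.2) (S₁ ∪ S₂ ×ˢ Icc 0 1) D (b, t) := by
  classical
  obtain ⟨U₁, hUN, hU₁, hbU₁, H₁⟩ := c₁.exists_halfChart hb₁ (hN.prod isOpen_Ioo)
    (show (b, t) ∈ N ×ˢ Ioo (0 : ℝ) 1 from ⟨hbN, ht0, ht1⟩)
  obtain ⟨U₂, -, hU₂, hbU₂, H₂⟩ := c₂.exists_halfChart hb₂ hN hbN
  obtain ⟨N₁, T, hN₁, hT, hbN₁, htT, hbox⟩ := isOpen_prod_iff.1 hU₁ b t hbU₁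
  have hbox' : (N₁ ∩ U₂) ×ˢ T ⊆ U₁ := fun q hq => hbox ⟨hq.1.1, hq.2⟩
  have hN' : IsOpen (N₁ ∩ U₂) := hN₁.inter hU₂
  obtain ⟨e⟩ := H₁ _ hbox' (hN'.prod hT) ⟨⟨hbN₁, hbU₂⟩, htT⟩
  obtain ⟨e'⟩ := H₂ (N₁ ∩ U₂) inter_subset_right hN' ⟨hbN₁, hbU₂⟩
  set N' := N₁ ∩ U₂ with hNdef
  have hbN' : b ∈ N' := ⟨hbN₁, hbU₂⟩
  have hUN : N' ×ˢ T ⊆ N ×ˢ Ioo (0 : ℝ) 1 := hbox'.trans hUN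
  have hTI : ∀ s ∈ T, s ∈ Ioo (0 : ℝ) 1 := fun s hs =>
    (hUN (show (b, s) ∈ N' ×ˢ T from ⟨hbN', hs⟩)).2
  have hN'N : ∀ x ∈ N', x ∈ N := fun x hx => (hUN (show (x, t) ∈ N' ×ˢ T from ⟨hx, htT⟩)).1
  -- the boundary line
  have lineD : ∀ s ∈ T, (b, s) ∈ D₁ := fun s hs => (hD₁ _ ⟨hbN, hTI s hs⟩).2 rfl
  have lineS : ∀ s ∈ T, (b, s) ∈ S₁ ∩ N' ×ˢ T := fun s hs => ⟨hDS (lineD s hs), hbN', hs⟩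
  have linef : ∀ s ∈ T, (e.f (b, s)).2 = 0 := fun s hs => (e.bd _ (lineS s hs)).1 (lineD s hs)
  have linef' : ∀ s ∈ T, ((e.f (b, s)).1, (0 : ℝ)) = e.f (b, s) := fun s hs =>
    Prod.ext rfl (linef s hs).symm
  have lineg : ∀ u : ℝ, (u, (0 : ℝ)) ∈ e.V → (e.g (u, 0)).1 = b ∧ (e.g (u, 0)).2 ∈ T ∧
      e.f (b, (e.g (u, 0)).2) = (u, 0) := fun u hu => by
    have hu' : (u, (0 : ℝ)) ∈ e.V ∩ {y | 0 ≤ y.2} := ⟨hu, le_refl (0 : ℝ)⟩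
    have h1 := e.mg _ hu'
    have h2 := (e.bd _ h1).2 (by rw [e.fg _ hu'])
    have h3 := (hD₁ _ (hUN h1.2)).1 h2
    refine ⟨h3, h1.2.2, ?_⟩
    rw [show (b, (e.g (u, 0)).2) = e.g (u, 0) from Prod.ext h3.symm rfl, e.fg _ hu']
  have f0' : e'.f b = 0 := (e'.bd b ⟨hb₂, hbN'⟩).1 ((hD₂ b hbN).2 rfl)
  have z' : (0 : ℝ) ∈ e'.V := f0' ▸ (e'.mf b ⟨hb₂, hbN'⟩).1
  have g0' : e'.g 0 = b := by rw [← f0', e'.gf b ⟨hb₂, hbN'⟩]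
  have pos' : ∀ q ∈ (S₂ ×ˢ Icc (0 : ℝ) 1) ∩ N' ×ˢ T, q ∉ S₁ → 0 < e'.f q.1 :=
    fun q hq hq1 => by
      have h1 : 0 ≤ e'.f q.1 := (e'.mf q.1 ⟨hq.1.1, hq.2.1⟩).2
      refine h1.lt_of_ne fun h2 => hq1 ?_
      have h3 := (hD₂ q.1 (hN'N _ hq.2.1)).1 ((e'.bd q.1 ⟨hq.1.1, hq.2.1⟩).2 h2.symm)
      rw [show q = (b, q.2) from Prod.ext h3 rfl]
      exact (lineS _ hq.2.2).1
  let F : X × ℝ → ℝ × ℝ := fun q => if q ∈ S₁ then e.f q else ((e.f (b, q.2)).1, - e'.f q.1)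
  let G : ℝ × ℝ → X × ℝ := fun y => if 0 ≤ y.2 then e.g y else (e'.g (-y.2), (e.g (y.1, 0)).2)
  let A : Set (ℝ × ℝ) := {y | (y.1, (0 : ℝ)) ∈ e.V ∧ -y.2 ∈ e'.V}
  have hA : IsOpen A := by
    have h1 : Continuous fun y : ℝ × ℝ => (y.1, (0 : ℝ)) := by fun_prop
    have h2 : Continuous fun y : ℝ × ℝ => -y.2 := by fun_prop
    exact (e.isOpen_V.preimage h1).inter (e'.isOpen_V.preimage h2)
  let V : Set (ℝ × ℝ) := (e.V ∩ {y | 0 < y.2}) ∪ (e.V ∩ A) ∪ (A ∩ {y | y.2 < 0})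
  have hpos : IsOpen {y : ℝ × ℝ | 0 < y.2} := isOpen_lt continuous_const continuous_snd
  have hV : IsOpen V := ((e.isOpen_V.inter hpos).union (e.isOpen_V.inter hA)).union
    (hA.inter (isOpen_lt continuous_snd continuous_const))
  have V1 : ∀ y ∈ V, 0 ≤ y.2 → y ∈ e.V ∩ {y | 0 ≤ y.2} := by
    rintro y ((h | h) | h) hy
    exacts [⟨h.1, hy⟩, ⟨h.1, hy⟩, absurd h.2 (not_lt.2 hy)]
  have V2 : ∀ y ∈ V, y.2 ≤ 0 → y ∈ A := by
    rintro y ((h | h) | h) hy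
    exacts [absurd h.2 (not_lt.2 hy), h.2, h.1]
  have F2 : ∀ q ∈ (S₂ ×ˢ Icc (0 : ℝ) 1) ∩ N' ×ˢ T, F q = ((e.f (b, q.2)).1, - e'.f q.1) :=
    fun q hq => by
      by_cases h : q ∈ S₁
      · have h2 := hS q (hUN hq.2) h hq.1.1
        have h3 : q = (b, q.2) := Prod.ext h2 rfl
        rw [show F q = e.f q from if_pos h, h2, f0', neg_zero, linef' _ hq.2.2, ← h3]
      · exact if_neg h
  have G2 : ∀ y ∈ V, y.2 ≤ 0 → G y = (e'.g (-y.2), (e.g (y.1, 0)).2) := fun y hyV hy => by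
    rcases hy.lt_or_eq with h | h
    · exact if_neg (not_le.2 h)
    · rw [show G y = e.g y from if_pos h.ge, h, neg_zero, g0',
        ← (lineg _ (V2 y hyV hy).1).1, show (y.1, (0 : ℝ)) = y from Prod.ext rfl h.symm]
  have expc : Continuous fun y : ℝ × ℝ => (y.1, Real.exp y.2) := by fun_prop
  refine hasHalfChart_of_open (V := V) (f := F) (g := G) (fun y : ℝ × ℝ => (y.1, Real.exp y.2))
    (fun y => (y.1, Real.log y.2)) expc hpos ?_ (fun y => by simp) (fun y => Real.exp_pos _)
    (fun y hy => Prod.ext rfl (Real.exp_log hy)) (hN'.prod hT) ⟨hbN', htT⟩ hV ?_ ?_ ?_ ?_ ?_ ?_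
    (fun q hq => hD q (hUN hq))
  · exact continuousOn_fst.prodMk (continuousOn_snd.log fun y hy => (ne_of_gt hy))
  · refine continuousOn_of_closed_cover h₁ (h₂.preimage continuous_fst)
      (fun q hq => hq.1.imp id fun h => h.1) ?_ ?_
    · exact (e.cf.mono fun q hq => ⟨hq.2, hq.1.2⟩).congr fun q hq => if_pos hq.2
    · have hmem : ∀ q ∈ (S₁ ∪ S₂ ×ˢ Icc (0 : ℝ) 1) ∩ N' ×ˢ T ∩ Prod.fst ⁻¹' S₂,
          q ∈ (S₂ ×ˢ Icc (0 : ℝ) 1) ∩ N' ×ˢ T := fun q hq =>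
        ⟨⟨hq.2, Ioo_subset_Icc_self (hTI _ hq.1.2.2)⟩, hq.1.2⟩
      refine ContinuousOn.congr ?_ fun q hq => F2 q (hmem q hq)
      refine ContinuousOn.prodMk ?_ (ContinuousOn.neg ?_)
      · refine continuous_fst.comp_continuousOn (e.cf.comp (f := fun q : X × ℝ => (b, q.2))
          (by fun_prop) fun q hq => lineS _ hq.1.2.2)
      · exact e'.cf.comp continuousOn_fst fun q hq => ⟨hq.2, hq.1.2.1⟩
  · refine continuousOn_of_closed_cover (A := {y : ℝ × ℝ | 0 ≤ y.2}) (C := {y | y.2 ≤ 0})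
      (isClosed_le continuous_const continuous_snd) (isClosed_le continuous_snd continuous_const)
      (fun y _ => (le_total 0 y.2).imp id id) ?_ ?_
    · exact (e.cg.mono fun y hy => V1 y hy.1 hy.2).congr fun y hy => if_pos hy.2
    · refine ContinuousOn.congr ?_ fun y hy => G2 y hy.1 hy.2
      refine ContinuousOn.prodMk ?_ (continuous_snd.comp_continuousOn ?_)
      · refine e'.cg.comp (f := fun y : ℝ × ℝ => -y.2) (by fun_prop) fun y hy =>
          ⟨(V2 y hy.1 hy.2).2, ?_⟩
        have : y.2 ≤ 0 := hy.2
        show 0 ≤ -y.2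
        linarith
      · exact e.cg.comp (f := fun y : ℝ × ℝ => (y.1, (0 : ℝ))) (by fun_prop) fun y hy =>
          ⟨(V2 y hy.1 hy.2).1, le_refl (0 : ℝ)⟩
  · rintro q ⟨hq, hqU⟩
    by_cases h : q ∈ S₁
    · rw [show F q = e.f q from if_pos h]
      have h1 := e.mf q ⟨h, hqU⟩
      have h2 : 0 ≤ (e.f q).2 := h1.2
      rcases h2.lt_or_eq with h3 | h3
      · exact .inl (.inl ⟨h1.1, h3⟩)
      · refine .inl (.inr ⟨h1.1, ?_, ?_⟩)
        · rw [show ((e.f q).1, (0 : ℝ)) = e.f q from Prod.ext rfl h3]; exact h1.1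
        · rw [← h3, neg_zero]; exact z'
    · have hq2 : q ∈ (S₂ ×ˢ Icc (0 : ℝ) 1) ∩ N' ×ˢ T := ⟨hq.resolve_left h, hqU⟩
      rw [F2 q hq2]
      refine .inr ⟨⟨?_, ?_⟩, ?_⟩
      · simp only [linef' _ hqU.2]; exact (e.mf _ (lineS _ hqU.2)).1
      · simp only [neg_neg]; exact (e'.mf _ ⟨hq2.1.1, hqU.1⟩).1
      · have := pos' q hq2 h
        show - e'.f q.1 < 0
        linarith
  · intro y hy
    rcases le_or_gt 0 y.2 with h | h
    · rw [show G y = e.g y from if_pos h]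
      have := e.mg y (V1 y hy h)
      exact ⟨.inl this.1, this.2⟩
    · rw [G2 y hy h.le]
      have h1 := V2 y hy h.le
      have h2 := e'.mg (-y.2) ⟨h1.2, by show 0 ≤ -y.2; linarith⟩
      have h3 := (lineg _ h1.1).2.1
      exact ⟨.inr ⟨h2.1, Ioo_subset_Icc_self (hTI _ h3)⟩, h2.2, h3⟩
  · rintro q ⟨hq, hqU⟩
    by_cases h : q ∈ S₁
    · have h2 : 0 ≤ (e.f q).2 := (e.mf q ⟨h, hqU⟩).2
      rw [show F q = e.f q from if_pos h, show G (e.f q) = e.g (e.f q) from if_pos h2]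
      exact e.gf q ⟨h, hqU⟩
    · have hq2 : q ∈ (S₂ ×ˢ Icc (0 : ℝ) 1) ∩ N' ×ˢ T := ⟨hq.resolve_left h, hqU⟩
      have := pos' q hq2 h
      have hn : ¬ (0 : ℝ) ≤ - e'.f q.1 := by linarith
      rw [F2 q hq2]
      simp only [G, if_neg hn, neg_neg, e'.gf _ ⟨hq2.1.1, hqU.1⟩, linef' _ hqU.2,
        e.gf _ (lineS _ hqU.2)]
  · intro y hy
    rcases le_or_gt 0 y.2 with h | h
    · rw [show G y = e.g y from if_pos h]
      have := e.mg y (V1 y hy h)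
      rw [show F (e.g y) = e.f (e.g y) from if_pos this.1]
      exact e.fg y (V1 y hy h)
    · have h1 := V2 y hy h.le
      have h2 : -y.2 ∈ e'.V ∩ {y | 0 ≤ y} := ⟨h1.2, by show 0 ≤ -y.2; linarith⟩
      have h3 := e'.mg (-y.2) h2
      have h4 := lineg _ h1.1
      rw [G2 y hy h.le, F2 (e'.g (-y.2), (e.g (y.1, 0)).2) ⟨⟨h3.1, Ioo_subset_Icc_self (hTI _ h4.2.1)⟩, h3.2, h4.2.1⟩]
      simp only [h4.2.2, e'.fg _ h2, neg_neg]

end glue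
end PL

namespace Khovanov
open PL

abbrev Plane : Type := ℝ × ℝ
abbrev Space : Type := Plane × ℝ

/-- The cylinder over a planar region. -/
def cyl (W : Set Plane) : Set Space := W ×ˢ Icc 0 1

/-- A piecewise linear disk in the plane: the image of a square (a ball of the sup norm) under a
piecewise linear homeomorphism of the plane. -/
def IsDisk (W : Set Plane) : Prop :=
  ∃ h : Plane ≃ₜ Plane, IsPLOn h univ ∧ W = h '' Metric.closedBall 0 1

/-- A smoothing in the region `W` with boundary `B`: a compact polygonal 1-manifold in `W` with
boundary `B`, which meets the frontier of `W` in `B` only. -/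
structure Smoothing (W : Set Plane) (B : Finset Plane) where
  carrier : Set Plane
  isPolyhedron : IsPolyhedron carrier
  subset : carrier ⊆ W
  inter_frontier : carrier ∩ frontier W = B
  isCurve : IsCurve carrier B

variable {W : Set Plane} {B : Finset Plane}

/-- The prescribed boundary `O × {0} ∪ B × [0,1] ∪ O' × {1}` of a cobordism. -/
def cobBoundary (O : Set Plane) (B : Set Plane) (O' : Set Plane) : Set Space :=
  O ×ˢ {0} ∪ B ×ˢ Icc 0 1 ∪ O' ×ˢ {1}

/-- A cobordism: a compact polyhedral surface properly embedded in the cylinder over `W`, with the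
prescribed boundary. As usual for composition, it is a product near the top and the bottom. (Such
a surface separates the cylinder, hence it is always orientable; smoothings are not oriented, and
an orientation is not part of the data.) -/
structure Cobordism (O O' : Smoothing W B) where
  carrier : Set Space
  isPolyhedron : IsPolyhedron carrier
  subset : carrier ⊆ cyl W
  inter_side : carrier ∩ frontier W ×ˢ univ = (B : Set Plane) ×ˢ Icc 0 1
  collar : ∃ ε : ℝ, 0 < ε ∧ ε < 1 ∧
    carrier ∩ {p | p.2 ≤ ε} = O.carrier ×ˢ Icc 0 ε ∧
    carrier ∩ {p | 1 - ε ≤ p.2} = O'.carrier ×ˢ Icc (1 - ε) 1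
  isSurface : IsSurface carrier (cobBoundary O.carrier B O'.carrier)

/-- The degree `χ(C) - |B| / 2` (the integer division is exact as soon as there is a smoothing with
boundary `B`). -/
noncomputable def Cobordism.degree {O O' : Smoothing W B} (C : Cobordism O O') : ℤ :=
  eulerChar C.carrier - (B.card : ℤ) / 2

/-- An ambient isotopy of the cylinder over `W`, through piecewise linear homeomorphisms, that
preserves the boundary: it fixes the top and the bottom, and on the side it moves points only
vertically. -/
structure AmbientIsotopy (W : Set Plane) where
  toFun : ℝ → Space → Space
  continuousOn : ContinuousOn (fun q : ℝ × Space => toFun q.1 q.2) (Icc 0 1 ×ˢ cyl W)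
  isPLOn : ∀ s ∈ Icc (0 : ℝ) 1, IsPLOn (toFun s) (cyl W)
  bijOn : ∀ s ∈ Icc (0 : ℝ) 1, BijOn (toFun s) (cyl W) (cyl W)
  zero : ∀ p ∈ cyl W, toFun 0 p = p
  horizontal : ∀ s ∈ Icc (0 : ℝ) 1, ∀ p ∈ cyl W, p.2 = 0 ∨ p.2 = 1 → toFun s p = p
  vertical : ∀ s ∈ Icc (0 : ℝ) 1, ∀ p ∈ cyl W, p.1 ∈ frontier W → (toFun s p).1 = p.1

/-- Two subsets of the cylinder are isotopic. -/
def Isotopic (W : Set Plane) (A A' : Set Space) : Prop :=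
  ∃ H : AmbientIsotopy W, H.toFun 1 '' A = A'

/-- The vertical rescaling that takes `[0,1]` to `[a,b]`. -/
def squeeze (a b : ℝ) (p : Space) : Space := (p.1, a + (b - a) * p.2)

/-- `A` below and `C` on top of it, vertically renormalized. -/
def stack (A C : Set Space) : Set Space :=
  squeeze 0 (1 / 2) '' A ∪ squeeze (1 / 2) 1 '' C

/-! Composition is well defined -/

noncomputable def unsqueeze (a b : ℝ) : Space →ᵃ[ℝ] Space :=
  (LinearMap.fst ℝ Plane ℝ).toAffineMap.prod
    ((b - a)⁻¹ • ((LinearMap.snd ℝ Plane ℝ).toAffineMap - AffineMap.const ℝ Space a))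

theorem unsqueeze_apply (a b : ℝ) (p : Space) :
    unsqueeze a b p = (p.1, (b - a)⁻¹ * (p.2 - a)) := rfl

theorem unsqueeze_squeeze {a b : ℝ} (h : a < b) (p : Space) :
    unsqueeze a b (squeeze a b p) = p := by
  have : b - a ≠ 0 := by linarith
  rw [unsqueeze_apply]
  ext <;> simp [squeeze, this]

theorem squeeze_unsqueeze {a b : ℝ} (h : a < b) (p : Space) :
    squeeze a b (unsqueeze a b p) = p := by
  have : b - a ≠ 0 := by linarith
  rw [unsqueeze_apply]
  ext <;> simp [squeeze, this]

theorem continuous_squeeze (a b : ℝ) : Continuous (squeeze a b) := by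
  unfold squeeze; fun_prop

theorem continuous_unsqueeze (a b : ℝ) : Continuous (unsqueeze a b) := by
  have : (unsqueeze a b : Space → Space) = fun p => (p.1, (b - a)⁻¹ * (p.2 - a)) := rfl
  rw [this]; fun_prop

noncomputable def squeezeHomeo {a b : ℝ} (h : a < b) : Space ≃ₜ Space where
  toFun := squeeze a b
  invFun := unsqueeze a b
  left_inv := unsqueeze_squeeze h
  right_inv := squeeze_unsqueeze h
  continuous_toFun := continuous_squeeze a b
  continuous_invFun := continuous_unsqueeze a b

theorem mem_squeeze_image {a b : ℝ} (h : a < b) (A : Set Space) (p : Space) :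
    p ∈ squeeze a b '' A ↔ unsqueeze a b p ∈ A := by
  constructor
  · rintro ⟨q, hq, rfl⟩; rwa [unsqueeze_squeeze h]
  · intro hp; exact ⟨_, hp, squeeze_unsqueeze h p⟩

theorem mem_stack (A C : Set Space) (x : Plane) (t : ℝ) :
    (x, t) ∈ stack A C ↔ (x, 2 * t) ∈ A ∨ (x, 2 * t - 1) ∈ C := by
  have h1 : unsqueeze 0 (1 / 2) (x, t) = (x, 2 * t) := by
    rw [unsqueeze_apply]; ext <;> simp
  have h2 : unsqueeze (1 / 2) 1 (x, t) = (x, 2 * t - 1) := by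
    rw [unsqueeze_apply]; ext <;> simp; ring
  rw [stack, mem_union, mem_squeeze_image (by norm_num), mem_squeeze_image (by norm_num), h1, h2]

/-- An isotopy on a slab of the cylinder, extended by the identity. -/
theorem Isotopic.squeeze_union {A A' R : Set Space} (h : Isotopic W A A') (hA : A ⊆ cyl W)
    {a b : ℝ} (ha : 0 ≤ a) (hab : a < b) (hb : b ≤ 1) (hR : R ⊆ cyl W)
    (hR' : ∀ p ∈ R, p.2 ≤ a ∨ b ≤ p.2) :
    Isotopic W (squeeze a b '' A ∪ R) (squeeze a b '' A' ∪ R) := by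
  classical
  obtain ⟨H, rfl⟩ := h
  have hba : 0 < b - a := by linarith
  let K : ℝ → Space → Space := fun s p =>
    if a ≤ p.2 ∧ p.2 ≤ b then squeeze a b (H.toFun s (unsqueeze a b p)) else p
  have un_mem : ∀ p ∈ cyl W, a ≤ p.2 → p.2 ≤ b → unsqueeze a b p ∈ cyl W := fun p hp h1 h2 => by
    rw [unsqueeze_apply]
    refine ⟨hp.1, mul_nonneg (inv_nonneg.2 hba.le) (by linarith), ?_⟩
    show (b - a)⁻¹ * (p.2 - a) ≤ 1
    rw [inv_mul_le_iff₀ hba]; linarith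
  have sq_mem : ∀ p ∈ cyl W, squeeze a b p ∈ cyl W ∧ a ≤ (squeeze a b p).2 ∧
      (squeeze a b p).2 ≤ b := fun p hp => by
    have h1 : 0 ≤ p.2 := hp.2.1
    have h2 : p.2 ≤ 1 := hp.2.2
    have h3 : (b - a) * p.2 ≤ b - a := by nlinarith
    have h4 : 0 ≤ (b - a) * p.2 := by positivity
    have h5 : (squeeze a b p).2 = a + (b - a) * p.2 := rfl
    refine ⟨⟨hp.1, ?_, ?_⟩, ?_, ?_⟩ <;> rw [h5] <;> linarith
  have K_in : ∀ s p, a ≤ p.2 → p.2 ≤ b →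
      K s p = squeeze a b (H.toFun s (unsqueeze a b p)) := fun s p h1 h2 => if_pos ⟨h1, h2⟩
  have K_out : ∀ s ∈ Icc (0 : ℝ) 1, ∀ p ∈ cyl W, p.2 ≤ a ∨ b ≤ p.2 → K s p = p := by
    intro s hs p hp h
    by_cases h1 : a ≤ p.2 ∧ p.2 ≤ b
    · have h2 : (unsqueeze a b p).2 = 0 ∨ (unsqueeze a b p).2 = 1 := by
        rw [unsqueeze_apply]
        rcases h with h | h
        · left; simp [le_antisymm h h1.1]
        · right; simp [le_antisymm h1.2 h, hba.ne']
      rw [K_in s p h1.1 h1.2, H.horizontal s hs _ (un_mem p hp h1.1 h1.2) h2,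
        squeeze_unsqueeze hab]
    · exact if_neg h1
  have K_mem : ∀ s ∈ Icc (0 : ℝ) 1, ∀ p ∈ cyl W, K s p ∈ cyl W := by
    intro s hs p hp
    by_cases h1 : a ≤ p.2 ∧ p.2 ≤ b
    · rw [K_in s p h1.1 h1.2]
      exact (sq_mem _ ((H.bijOn s hs).mapsTo (un_mem p hp h1.1 h1.2))).1
    · rwa [show K s p = p from if_neg h1]
  refine ⟨⟨K, ?_, ?_, ?_, ?_, ?_, ?_⟩, ?_⟩
  · have h2 : Continuous fun q : ℝ × Space => q.2.2 := by fun_prop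
    refine continuousOn_of_closed_cover (A := {q : ℝ × Space | a ≤ q.2.2 ∧ q.2.2 ≤ b})
      (C := {q : ℝ × Space | q.2.2 ≤ a ∨ b ≤ q.2.2}) ?_ ?_ ?_ ?_ ?_
    · exact (isClosed_le continuous_const h2).inter (isClosed_le h2 continuous_const)
    · exact (isClosed_le h2 continuous_const).union (isClosed_le continuous_const h2)
    · intro q _
      rcases le_total a q.2.2 with h1 | h1
      · rcases le_total q.2.2 b with h2 | h2
        · exact .inl ⟨h1, h2⟩
        · exact .inr (.inr h2)
      · exact .inr (.inl h1)
    · have h1 : ContinuousOn (fun q : ℝ × Space =>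
          squeeze a b (H.toFun q.1 (unsqueeze a b q.2)))
          (Icc 0 1 ×ˢ cyl W ∩ {q : ℝ × Space | a ≤ q.2.2 ∧ q.2.2 ≤ b}) := by
        refine (continuous_squeeze a b).comp_continuousOn (H.continuousOn.comp
          (f := fun q : ℝ × Space => (q.1, unsqueeze a b q.2)) ?_ ?_)
        · exact (continuous_fst.prodMk
            ((continuous_unsqueeze a b).comp continuous_snd)).continuousOn
        · rintro q ⟨hq, hq1, hq2⟩
          exact ⟨hq.1, un_mem _ hq.2 hq1 hq2⟩
      exact h1.congr fun q hq => K_in _ _ hq.2.1 hq.2.2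
    · exact continuousOn_snd.congr fun q hq => K_out _ hq.1.1 _ hq.1.2 hq.2
  · intro s hs
    obtain ⟨𝒬, hf, hq, hc, hA⟩ := H.isPLOn s hs
    have lo : IsConvexPolyhedron {p : Space | p.2 ≤ a} := by
      convert IsConvexPolyhedron.nonneg
        (AffineMap.const ℝ Space a - (LinearMap.snd ℝ Plane ℝ).toAffineMap) using 2
      simp
    have hi : IsConvexPolyhedron {p : Space | b ≤ p.2} := by
      convert IsConvexPolyhedron.nonneg
        ((LinearMap.snd ℝ Plane ℝ).toAffineMap - AffineMap.const ℝ Space b) using 2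
      simp
    have lo' : IsConvexPolyhedron {p : Space | p.2 ≤ b} := by
      convert IsConvexPolyhedron.nonneg
        (AffineMap.const ℝ Space b - (LinearMap.snd ℝ Plane ℝ).toAffineMap) using 2
      simp
    have hi' : IsConvexPolyhedron {p : Space | a ≤ p.2} := by
      convert IsConvexPolyhedron.nonneg
        ((LinearMap.snd ℝ Plane ℝ).toAffineMap - AffineMap.const ℝ Space a) using 2
      simp
    refine ⟨insert {p : Space | p.2 ≤ a} (insert {p : Space | b ≤ p.2}
      ((fun Q => unsqueeze a b ⁻¹' Q ∩ ({p : Space | p.2 ≤ b} ∩ {p : Space | a ≤ p.2})) '' 𝒬)),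
      ((hf.image _).insert _).insert _, ?_, ?_, ?_⟩
    · rintro Q (rfl | rfl | ⟨Q, hQ, rfl⟩)
      · exact lo
      · exact hi
      · exact ((hq Q hQ).preimage _).inter (lo'.inter hi')
    · intro p hp
      rcases le_total p.2 a with h1 | h1
      · exact ⟨_, .inl rfl, h1⟩
      rcases le_total b p.2 with h2 | h2
      · exact ⟨_, .inr (.inl rfl), h2⟩
      obtain ⟨Q, hQ, hpQ⟩ := hc (un_mem p hp h1 h2)
      exact ⟨_, .inr (.inr ⟨Q, hQ, rfl⟩), hpQ, h2, h1⟩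
    · rintro Q (rfl | rfl | ⟨Q, hQ, rfl⟩)
      · exact ⟨AffineMap.id ℝ Space, fun p hp => K_out s hs p hp.1 (.inl hp.2)⟩
      · exact ⟨AffineMap.id ℝ Space, fun p hp => K_out s hs p hp.1 (.inr hp.2)⟩
      · obtain ⟨L, hL⟩ := hA Q hQ
        refine ⟨((LinearMap.fst ℝ Plane ℝ).toAffineMap.prod (AffineMap.const ℝ Space a +
          (b - a) • (LinearMap.snd ℝ Plane ℝ).toAffineMap)).comp (L.comp (unsqueeze a b)), ?_⟩
        rintro p ⟨hp, hpQ, h2, h1⟩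
        have h1 : a ≤ p.2 := h1
        have h2 : p.2 ≤ b := h2
        rw [K_in s p h1 h2, hL ⟨un_mem p hp h1 h2, hpQ⟩]
        rfl
  · intro s hs
    refine ⟨K_mem s hs, ?_, ?_⟩
    · have slab : ∀ p ∈ cyl W, a ≤ p.2 → p.2 ≤ b → a ≤ (K s p).2 ∧ (K s p).2 ≤ b := by
        intro p hp h1 h2
        rw [K_in s p h1 h2]
        exact (sq_mem _ ((H.bijOn s hs).mapsTo (un_mem p hp h1 h2))).2
      intro p hp q hq hpq
      by_cases h1 : a ≤ p.2 ∧ p.2 ≤ b <;> by_cases h2 : a ≤ q.2 ∧ q.2 ≤ b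
      · rw [K_in s p h1.1 h1.2, K_in s q h2.1 h2.2] at hpq
        have h3 := (squeezeHomeo hab).injective hpq
        have h4 := (H.bijOn s hs).injOn (un_mem p hp h1.1 h1.2) (un_mem q hq h2.1 h2.2) h3
        rw [← squeeze_unsqueeze hab p, h4, squeeze_unsqueeze hab]
      · exact absurd ((show K s q = q from if_neg h2) ▸ hpq ▸ slab p hp h1.1 h1.2) h2
      · exact absurd ((show K s p = p from if_neg h1) ▸ hpq ▸ slab q hq h2.1 h2.2) h1
      · rwa [show K s p = p from if_neg h1, show K s q = q from if_neg h2] at hpq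
    · intro q hq
      by_cases h1 : a ≤ q.2 ∧ q.2 ≤ b
      · obtain ⟨p, hp, hpq⟩ := (H.bijOn s hs).surjOn (un_mem q hq h1.1 h1.2)
        have h2 := sq_mem p hp
        refine ⟨squeeze a b p, h2.1, ?_⟩
        rw [K_in s _ h2.2.1 h2.2.2, unsqueeze_squeeze hab, hpq, squeeze_unsqueeze hab]
      · exact ⟨q, hq, if_neg h1⟩
  · intro p hp
    by_cases h1 : a ≤ p.2 ∧ p.2 ≤ b
    · rw [K_in 0 p h1.1 h1.2, H.zero _ (un_mem p hp h1.1 h1.2), squeeze_unsqueeze hab]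
    · exact if_neg h1
  · intro s hs p hp h
    exact K_out s hs p hp (h.imp (fun h => by rw [h]; exact ha) (fun h => by rw [h]; exact hb))
  · intro s hs p hp hpW
    by_cases h1 : a ≤ p.2 ∧ p.2 ≤ b
    · rw [K_in s p h1.1 h1.2]
      exact H.vertical s hs _ (un_mem p hp h1.1 h1.2) hpW
    · rw [show K s p = p from if_neg h1]
  · have one : (1 : ℝ) ∈ Icc (0 : ℝ) 1 := by simp
    show K 1 '' _ = _
    rw [image_union]
    congr 1
    · rw [image_image, image_image]
      refine image_congr fun p hp => ?_
      have h2 := sq_mem p (hA hp)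
      rw [K_in 1 _ h2.2.1 h2.2.2, unsqueeze_squeeze hab]
    · have : EqOn (K 1) id R := fun p hp => K_out 1 one p (hR hp) (hR' p hp)
      rw [this.image_eq, image_id]

/-- Vertical reparametrizations are isotopic to the identity. -/
theorem isotopic_of_reparam {A A' : Set Space} (hA : A ⊆ cyl W) (hA' : A' ⊆ cyl W) (φ : ℝ → ℝ)
    (hφc : Continuous φ) (hφm : StrictMono φ) (hφ0 : φ 0 = 0) (hφ1 : φ 1 = 1)
    (hφ : IsPLOn φ (Icc 0 1))
    (h : ∀ x, ∀ t ∈ Icc (0 : ℝ) 1, (x, t) ∈ A ↔ (x, φ t) ∈ A') : Isotopic W A A' := by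
  let ψ : ℝ → ℝ → ℝ := fun s t => (1 - s) * t + s * φ t
  have ψc : Continuous fun q : ℝ × ℝ => ψ q.1 q.2 := by
    show Continuous fun q : ℝ × ℝ => (1 - q.1) * q.2 + q.1 * φ q.2
    fun_prop
  have ψc' : ∀ s, Continuous (ψ s) := fun s => ψc.comp (continuous_const.prodMk continuous_id)
  have ψ0 : ∀ s, ψ s 0 = 0 := fun s => by simp [ψ, hφ0]
  have ψ1 : ∀ s, ψ s 1 = 1 := fun s => by simp [ψ, hφ1]
  have ψm : ∀ s ∈ Icc (0 : ℝ) 1, StrictMono (ψ s) := by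
    intro s hs t u htu
    have h1 := hφm htu
    rcases hs.1.eq_or_lt with rfl | h0
    · simpa [ψ] using htu
    · have h2 : (1 - s) * t ≤ (1 - s) * u := mul_le_mul_of_nonneg_left htu.le (by linarith [hs.2])
      have h3 : s * φ t < s * φ u := by gcongr
      show (1 - s) * t + s * φ t < (1 - s) * u + s * φ u
      linarith
  have ψI : ∀ s ∈ Icc (0 : ℝ) 1, BijOn (ψ s) (Icc 0 1) (Icc 0 1) := by
    intro s hs
    refine ⟨fun t ht => ⟨?_, ?_⟩, (ψm s hs).injective.injOn, fun u hu => ?_⟩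
    · rw [← ψ0 s]; exact (ψm s hs).monotone ht.1
    · rw [← ψ1 s]; exact (ψm s hs).monotone ht.2
    · have := intermediate_value_Icc zero_le_one (ψc' s).continuousOn
      rw [ψ0, ψ1] at this
      exact this hu
  have one : (1 : ℝ) ∈ Icc (0 : ℝ) 1 := by simp
  have ψφ : ∀ t, ψ 1 t = φ t := fun t => by simp [ψ]
  refine ⟨⟨fun s p => (p.1, ψ s p.2), ?_, ?_, ?_, ?_, ?_, ?_⟩, ?_⟩
  · refine Continuous.continuousOn ?_
    exact (continuous_fst.comp continuous_snd).prodMk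
      (ψc.comp (continuous_fst.prodMk (continuous_snd.comp continuous_snd)))
  · intro s hs
    obtain ⟨𝒬, hf, hq, hc, hL⟩ := hφ
    refine ⟨(fun Q => Prod.snd ⁻¹' Q) '' 𝒬, hf.image _, ?_, ?_, ?_⟩
    · rintro _ ⟨Q, hQ, rfl⟩
      exact (hq Q hQ).preimage (LinearMap.snd ℝ Plane ℝ).toAffineMap
    · intro p hp
      obtain ⟨Q, hQ, hpQ⟩ := hc hp.2
      exact ⟨_, ⟨Q, hQ, rfl⟩, hpQ⟩
    · rintro _ ⟨Q, hQ, rfl⟩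
      obtain ⟨L, hL⟩ := hL Q hQ
      refine ⟨(LinearMap.fst ℝ Plane ℝ).toAffineMap.prod
        ((1 - s) • (LinearMap.snd ℝ Plane ℝ).toAffineMap +
          s • L.comp (LinearMap.snd ℝ Plane ℝ).toAffineMap), ?_⟩
      rintro p ⟨hp, hpQ⟩
      have h1 : φ p.2 = L p.2 := hL ⟨hp.2, hpQ⟩
      show (p.1, (1 - s) * p.2 + s * φ p.2) = _
      rw [h1]; rfl
  · intro s hs
    refine ⟨fun p hp => ⟨hp.1, (ψI s hs).mapsTo hp.2⟩, ?_, ?_⟩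
    · intro p hp q hq hpq
      have h1 := (Prod.ext_iff.1 hpq).1
      have h2 := (ψI s hs).injOn hp.2 hq.2 (Prod.ext_iff.1 hpq).2
      exact Prod.ext h1 h2
    · intro q hq
      obtain ⟨t, ht, htq⟩ := (ψI s hs).surjOn hq.2
      exact ⟨(q.1, t), ⟨hq.1, ht⟩, Prod.ext rfl htq⟩
  · intro p _
    ext <;> simp [ψ]
  · rintro s _ p _ (hp | hp)
    · exact Prod.ext rfl (by simp only [hp, ψ0])
    · exact Prod.ext rfl (by simp only [hp, ψ1])
  · intro s _ p _ _; rfl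
  · ext ⟨x, u⟩
    constructor
    · rintro ⟨⟨y, t⟩, hp, hpq⟩
      simp only [Prod.mk.injEq, ψφ] at hpq
      obtain ⟨rfl, rfl⟩ := hpq
      exact (h y t (hA hp).2).1 hp
    · intro hp
      obtain ⟨t, ht, htu⟩ := (ψI 1 one).surjOn (hA' hp).2
      have htu : φ t = u := by rw [← ψφ]; exact htu
      refine ⟨(x, t), (h x t ht).2 ?_, ?_⟩
      · rwa [htu]
      · simp only [ψφ, htu]

theorem isPLOn_min {φ φ' : ℝ → ℝ} {S : Set ℝ} (h : IsPLOn φ S) (h' : IsPLOn φ' S) :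
    IsPLOn (fun t => min (φ t) (φ' t)) S := by
  obtain ⟨𝒬, hf, hq, hc, hL⟩ := h
  obtain ⟨𝒬', hf', hq', hc', hL'⟩ := h'
  choose! L hL using hL
  choose! L' hL' using hL'
  refine ⟨(fun q : Set ℝ × Set ℝ => q.1 ∩ q.2 ∩ {t | 0 ≤ (L' q.2 - L q.1) t}) '' (𝒬 ×ˢ 𝒬') ∪
    (fun q : Set ℝ × Set ℝ => q.1 ∩ q.2 ∩ {t | 0 ≤ (L q.1 - L' q.2) t}) '' (𝒬 ×ˢ 𝒬'),
    ((hf.prod hf').image _).union ((hf.prod hf').image _), ?_, ?_, ?_⟩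
  · rintro _ (⟨q, hq1, rfl⟩ | ⟨q, hq1, rfl⟩) <;>
      exact ((hq _ hq1.1).inter (hq' _ hq1.2)).inter (.nonneg _)
  · intro t ht
    obtain ⟨Q, hQ, htQ⟩ := hc ht
    obtain ⟨Q', hQ', htQ'⟩ := hc' ht
    rcases le_total (L Q t) (L' Q' t) with h | h
    · exact ⟨_, .inl ⟨(Q, Q'), ⟨hQ, hQ'⟩, rfl⟩, ⟨htQ, htQ'⟩, by simpa using h⟩
    · exact ⟨_, .inr ⟨(Q, Q'), ⟨hQ, hQ'⟩, rfl⟩, ⟨htQ, htQ'⟩, by simpa using h⟩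
  · rintro _ (⟨q, hq1, rfl⟩ | ⟨q, hq1, rfl⟩)
    · refine ⟨L q.1, fun t ht => ?_⟩
      have h3 : L q.1 t ≤ L' q.2 t := by simpa using ht.2.2
      show min (φ t) (φ' t) = _
      rw [hL _ hq1.1 ⟨ht.1, ht.2.1.1⟩, hL' _ hq1.2 ⟨ht.1, ht.2.1.2⟩, min_eq_left h3]
    · refine ⟨L' q.2, fun t ht => ?_⟩
      have h3 : L' q.2 t ≤ L q.1 t := by simpa using ht.2.2
      show min (φ t) (φ' t) = _
      rw [hL _ hq1.1 ⟨ht.1, ht.2.1.1⟩, hL' _ hq1.2 ⟨ht.1, ht.2.1.2⟩, min_eq_right h3]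

theorem isPLOn_affine (m n : ℝ) (S : Set ℝ) : IsPLOn (fun t : ℝ => m * t + n) S :=
  ⟨{univ}, Set.finite_singleton _, by rintro _ rfl; exact .univ, by simp,
    fun _ _ => ⟨m • AffineMap.id ℝ ℝ + AffineMap.const ℝ ℝ n, fun _ _ => rfl⟩⟩

theorem isPLOn_max_affine (m n m' n' : ℝ) (S : Set ℝ) :
    IsPLOn (fun t : ℝ => max (m * t + n) (m' * t + n')) S := by
  have nn : ∀ k l : ℝ, IsConvexPolyhedron {t : ℝ | 0 ≤ k * t + l} := fun k l =>
    .nonneg (k • AffineMap.id ℝ ℝ + AffineMap.const ℝ ℝ l)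
  refine ⟨{{t : ℝ | 0 ≤ (m - m') * t + (n - n')}, {t : ℝ | 0 ≤ (m' - m) * t + (n' - n)}},
    (Set.finite_singleton _).insert _, ?_, ?_, ?_⟩
  · rintro _ (rfl | rfl) <;> exact nn _ _
  · intro t _
    rcases le_total 0 ((m - m') * t + (n - n')) with h | h
    · exact ⟨_, .inl rfl, h⟩
    · exact ⟨_, .inr rfl, by simp only [mem_ofPred_eq]; linarith⟩
  · rintro _ (rfl | rfl)
    · refine ⟨m • AffineMap.id ℝ ℝ + AffineMap.const ℝ ℝ n, fun t ht => max_eq_left ?_⟩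
      have := ht.2
      simp only [mem_ofPred_eq] at this; linarith
    · refine ⟨m' • AffineMap.id ℝ ℝ + AffineMap.const ℝ ℝ n', fun t ht => max_eq_right ?_⟩
      have := ht.2
      simp only [mem_ofPred_eq] at this; linarith

theorem strictMono_affine {m : ℝ} (hm : 0 < m) (n : ℝ) : StrictMono (fun t : ℝ => m * t + n) :=
  fun t u h => by have := mul_lt_mul_of_pos_left h hm; simp only; linarith

theorem Cobordism.exists_collar {O O' : Smoothing W B} (C : Cobordism O O') : ∃ ε : ℝ, 0 < ε ∧
    ε < 1 ∧ (∀ x t, t ≤ ε → ((x, t) ∈ C.carrier ↔ x ∈ O.carrier ∧ 0 ≤ t)) ∧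
    ∀ x t, 1 - ε ≤ t → ((x, t) ∈ C.carrier ↔ x ∈ O'.carrier ∧ t ≤ 1) := by
  obtain ⟨ε, h0, h1, hl, hu⟩ := C.collar
  refine ⟨ε, h0, h1, fun x t ht => ?_, fun x t ht => ?_⟩
  · have := Set.ext_iff.1 hl (x, t)
    simpa [ht] using this
  · have := Set.ext_iff.1 hu (x, t)
    simpa [ht, show 1 ≤ t + ε by linarith] using this

theorem Cobordism.height {O O' : Smoothing W B} (C : Cobordism O O') {x : Plane} {t : ℝ}
    (h : (x, t) ∈ C.carrier) : 0 ≤ t ∧ t ≤ 1 := (C.subset h).2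

theorem Cobordism.side_iff {O O' : Smoothing W B} (C : Cobordism O O') {x : Plane} {t : ℝ}
    (hx : x ∈ frontier W) : (x, t) ∈ C.carrier ↔ x ∈ B ∧ 0 ≤ t ∧ t ≤ 1 := by
  have := Set.ext_iff.1 C.inter_side (x, t)
  simpa [hx] using this

/-- The identity cobordism `O × [0,1]`. -/
def Cobordism.id (O : Smoothing W B) : Cobordism O O where
  carrier := O.carrier ×ˢ Icc 0 1
  isPolyhedron := O.isPolyhedron.prod_Icc 0 1
  subset := prod_mono O.subset subset_rfl
  inter_side := by rw [prod_inter_prod, O.inter_frontier, inter_univ]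
  collar := by
    refine ⟨1 / 2, by norm_num, by norm_num, ?_, ?_⟩ <;> ext ⟨x, t⟩ <;>
      simp only [mem_inter_iff, mem_prod, mem_Icc, mem_ofPred_eq] <;> constructor
    · rintro ⟨⟨h1, h2, h3⟩, h4⟩; exact ⟨h1, h2, h4⟩
    · rintro ⟨h1, h2, h3⟩; exact ⟨⟨h1, h2, by linarith⟩, h3⟩
    · rintro ⟨⟨h1, h2, h3⟩, h4⟩; exact ⟨h1, h4, h3⟩
    · rintro ⟨h1, h2, h3⟩; exact ⟨⟨h1, by linarith, h3⟩, h2⟩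
  isSurface := O.isCurve.prod_Icc

/-- The vertical composition of cobordisms. -/
def Cobordism.comp {O O' O'' : Smoothing W B} (C : Cobordism O O') (D : Cobordism O' O'') :
    Cobordism O O'' where
  carrier := stack C.carrier D.carrier
  isPolyhedron :=
    (C.isPolyhedron.image (continuous_squeeze _ _) _ (unsqueeze_squeeze (by norm_num))
      (squeeze_unsqueeze (by norm_num))).union
    (D.isPolyhedron.image (continuous_squeeze _ _) _ (unsqueeze_squeeze (by norm_num))
      (squeeze_unsqueeze (by norm_num)))
  subset := by
    rintro ⟨x, t⟩ h
    rcases (mem_stack _ _ _ _).1 h with h | h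
    · have := C.height h
      exact ⟨(C.subset h).1, by simp only; linarith, by simp only; linarith⟩
    · have := D.height h
      exact ⟨(D.subset h).1, by simp only; linarith, by simp only; linarith⟩
  inter_side := by
    ext ⟨x, t⟩
    simp only [mem_inter_iff, mem_stack, mem_prod, mem_univ, and_true, Finset.mem_coe, mem_Icc]
    constructor
    · rintro ⟨h, hx⟩
      rw [C.side_iff hx, D.side_iff hx] at h
      rcases h with ⟨h, h1, h2⟩ | ⟨h, h1, h2⟩
      · exact ⟨h, by linarith, by linarith⟩
      · exact ⟨h, by linarith, by linarith⟩
    · rintro ⟨h, h1, h2⟩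
      have hx : x ∈ frontier W := by
        have : x ∈ O.carrier ∩ frontier W := by rw [O.inter_frontier]; exact h
        exact this.2
      refine ⟨?_, hx⟩
      rw [C.side_iff hx, D.side_iff hx]
      rcases le_total (2 * t) 1 with h3 | h3
      · exact .inl ⟨h, by linarith, h3⟩
      · exact .inr ⟨h, by linarith, by linarith⟩
  collar := by
    obtain ⟨ε, h0, h1, hC, -⟩ := C.exists_collar
    obtain ⟨δ, h0', h1', -, hD⟩ := D.exists_collar
    refine ⟨min ε δ / 2, by positivity, ?_, ?_, ?_⟩
    · have := min_le_left ε δ; linarith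
    · have := min_le_left ε δ
      ext ⟨x, t⟩
      simp only [mem_inter_iff, mem_stack, mem_prod, mem_Icc, mem_ofPred_eq]
      constructor
      · rintro ⟨h | h, h2⟩
        · have := (hC x (2 * t) (by linarith)).1 h
          exact ⟨this.1, by linarith, h2⟩
        · have := D.height h
          linarith
      · rintro ⟨hx, h2, h3⟩
        exact ⟨.inl ((hC x _ (by linarith)).2 ⟨hx, by linarith⟩), h3⟩
    · have := min_le_right ε δ
      ext ⟨x, t⟩
      simp only [mem_inter_iff, mem_stack, mem_prod, mem_Icc, mem_ofPred_eq]
      constructor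
      · rintro ⟨h | h, h2⟩
        · have := C.height h
          linarith
        · have := (hD x _ (by linarith)).1 h
          exact ⟨this.1, h2, by linarith⟩
      · rintro ⟨hx, h2, h3⟩
        exact ⟨.inr ((hD x _ (by linarith)).2 ⟨hx, by linarith⟩), h2⟩
  isSurface := by
    obtain ⟨ε, h0, h1, -, hC⟩ := C.exists_collar
    obtain ⟨δ, h0', h1', hD, -⟩ := D.exists_collar
    refine ⟨?_, ?_⟩
    · rintro ⟨x, t⟩ ((⟨h1, h2⟩ | ⟨h1, h2⟩) | ⟨h1, h2⟩)
      · obtain rfl : t = 0 := h2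
        refine (mem_stack _ _ _ _).2 (.inl (C.isSurface.1 (.inl (.inl ⟨h1, ?_⟩))))
        simp
      · have h3 : 0 ≤ t := h2.1
        have h4 : t ≤ 1 := h2.2
        rcases le_total (2 * t) 1 with h5 | h5
        · exact (mem_stack _ _ _ _).2 (.inl (C.isSurface.1 (.inl (.inr ⟨h1,
            by simp only [mem_Icc]; constructor <;> linarith⟩))))
        · exact (mem_stack _ _ _ _).2 (.inr (D.isSurface.1 (.inl (.inr ⟨h1,
            by simp only [mem_Icc]; constructor <;> linarith⟩))))
      · obtain rfl : t = 1 := h2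
        refine (mem_stack _ _ _ _).2 (.inr (D.isSurface.1 (.inr ⟨h1, ?_⟩)))
        norm_num
    · rintro ⟨x, t⟩ hp
      have hlt : (0 : ℝ) < 1 / 2 := by norm_num
      have hlt' : (1 / 2 : ℝ) < 1 := by norm_num
      rcases lt_trichotomy t (1 / 2) with ht | rfl | ht
      · have hp' : (x, 2 * t) ∈ C.carrier := by
          rcases (mem_stack _ _ _ _).1 hp with h | h
          · exact h
          · have := D.height h; linarith
        have h2 := (C.isSurface.2 _ hp').image hp' (squeezeHomeo hlt)
        have h3 : squeezeHomeo hlt (x, 2 * t) = (x, t) := by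
          show squeeze _ _ _ = _
          ext <;> simp [squeeze]
        rw [h3] at h2
        refine h2.congr (h3 ▸ ⟨_, hp', rfl⟩) (N := {q | q.2 < 1 / 2})
          (isOpen_lt continuous_snd continuous_const) ht ?_ ?_
        · rintro ⟨y, u⟩ hu
          have hu : u < 1 / 2 := hu
          refine ⟨fun h => .inl h, ?_⟩
          rintro (h | h)
          · exact h
          · obtain ⟨⟨z, v⟩, hz, hzv⟩ := h
            have := D.height hz
            have h4 : 1 / 2 + (1 - 1 / 2) * v = u := (Prod.ext_iff.1 hzv).2
            linarith
        · rintro ⟨y, u⟩ hu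
          have hu : u < 1 / 2 := hu
          rw [show (squeezeHomeo hlt '' cobBoundary O.carrier B O'.carrier) =
            squeeze 0 (1 / 2) '' _ from rfl, mem_squeeze_image hlt]
          simp only [unsqueeze_apply, cobBoundary, mem_union, mem_prod, mem_singleton_iff, mem_Icc]
          have e : ((1 / 2 : ℝ) - 0)⁻¹ * (u - 0) = 2 * u := by norm_num
          rw [e]
          constructor
          · rintro ((⟨h, h'⟩ | ⟨h, h', h''⟩) | ⟨h, h'⟩)
            · exact .inl (.inl ⟨h, by linarith⟩)
            · exact .inl (.inr ⟨h, by linarith, by linarith⟩)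
            · linarith
          · rintro ((⟨h, h'⟩ | ⟨h, h', h''⟩) | ⟨h, h'⟩)
            · exact .inl (.inl ⟨h, by linarith⟩)
            · exact .inl (.inr ⟨h, by linarith, by linarith⟩)
            · linarith
      · have hx : x ∈ O'.carrier := by
          rcases (mem_stack _ _ _ _).1 hp with h | h
          · exact ((hC x _ (by linarith)).1 h).1
          · exact ((hD x _ (by linarith)).1 h).1
        have hx2 : (x, (1 / 2 : ℝ)) ∈ O'.carrier ×ˢ Icc (0 : ℝ) 1 := ⟨hx, by norm_num, by norm_num⟩
        refine (O'.isCurve.prod_Icc.2 _ hx2).congr hx2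
          (N := {q | (1 - ε) / 2 < q.2 ∧ q.2 < (1 + δ) / 2})
          ((isOpen_lt continuous_const continuous_snd).inter
            (isOpen_lt continuous_snd continuous_const))
          ⟨by simp only; linarith, by simp only; linarith⟩ ?_ ?_
        · rintro ⟨y, u⟩ ⟨hu, hu'⟩
          have hu : (1 - ε) / 2 < u := hu
          have hu' : u < (1 + δ) / 2 := hu'
          rw [mem_stack, hC _ _ (by linarith), hD _ _ (by linarith)]
          simp only [mem_prod, mem_Icc]
          constructor
          · rintro ⟨h, -, -⟩
            rcases le_total (2 * u) 1 with h5 | h5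
            · exact .inl ⟨h, h5⟩
            · exact .inr ⟨h, by linarith⟩
          · rintro (⟨h, -⟩ | ⟨h, -⟩) <;> exact ⟨h, by linarith, by linarith⟩
        · rintro ⟨y, u⟩ ⟨hu, hu'⟩
          have hu : (1 - ε) / 2 < u := hu
          have hu' : u < (1 + δ) / 2 := hu'
          have n0 : u ≠ 0 := by linarith
          have n1 : u ≠ 1 := by linarith
          simp only [cobBoundary, mem_union, mem_prod, mem_singleton_iff, n0, n1, and_false,
            false_or, or_false]
      · have hp' : (x, 2 * t - 1) ∈ D.carrier := by
          rcases (mem_stack _ _ _ _).1 hp with h | h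
          · have := C.height h; linarith
          · exact h
        have h2 := (D.isSurface.2 _ hp').image hp' (squeezeHomeo hlt')
        have h3 : squeezeHomeo hlt' (x, 2 * t - 1) = (x, t) := by
          show squeeze _ _ _ = _
          ext <;> simp [squeeze]; ring
        rw [h3] at h2
        refine h2.congr (h3 ▸ ⟨_, hp', rfl⟩) (N := {q | 1 / 2 < q.2})
          (isOpen_lt continuous_const continuous_snd) ht ?_ ?_
        · rintro ⟨y, u⟩ hu
          have hu : 1 / 2 < u := hu
          refine ⟨fun h => .inr h, ?_⟩
          rintro (h | h)
          · obtain ⟨⟨z, v⟩, hz, hzv⟩ := h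
            have := C.height hz
            have h4 : 0 + (1 / 2 - 0) * v = u := (Prod.ext_iff.1 hzv).2
            linarith
          · exact h
        · rintro ⟨y, u⟩ hu
          have hu : 1 / 2 < u := hu
          rw [show (squeezeHomeo hlt' '' cobBoundary O'.carrier B O''.carrier) =
            squeeze (1 / 2) 1 '' _ from rfl, mem_squeeze_image hlt']
          simp only [unsqueeze_apply, cobBoundary, mem_union, mem_prod, mem_singleton_iff, mem_Icc]
          have e : ((1 : ℝ) - 1 / 2)⁻¹ * (u - 1 / 2) = 2 * u - 1 := by norm_num; ring
          rw [e]
          constructor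
          · rintro ((⟨h, h'⟩ | ⟨h, h', h''⟩) | ⟨h, h'⟩)
            · linarith
            · exact .inl (.inr ⟨h, by linarith, by linarith⟩)
            · exact .inr ⟨h, by linarith⟩
          · rintro ((⟨h, h'⟩ | ⟨h, h', h''⟩) | ⟨h, h'⟩)
            · linarith
            · exact .inl (.inr ⟨h, by linarith, by linarith⟩)
            · exact .inr ⟨h, by linarith⟩

theorem isotopic_comp_left {O O' O'' : Smoothing W B} {C C' : Cobordism O O'}
    (h : Isotopic W C.carrier C'.carrier) (D : Cobordism O' O'') :
    Isotopic W (C.comp D).carrier (C'.comp D).carrier :=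
  h.squeeze_union C.subset le_rfl (by norm_num) (by norm_num)
    (fun p hp => (C.comp D).subset (.inr hp)) (by
      rintro _ ⟨q, hq, rfl⟩
      right
      have h1 : 0 ≤ q.2 := (D.subset hq).2.1
      show (1 : ℝ) / 2 ≤ 1 / 2 + (1 - 1 / 2) * q.2
      linarith)

theorem isotopic_comp_right {O O' O'' : Smoothing W B} (C : Cobordism O O')
    {D D' : Cobordism O' O''} (h : Isotopic W D.carrier D'.carrier) :
    Isotopic W (C.comp D).carrier (C.comp D').carrier := by
  have := h.squeeze_union (a := 1 / 2) (b := 1) (R := squeeze 0 (1 / 2) '' C.carrier) D.subset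
    (by norm_num) (by norm_num) le_rfl (fun p hp => (C.comp D).subset (.inl hp)) (by
      rintro _ ⟨q, hq, rfl⟩
      left
      have h1 : q.2 ≤ 1 := (C.subset hq).2.2
      show (0 : ℝ) + (1 / 2 - 0) * q.2 ≤ 1 / 2
      linarith)
  rwa [union_comm, union_comm _ (squeeze 0 (1 / 2) '' C.carrier)] at this

theorem isotopic_id_comp {O O' : Smoothing W B} (C : Cobordism O O') :
    Isotopic W ((Cobordism.id O).comp C).carrier C.carrier := by
  obtain ⟨ε, h0, h1, hC, -⟩ := C.exists_collar
  let k : ℝ := 2 * ε / (1 + ε)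
  have hk0 : 0 < k := by positivity
  have hk : k * (1 + ε) = 2 * ε := by simp only [k]; field_simp
  have hk2 : k < 1 := by nlinarith
  refine isotopic_of_reparam (Cobordism.subset _) C.subset
    (fun t => max (k * t + 0) (2 * t + -1)) (by fun_prop)
    (fun _ _ h => max_lt_max (strictMono_affine hk0 0 h) (strictMono_affine two_pos (-1) h)) (by norm_num)
    (by rw [max_eq_right] <;> linarith) (isPLOn_max_affine _ _ _ _ _) ?_
  intro x t ht
  rw [show ((Cobordism.id O).comp C).carrier = stack (O.carrier ×ˢ Icc 0 1) C.carrier from rfl,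
    mem_stack]
  simp only [mem_prod, mem_Icc]
  rcases le_total t ((1 + ε) / 2) with h | h
  · have e : max (k * t + 0) (2 * t + -1) = k * t := by
      rw [max_eq_left]
      · ring
      · nlinarith
    have h2 : k * t ≤ ε := by nlinarith
    rw [e, hC _ _ h2, hC _ _ (by linarith)]
    have h3 : 0 ≤ k * t := mul_nonneg hk0.le ht.1
    constructor
    · rintro (⟨h, -⟩ | ⟨h, -⟩) <;> exact ⟨h, h3⟩
    · rintro ⟨h, -⟩
      rcases le_total (2 * t) 1 with h5 | h5
      · exact .inl ⟨h, by linarith [ht.1], h5⟩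
      · exact .inr ⟨h, by linarith⟩
  · have e : max (k * t + 0) (2 * t + -1) = 2 * t - 1 := by
      rw [max_eq_right]
      · ring
      · nlinarith
    rw [e]
    constructor
    · rintro (⟨_, _, h5⟩ | h5)
      · linarith
      · exact h5
    · exact .inr

theorem isotopic_comp_id {O O' : Smoothing W B} (C : Cobordism O O') :
    Isotopic W (C.comp (Cobordism.id O')).carrier C.carrier := by
  obtain ⟨ε, h0, h1, -, hC⟩ := C.exists_collar
  let k : ℝ := 2 * ε / (1 + ε)
  have hk0 : 0 < k := by positivity
  have hk : k * (1 + ε) = 2 * ε := by simp only [k]; field_simp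
  have hk2 : k < 1 := by nlinarith
  refine isotopic_of_reparam (Cobordism.subset _) C.subset
    (fun t => min (2 * t + 0) (k * t + (1 - k))) (by fun_prop)
    (fun _ _ h => min_lt_min (strictMono_affine two_pos 0 h) (strictMono_affine hk0 (1 - k) h))
    (by rw [min_eq_left] <;> nlinarith)
    (by rw [min_eq_right] <;> linarith)
    (isPLOn_min (isPLOn_affine _ _ _) (isPLOn_affine _ _ _)) ?_
  intro x t ht
  rw [show (C.comp (Cobordism.id O')).carrier = stack C.carrier (O'.carrier ×ˢ Icc 0 1) from rfl,
    mem_stack]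
  simp only [mem_prod, mem_Icc]
  rcases le_total ((1 - ε) / 2) t with h | h
  · have e : min (2 * t + 0) (k * t + (1 - k)) = k * t + (1 - k) := by
      rw [min_eq_right]
      nlinarith
    have h2 : 1 - ε ≤ k * t + (1 - k) := by nlinarith
    have h3 : k * t + (1 - k) ≤ 1 := by nlinarith [ht.2]
    rw [e, hC _ _ h2, hC _ _ (by linarith)]
    constructor
    · rintro (⟨h, -⟩ | ⟨h, -⟩) <;> exact ⟨h, h3⟩
    · rintro ⟨h, -⟩
      rcases le_total (2 * t) 1 with h5 | h5
      · exact .inl ⟨h, h5⟩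
      · exact .inr ⟨h, by linarith, by linarith [ht.2]⟩
  · have e : min (2 * t + 0) (k * t + (1 - k)) = 2 * t := by
      rw [min_eq_left]
      · ring
      · nlinarith
    rw [e]
    constructor
    · rintro (h5 | ⟨_, h5, _⟩)
      · exact h5
      · linarith
    · exact .inl

theorem isotopic_comp_assoc {O₁ O₂ O₃ O₄ : Smoothing W B} (C₁ : Cobordism O₁ O₂)
    (C₂ : Cobordism O₂ O₃) (C₃ : Cobordism O₃ O₄) :
    Isotopic W ((C₁.comp C₂).comp C₃).carrier (C₁.comp (C₂.comp C₃)).carrier := by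
  refine isotopic_of_reparam (Cobordism.subset _) (Cobordism.subset _)
    (fun t => min (2 * t + 0) (min (1 * t + 1 / 4) (1 / 2 * t + 1 / 2))) (by fun_prop)
    (fun _ _ h => min_lt_min (strictMono_affine two_pos 0 h) (min_lt_min
      (strictMono_affine one_pos _ h) (strictMono_affine (by norm_num) _ h)))
    (by norm_num) (by norm_num)
    (isPLOn_min (isPLOn_affine _ _ _) (isPLOn_min (isPLOn_affine _ _ _) (isPLOn_affine _ _ _))) ?_
  intro x t ht
  rw [show ((C₁.comp C₂).comp C₃).carrier = stack (stack C₁.carrier C₂.carrier) C₃.carrier from rfl,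
    show (C₁.comp (C₂.comp C₃)).carrier = stack C₁.carrier (stack C₂.carrier C₃.carrier) from rfl]
  simp only [mem_stack]
  have not_mem : ∀ {P Q : Smoothing W B} (C : Cobordism P Q) (s : ℝ), s < 0 ∨ 1 < s →
      ¬ (x, s) ∈ C.carrier := fun C s hs h => by
    have := C.height h
    rcases hs with hs | hs <;> linarith
  rcases lt_trichotomy t (1 / 4) with h | rfl | h
  · have e : min (2 * t + 0) (min (1 * t + 1 / 4) (1 / 2 * t + 1 / 2)) = 2 * t := by
      rw [min_eq_left]
      · ring
      · exact le_min (by linarith) (by linarith)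
    rw [e]
    have n1 := not_mem C₂ (2 * (2 * t) - 1) (.inl (by linarith))
    have n2 := not_mem C₃ (2 * t - 1) (.inl (by linarith))
    have n3 := not_mem C₂ (2 * (2 * (2 * t) - 1)) (.inl (by linarith))
    have n4 := not_mem C₃ (2 * (2 * (2 * t) - 1) - 1) (.inl (by linarith))
    tauto
  · have n2 := not_mem C₃ (-(1 / 2)) (.inl (by norm_num))
    have n4 := not_mem C₃ (-1) (.inl (by norm_num))
    norm_num [n2, n4]
  rcases lt_trichotomy t (1 / 2) with h' | rfl | h'
  · have e : min (2 * t + 0) (min (1 * t + 1 / 4) (1 / 2 * t + 1 / 2)) = t + 1 / 4 := by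
      rw [min_eq_right, min_eq_left]
      · ring
      · linarith
      · exact min_le_of_left_le (by linarith)
    rw [e]
    have n1 := not_mem C₁ (2 * (2 * t)) (.inr (by linarith))
    have n2 := not_mem C₃ (2 * t - 1) (.inl (by linarith))
    have n3 := not_mem C₁ (2 * (t + 1 / 4)) (.inr (by linarith))
    have n4 := not_mem C₃ (2 * (2 * (t + 1 / 4) - 1) - 1) (.inl (by linarith))
    have e2 : 2 * (2 * (t + 1 / 4) - 1) = 2 * (2 * t) - 1 := by ring
    rw [e2] at n4 ⊢
    tauto
  · have n2 := not_mem C₁ 2 (.inr (by norm_num))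
    have n4 := not_mem C₁ (3 / 2) (.inr (by norm_num))
    norm_num [n2, n4]
  · have e : min (2 * t + 0) (min (1 * t + 1 / 4) (1 / 2 * t + 1 / 2)) = 1 / 2 * t + 1 / 2 := by
      rw [min_eq_right, min_eq_right]
      · linarith
      · exact min_le_of_right_le (by linarith)
    rw [e]
    have n1 := not_mem C₁ (2 * (2 * t)) (.inr (by linarith))
    have n2 := not_mem C₂ (2 * (2 * t) - 1) (.inr (by linarith))
    have n3 := not_mem C₁ (2 * (1 / 2 * t + 1 / 2)) (.inr (by linarith))
    have n4 := not_mem C₂ (2 * (2 * (1 / 2 * t + 1 / 2) - 1)) (.inr (by linarith))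
    have e2 : 2 * (2 * (1 / 2 * t + 1 / 2) - 1) - 1 = 2 * t - 1 := by ring
    rw [e2]
    tauto

/-- The category of smoothings and isotopy classes of cobordisms (isotopy is already an equivalence
relation, so `Quot` identifies exactly the isotopic cobordisms). The first factor of `f ≫ g` is at
the bottom. -/
instance : Category (Smoothing W B) where
  Hom O O' := Quot fun C C' : Cobordism O O' => Isotopic W C.carrier C'.carrier
  id O := Quot.mk _ (Cobordism.id O)
  comp f g := Quot.map₂ Cobordism.comp (fun C _ _ h => isotopic_comp_right C h)
    (fun _ _ D h => isotopic_comp_left h D) f g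
  id_comp := by rintro _ _ ⟨C⟩; exact Quot.sound (isotopic_id_comp C)
  comp_id := by rintro _ _ ⟨C⟩; exact Quot.sound (isotopic_comp_id C)
  assoc := by rintro _ _ _ _ ⟨C₁⟩ ⟨C₂⟩ ⟨C₃⟩; exact Quot.sound (isotopic_comp_assoc C₁ C₂ C₃)

/-! Planar arc diagrams and their action on smoothings and cobordisms -/

/-- A planar arc diagram with `n` inputs: disjoint disks in the interior of the output region `W`,
and a collection of disjoint embedded arcs and closed curves between them, with end points `B` on
the frontier of `W` and `ends i` on that of the `i`-th input disk. -/
structure PlanarArcDiagram (W : Set Plane) (B : Finset Plane) (n : ℕ) where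
  inputDisk : Fin n → Set Plane
  isDisk : ∀ i, IsDisk (inputDisk i)
  inputDisk_subset : ∀ i, inputDisk i ⊆ interior W
  disjoint : ∀ i j, i ≠ j → Disjoint (inputDisk i) (inputDisk j)
  ends : Fin n → Finset Plane
  curves : Set Plane
  isPolyhedron : IsPolyhedron curves
  subset : curves ⊆ W
  disjoint_interior : ∀ i, Disjoint curves (interior (inputDisk i))
  inter_frontier : curves ∩ frontier W = B
  inter_inputDisk : ∀ i, curves ∩ frontier (inputDisk i) = ends i
  isCurve : IsCurve curves (B ∪ ⋃ i, (ends i : Set Plane))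

namespace PlanarArcDiagram
variable {n : ℕ} (D : PlanarArcDiagram W B n)

theorem isClosed_inputDisk (i : Fin n) : IsClosed (D.inputDisk i) := by
  obtain ⟨h, -, e⟩ := D.isDisk i
  rw [e, h.isClosed_image]
  exact Metric.isClosed_closedBall

theorem ends_iff (i : Fin n) (x : Plane) :
    x ∈ D.ends i ↔ x ∈ D.curves ∧ x ∈ D.inputDisk i := by
  have h1 := Set.ext_iff.1 (D.inter_inputDisk i) x
  simp only [mem_inter_iff, (D.isClosed_inputDisk i).frontier_eq, mem_sdiff, Finset.mem_coe] at h1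
  rw [← h1]
  have : x ∈ D.curves → x ∉ interior (D.inputDisk i) := fun hx hx' =>
    disjoint_left.1 (D.disjoint_interior i) hx hx'
  tauto

theorem ends_notMem_interior {i : Fin n} {x : Plane} (h : x ∈ D.ends i) :
    x ∉ interior (D.inputDisk i) := fun h' =>
  disjoint_left.1 (D.disjoint_interior i) ((D.ends_iff i x).1 h).1 h'

theorem notMem_boundary {i : Fin n} {x : Plane} (h : x ∈ D.inputDisk i) : x ∉ B := fun hB => by
  have : x ∈ D.curves ∩ frontier W := by rw [D.inter_frontier]; exact hB
  exact this.2.2 (D.inputDisk_subset i h)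

theorem eq_of_mem {i j : Fin n} {x : Plane} (hi : x ∈ D.inputDisk i) (hj : x ∈ D.inputDisk j) :
    i = j := by
  by_contra h
  exact disjoint_left.1 (D.disjoint i j h) hi hj

/-- A neighbourhood of an end point on the `i`-th input disk. -/
def endNhd (i : Fin n) (b : Plane) : Set Plane :=
  (⋃ j : {j : Fin n // j ≠ i}, D.inputDisk j)ᶜ ∩ ((D.ends i : Set Plane) \ {b})ᶜ ∩ (B : Set Plane)ᶜ

theorem isOpen_endNhd (i : Fin n) (b : Plane) : IsOpen (D.endNhd i b) := by
  refine (IsOpen.inter ?_ ?_).inter ?_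
  · exact (isClosed_iUnion_of_finite fun j => D.isClosed_inputDisk _).isOpen_compl
  · exact ((D.ends i).finite_toSet.subset sdiff_subset).isClosed.isOpen_compl
  · exact B.finite_toSet.isClosed.isOpen_compl

theorem mem_endNhd {i : Fin n} {b : Plane} (hb : b ∈ D.ends i) : b ∈ D.endNhd i b := by
  have h := ((D.ends_iff i b).1 hb).2
  refine ⟨⟨?_, ?_⟩, D.notMem_boundary h⟩
  · rw [mem_compl_iff, mem_iUnion]
    rintro ⟨⟨j, hj⟩, hj'⟩
    exact hj (D.eq_of_mem hj' h)
  · simp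

theorem endNhd_disk {i j : Fin n} {b x : Plane} (hx : x ∈ D.endNhd i b) (h : x ∈ D.inputDisk j) :
    j = i := by
  by_contra hj
  exact hx.1.1 (mem_iUnion.2 ⟨⟨j, hj⟩, h⟩)

theorem endNhd_ends {i j : Fin n} {b x : Plane} (hx : x ∈ D.endNhd i b) (h : x ∈ D.ends j) :
    x = b := by
  obtain rfl := D.endNhd_disk hx ((D.ends_iff j x).1 h).2
  by_contra hb
  exact hx.1.2 ⟨h, hb⟩

/-- The smoothing obtained by placing smoothings in the input disks. -/
def obj (O : ∀ i, Smoothing (D.inputDisk i) (D.ends i)) : Smoothing W B where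
  carrier := D.curves ∪ ⋃ i, (O i).carrier
  isPolyhedron := D.isPolyhedron.union (.iUnion fun i => (O i).isPolyhedron)
  subset := union_subset D.subset (iUnion_subset fun i =>
    (O i).subset.trans ((D.inputDisk_subset i).trans interior_subset))
  inter_frontier := by
    rw [union_inter_distrib_right, D.inter_frontier, union_eq_left]
    rintro x ⟨hx, hx'⟩
    obtain ⟨i, hi⟩ := mem_iUnion.1 hx
    exact absurd (D.inputDisk_subset i ((O i).subset hi)) hx'.2
  isCurve := by
    refine ⟨fun x hx => .inl (D.isCurve.1 (.inl hx)), fun x hx => ?_⟩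
    by_cases hd : ∃ i, x ∈ D.inputDisk i
    · obtain ⟨i, hi⟩ := hd
      have hOi : ∀ y ∈ D.inputDisk i, (y ∈ D.curves ∪ ⋃ i, (O i).carrier) →
          y ∈ (O i).carrier := by
        rintro y hy (h | h)
        · exact (O i).isCurve.1 ((D.ends_iff i y).2 ⟨h, hy⟩)
        · obtain ⟨j, hj⟩ := mem_iUnion.1 h
          obtain rfl := D.eq_of_mem hy ((O j).subset hj)
          exact hj
      have hxO := hOi x hi hx
      by_cases hint : x ∈ interior (D.inputDisk i)
      · refine ((O i).isCurve.2 x hxO).congr hxO isOpen_interior hint (fun y hy => ?_)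
          (fun y hy => ?_)
        · exact ⟨fun h => .inr (mem_iUnion.2 ⟨i, h⟩), hOi y (interior_subset hy)⟩
        · exact iff_of_false (fun h => D.ends_notMem_interior h hy)
            (D.notMem_boundary (interior_subset hy))
      · have hxe : x ∈ D.ends i := by
          have : x ∈ (O i).carrier ∩ frontier (D.inputDisk i) := by
            rw [(D.isClosed_inputDisk i).frontier_eq]; exact ⟨hxO, hi, hint⟩
          rw [(O i).inter_frontier] at this
          exact this
        have hxc := ((D.ends_iff i x).1 hxe).1
        have hN := D.isOpen_endNhd i x
        have hxN := D.mem_endNhd hxe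
        refine (hasHalfChart_glue_curve (D := (B : Set Plane))
          (O i).isPolyhedron.1.isClosed D.isPolyhedron.1.isClosed
          ((O i).isCurve.2 x hxO) (D.isCurve.2 x hxc) hxO hxc hN hxN
          (fun q hq h1 h2 => D.endNhd_ends hq ((D.ends_iff i q).2 ⟨h2, (O i).subset h1⟩))
          hxe ?_ (fun q hq => hq.2)).congr (.inl hxO) hN hxN ?_ (fun _ _ => Iff.rfl)
        · intro q hq
          constructor
          · rintro (h | h)
            · exact absurd h hq.2
            · obtain ⟨j, hj⟩ := mem_iUnion.1 h
              exact D.endNhd_ends hq hj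
          · rintro rfl
            exact .inr (mem_iUnion.2 ⟨i, hxe⟩)
        · intro q hq
          constructor
          · rintro (h | h)
            · exact .inr (mem_iUnion.2 ⟨i, h⟩)
            · exact .inl h
          · rintro (h | h)
            · exact .inr h
            · obtain ⟨j, hj⟩ := mem_iUnion.1 h
              obtain rfl := D.endNhd_disk hq ((O j).subset hj)
              exact .inl hj
    · push Not at hd
      have hxc : x ∈ D.curves := hx.resolve_right fun h => by
        obtain ⟨j, hj⟩ := mem_iUnion.1 h
        exact hd j ((O j).subset hj)
      refine (D.isCurve.2 x hxc).congr hxc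
        (isClosed_iUnion_of_finite fun j => D.isClosed_inputDisk j).isOpen_compl
        (by simpa using hd) (fun y hy => ?_) (fun y hy => ?_)
      · refine ⟨.inl, fun h => h.resolve_right fun h => ?_⟩
        obtain ⟨j, hj⟩ := mem_iUnion.1 h
        exact hy (mem_iUnion.2 ⟨j, (O j).subset hj⟩)
      · refine ⟨fun h => h.resolve_right fun h => ?_, .inl⟩
        obtain ⟨j, hj⟩ := mem_iUnion.1 h
        exact hy (mem_iUnion.2 ⟨j, ((D.ends_iff j y).1 hj).2⟩)

/-- The cobordism obtained by placing cobordisms in the vertical cylindrical holes; the arcs of the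
diagram become vertical curtains. -/
def map {O O' : ∀ i, Smoothing (D.inputDisk i) (D.ends i)} (C : ∀ i, Cobordism (O i) (O' i)) :
    Cobordism (D.obj O) (D.obj O') where
  carrier := D.curves ×ˢ Icc 0 1 ∪ ⋃ i, (C i).carrier
  isPolyhedron := (D.isPolyhedron.prod_Icc 0 1).union (.iUnion fun i => (C i).isPolyhedron)
  subset := union_subset (prod_mono D.subset subset_rfl) (iUnion_subset fun i =>
    (C i).subset.trans (prod_mono ((D.inputDisk_subset i).trans interior_subset) subset_rfl))
  inter_side := by
    rw [union_inter_distrib_right, prod_inter_prod, D.inter_frontier, inter_univ, union_eq_left]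
    rintro x ⟨hx, hx'⟩
    obtain ⟨i, hi⟩ := mem_iUnion.1 hx
    exact absurd (D.inputDisk_subset i ((C i).subset hi).1) hx'.1.2
  collar := by
    choose ε h0 h1 hl hu using fun i => (C i).exists_collar
    obtain ⟨δ, hδ, hδ1, hδε⟩ : ∃ δ : ℝ, 0 < δ ∧ δ < 1 ∧ ∀ i, δ < ε i := by
      have h : ∀ᶠ δ in nhdsWithin (0 : ℝ) (Ioi 0), δ ∈ Ioi (0 : ℝ) ∧ δ < 1 ∧ ∀ i, δ < ε i :=
        Filter.Eventually.and self_mem_nhdsWithin (.and (nhdsWithin_le_nhds (Iio_mem_nhds one_pos))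
          (Filter.eventually_all.2 fun i => nhdsWithin_le_nhds (Iio_mem_nhds (h0 i))))
      obtain ⟨δ, h⟩ := h.exists
      exact ⟨δ, h⟩
    refine ⟨δ, hδ, hδ1, ?_, ?_⟩
    · ext ⟨x, t⟩
      simp only [obj, mem_inter_iff, mem_union, mem_prod, mem_iUnion, mem_Icc, mem_ofPred_eq]
      constructor
      · rintro ⟨⟨h, h2, -⟩ | ⟨i, h⟩, h3⟩
        · exact ⟨.inl h, h2, h3⟩
        · have := (hl i x t (h3.trans (hδε i).le)).1 h
          exact ⟨.inr ⟨i, this.1⟩, this.2, h3⟩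
      · rintro ⟨h | ⟨i, h⟩, h2, h3⟩
        · exact ⟨.inl ⟨h, h2, by linarith⟩, h3⟩
        · exact ⟨.inr ⟨i, (hl i x t (h3.trans (hδε i).le)).2 ⟨h, h2⟩⟩, h3⟩
    · ext ⟨x, t⟩
      simp only [obj, mem_inter_iff, mem_union, mem_prod, mem_iUnion, mem_Icc, mem_ofPred_eq]
      constructor
      · rintro ⟨⟨h, -, h2⟩ | ⟨i, h⟩, h3⟩
        · exact ⟨.inl h, h3, h2⟩
        · have := (hu i x t (by linarith [hδε i])).1 h
          exact ⟨.inr ⟨i, this.1⟩, h3, this.2⟩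
      · rintro ⟨h | ⟨i, h⟩, h2, h3⟩
        · exact ⟨.inl ⟨h, by linarith, h3⟩, h2⟩
        · exact ⟨.inr ⟨i, (hu i x t (by linarith [hδε i])).2 ⟨h, h3⟩⟩, h2⟩
  isSurface := by
    set S : Set Space := D.curves ×ˢ Icc 0 1 ∪ ⋃ i, (C i).carrier with hS
    have end0 : ∀ {P : ∀ i, Smoothing (D.inputDisk i) (D.ends i)} {x : Plane},
        x ∈ (D.obj P).carrier ↔ x ∈ D.curves ∨ ∃ i, x ∈ (P i).carrier := by
      intro P x; simp [obj]
    refine ⟨?_, ?_⟩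
    · rintro ⟨x, t⟩ ((⟨h, h2⟩ | ⟨h, h2⟩) | ⟨h, h2⟩)
      · obtain rfl : t = 0 := h2
        rcases end0.1 h with h | ⟨i, h⟩
        · exact .inl ⟨h, by simp⟩
        · exact .inr (mem_iUnion.2 ⟨i, (C i).isSurface.1 (.inl (.inl ⟨h, rfl⟩))⟩)
      · exact .inl ⟨D.isCurve.1 (.inl h), h2⟩
      · obtain rfl : t = 1 := h2
        rcases end0.1 h with h | ⟨i, h⟩
        · exact .inl ⟨h, by simp⟩
        · exact .inr (mem_iUnion.2 ⟨i, (C i).isSurface.1 (.inr ⟨h, rfl⟩)⟩)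
    · rintro ⟨x, t⟩ hx
      have htI : t ∈ Icc (0 : ℝ) 1 := by
        rcases hx with h | h
        · exact h.2
        · obtain ⟨j, hj⟩ := mem_iUnion.1 h
          exact (C j).height hj
      by_cases hd : ∃ i, x ∈ D.inputDisk i
      · obtain ⟨i, hi⟩ := hd
        have hCi : ∀ y ∈ D.inputDisk i, ∀ s, (y, s) ∈ S → (y, s) ∈ (C i).carrier := by
          rintro y hy s (h | h)
          · exact (C i).isSurface.1 (.inl (.inr ⟨(D.ends_iff i y).2 ⟨h.1, hy⟩, h.2⟩))
          · obtain ⟨j, hj⟩ := mem_iUnion.1 h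
            obtain rfl := D.eq_of_mem hy ((C j).subset hj).1
            exact hj
        have hxC := hCi x hi t hx
        by_cases hint : x ∈ interior (D.inputDisk i)
        · have hcur : ∀ y ∈ interior (D.inputDisk i), y ∉ D.curves := fun y hy h =>
            disjoint_left.1 (D.disjoint_interior i) h hy
          have hobj : ∀ (P : ∀ i, Smoothing (D.inputDisk i) (D.ends i)),
              ∀ y ∈ interior (D.inputDisk i), y ∈ (D.obj P).carrier ↔ y ∈ (P i).carrier := by
            intro P y hy
            rw [end0]
            constructor
            · rintro (h | ⟨j, hj⟩)
              · exact absurd h (hcur y hy)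
              · obtain rfl := D.eq_of_mem (interior_subset hy) ((P j).subset hj)
                exact hj
            · exact fun h => .inr ⟨i, h⟩
          refine ((C i).isSurface.2 _ hxC).congr hxC (N := Prod.fst ⁻¹' interior (D.inputDisk i))
            (isOpen_interior.preimage continuous_fst) hint ?_ ?_
          · rintro ⟨y, s⟩ hy
            exact ⟨fun h => .inr (mem_iUnion.2 ⟨i, h⟩), hCi y (interior_subset hy) s⟩
          · rintro ⟨y, s⟩ hy
            have hy : y ∈ interior (D.inputDisk i) := hy
            have n1 : y ∉ D.ends i := fun h => D.ends_notMem_interior h hy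
            have n2 : y ∉ B := D.notMem_boundary (interior_subset hy)
            simp only [cobBoundary, mem_union, mem_prod, hobj _ y hy, Finset.mem_coe, n1, n2]
        · have hxe : x ∈ D.ends i := by
            have : (x, t) ∈ (C i).carrier ∩ frontier (D.inputDisk i) ×ˢ univ := by
              rw [(D.isClosed_inputDisk i).frontier_eq]
              exact ⟨hxC, ⟨hi, hint⟩, mem_univ _⟩
            rw [(C i).inter_side] at this
            exact this.1
          have hxc := ((D.ends_iff i x).1 hxe).1
          have hN := D.isOpen_endNhd i x
          have hxN := D.mem_endNhd hxe
          have hSN : ∀ y ∈ D.endNhd i x, ∀ s, (y, s) ∈ S ↔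
              (y ∈ D.curves ∧ s ∈ Icc (0 : ℝ) 1) ∨ (y, s) ∈ (C i).carrier := by
            intro y hy s
            constructor
            · rintro (h | h)
              · exact .inl h
              · obtain ⟨j, hj⟩ := mem_iUnion.1 h
                obtain rfl := D.endNhd_disk hy ((C j).subset hj).1
                exact .inr hj
            · rintro (h | h)
              · exact .inl h
              · exact .inr (mem_iUnion.2 ⟨i, h⟩)
          have hobj : ∀ (P : ∀ i, Smoothing (D.inputDisk i) (D.ends i)),
              ∀ y ∈ D.endNhd i x, y ∈ (D.obj P).carrier ↔ y ∈ D.curves ∨ y ∈ (P i).carrier := by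
            intro P y hy
            rw [end0]
            refine or_congr Iff.rfl ⟨?_, fun h => ⟨i, h⟩⟩
            rintro ⟨j, hj⟩
            obtain rfl := D.endNhd_disk hy ((P j).subset hj)
            exact hj
          obtain ⟨ε, h0, h1, hl, hu⟩ := (C i).exists_collar
          rcases htI.1.eq_or_lt with rfl | ht0
          · have hm : (x, (0 : ℝ)) ∈ (D.obj O).carrier ×ˢ Icc (0 : ℝ) 1 :=
              ⟨end0.2 (.inl hxc), by simp⟩
            refine ((D.obj O).isCurve.prod_Icc.2 _ hm).congr hm
              (N := D.endNhd i x ×ˢ Iio ε) (hN.prod isOpen_Iio) ⟨hxN, h0⟩ ?_ ?_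
            · rintro ⟨y, s⟩ ⟨hy, hs⟩
              have hs : s < ε := hs
              rw [hSN y hy s, hl y s hs.le]
              simp only [mem_prod, hobj _ y hy, mem_Icc]
              have : s ≤ 1 := by linarith
              tauto
            · rintro ⟨y, s⟩ ⟨hy, hs⟩
              have hs : s < ε := hs
              have n1 : s ≠ 1 := by linarith
              simp only [cobBoundary, mem_union, mem_prod, mem_singleton_iff, n1, and_false]
          rcases htI.2.eq_or_lt with rfl | ht1
          · have hm : (x, (1 : ℝ)) ∈ (D.obj O').carrier ×ˢ Icc (0 : ℝ) 1 :=
              ⟨end0.2 (.inl hxc), by simp⟩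
            refine ((D.obj O').isCurve.prod_Icc.2 _ hm).congr hm
              (N := D.endNhd i x ×ˢ Ioi (1 - ε)) (hN.prod isOpen_Ioi)
              ⟨hxN, by show 1 - ε < 1; linarith⟩ ?_ ?_
            · rintro ⟨y, s⟩ ⟨hy, hs⟩
              have hs : 1 - ε < s := hs
              rw [hSN y hy s, hu y s hs.le]
              simp only [mem_prod, hobj _ y hy, mem_Icc]
              have : 0 ≤ s := by linarith
              tauto
            · rintro ⟨y, s⟩ ⟨hy, hs⟩
              have hs : 1 - ε < s := hs
              have n1 : s ≠ 0 := by linarith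
              simp only [cobBoundary, mem_union, mem_prod, mem_singleton_iff, n1, and_false,
                false_or]
          have hIoo : ∀ {s : ℝ}, s ∈ Ioo (0 : ℝ) 1 → s ≠ 0 ∧ s ≠ 1 ∧ s ∈ Icc (0 : ℝ) 1 :=
            fun hs => ⟨hs.1.ne', hs.2.ne, Ioo_subset_Icc_self hs⟩
          refine (hasHalfChart_glue_surface (D := cobBoundary (D.obj O).carrier B (D.obj O').carrier)
            (C i).isPolyhedron.1.isClosed D.isPolyhedron.1.isClosed ((C i).isSurface.2 _ hxC)
            (D.isCurve.2 x hxc) hxC hxc hN hxN ht0 ht1 ?_ (C i).isSurface.1 ?_ ?_ ?_).congr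
            (.inl hxC) (N := D.endNhd i x ×ˢ univ) (hN.prod isOpen_univ) ⟨hxN, mem_univ _⟩
            ?_ (fun _ _ => Iff.rfl)
          · rintro ⟨y, s⟩ ⟨hy, -⟩ hq hq'
            exact D.endNhd_ends hy ((D.ends_iff i y).2 ⟨hq', ((C i).subset hq).1⟩)
          · rintro ⟨y, s⟩ ⟨hy, hs⟩
            obtain ⟨s0, s1, hs⟩ := hIoo hs
            simp only [cobBoundary, mem_union, mem_prod, mem_singleton_iff, s0, s1, hs, and_false,
              and_true, false_or, or_false, Finset.mem_coe]
            exact ⟨fun h => D.endNhd_ends hy h, fun h => h ▸ hxe⟩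
          · intro q hq
            constructor
            · rintro (h | h)
              · exact absurd h hq.2
              · obtain ⟨j, hj⟩ := mem_iUnion.1 h
                exact D.endNhd_ends hq hj
            · rintro rfl
              exact .inr (mem_iUnion.2 ⟨i, hxe⟩)
          · rintro ⟨y, s⟩ ⟨hy, hs⟩
            obtain ⟨s0, s1, hs⟩ := hIoo hs
            have n2 : y ∉ B := hy.2
            simp [cobBoundary, s0, s1, n2]
          · rintro ⟨y, s⟩ ⟨hy, -⟩
            rw [hSN y hy s, or_comm]; rfl
      · push Not at hd
        have hxc : (x, t) ∈ D.curves ×ˢ Icc (0 : ℝ) 1 := hx.resolve_right fun h => by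
          obtain ⟨j, hj⟩ := mem_iUnion.1 h
          exact hd j ((C j).subset hj).1
        have hN : IsOpen (⋃ i, D.inputDisk i)ᶜ :=
          (isClosed_iUnion_of_finite fun j => D.isClosed_inputDisk j).isOpen_compl
        refine (D.isCurve.prod_Icc.2 _ hxc).congr hxc (hN.preimage continuous_fst)
          (by simpa using hd) ?_ ?_
        · rintro ⟨y, s⟩ hy
          refine ⟨.inl, fun h => h.resolve_right fun h => ?_⟩
          obtain ⟨j, hj⟩ := mem_iUnion.1 h
          exact hy (mem_iUnion.2 ⟨j, ((C j).subset hj).1⟩)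
        · rintro ⟨y, s⟩ hy
          have n1 : ∀ j, y ∉ D.inputDisk j := fun j hj => hy (mem_iUnion.2 ⟨j, hj⟩)
          have n2 : ∀ j, y ∉ D.ends j := fun j hj => n1 j ((D.ends_iff j y).1 hj).2
          have n3 : ∀ (P : ∀ i, Smoothing (D.inputDisk i) (D.ends i)),
              y ∈ (D.obj P).carrier ↔ y ∈ D.curves := fun P => by
            rw [end0]
            exact ⟨fun h => h.resolve_right fun ⟨j, hj⟩ => n1 j ((P j).subset hj), .inl⟩
          simp [cobBoundary, n2, n3]

end PlanarArcDiagram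

/-! The local relations -/

/-- The preadditive category `Cob(B)`: formal integral combinations of isotopy classes of
cobordisms in the cylinder over `W`. -/
abbrev Cob (W : Set Plane) (B : Finset Plane) : Type := Free ℤ (Smoothing W B)

/-- The morphism of `Cob(B)` represented by a cobordism. -/
noncomputable def Cobordism.hom {O O' : Smoothing W B} (C : Cobordism O O') :
    Free.of ℤ O ⟶ Free.of ℤ O' :=
  (Free.embedding ℤ (Smoothing W B)).map (X := O) (Y := O') (Quot.mk _ C)

/-- A standard torus: the boundary of the product of an interval with a square annulus of inner
and outer radius `r < R` in the sup norm. -/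
def stdTorus (c : Space) (r R h : ℝ) : Set Space :=
  {p | r ≤ dist p.1 c.1 ∧ dist p.1 c.1 ≤ R ∧ |p.2 - c.2| ≤ h ∧
    (dist p.1 c.1 = r ∨ dist p.1 c.1 = R ∨ |p.2 - c.2| = h)}

/-- `A` is isotopic to a sphere, the boundary of a cube (a sphere of the sup norm) in the interior
of the cylinder. -/
def IsIsotopicToSphere (W : Set Plane) (A : Set Space) : Prop :=
  ∃ (c : Space) (r : ℝ), 0 < r ∧ Metric.closedBall c r ⊆ interior W ×ˢ Ioo 0 1 ∧
    Isotopic W A (Metric.sphere c r)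

/-- `A` is isotopic to a standard torus in the interior of the cylinder. -/
def IsIsotopicToTorus (W : Set Plane) (A : Set Space) : Prop :=
  ∃ (c : Space) (r R h : ℝ), 0 < r ∧ r < R ∧ 0 < h ∧
    Metric.closedBall c.1 R ×ˢ Icc (c.2 - h) (c.2 + h) ⊆ interior W ×ˢ Ioo 0 1 ∧
    Isotopic W A (stdTorus c r R h)

/-- The model ball, a cube of side 8. -/
def modelBall : Set Space := Metric.closedBall 0 4

/-- The centres of the four model disks: the first and the fourth on the bottom face of the model
ball, the second and the third on the top face. -/
def modelCenter : Fin 4 → Space := ![((-2, 0), -4), ((-2, 0), 4), ((2, 0), 4), ((2, 0), -4)]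

/-- The four model disks: half surfaces of cubes, properly embedded in the model ball. -/
def modelDisk (i : Fin 4) : Set Space := Metric.sphere (modelCenter i) 1 ∩ modelBall

/-- The model tube from the boundary of the `i`-th model disk, on the bottom face, straight to that
of the `j`-th model disk, on the top face. -/
noncomputable def modelTube (i j : Fin 4) : Set Space :=
  {p | p.2 ∈ Icc (-4 : ℝ) 4 ∧
    dist p.1 (AffineMap.lineMap (modelCenter i).1 (modelCenter j).1 ((p.2 + 4) / 8)) = 1}

/-- The result of removing two of the disks in the ball `φ(modelBall)` from `A` and replacing them
by a tube with the same boundary. -/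
def tubed (φ : Space → Space) (A : Set Space) (i j : Fin 4) : Set Space :=
  A \ φ '' (modelDisk i ∪ modelDisk j) ∪ φ '' modelTube i j

/-- The combinations of cobordisms that are set equal to zero. -/
inductive LocalRelator {W : Set Plane} {B : Finset Plane} (O O' : Smoothing W B) :
    (Free.of ℤ O ⟶ Free.of ℤ O') → Prop
  /-- A cobordism with a component isotopic to a sphere is zero. -/
  | S (C : Cobordism O O') (p : Space) (hp : p ∈ C.carrier)
      (hS : IsIsotopicToSphere W (connectedComponentIn C.carrier p)) : LocalRelator O O' C.hom
  /-- A component isotopic to a torus may be removed, at the cost of a factor 2. -/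
  | T (C C' : Cobordism O O') (p : Space) (hp : p ∈ C.carrier)
      (hT : IsIsotopicToTorus W (connectedComponentIn C.carrier p))
      (h : C'.carrier = C.carrier \ connectedComponentIn C.carrier p) :
      LocalRelator O O' (C.hom - (2 : ℤ) • C'.hom)
  /-- `C` meets a ball in four disks: `C₁₂ + C₃₄ = C₁₃ + C₂₄`. -/
  | fourTu (C C₁₂ C₃₄ C₁₃ C₂₄ : Cobordism O O') (φ : Space → Space)
      (hφ : IsPLOn φ modelBall) (hφ' : InjOn φ modelBall)
      (hφW : φ '' modelBall ⊆ interior W ×ˢ Ioo 0 1)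
      (hC : C.carrier ∩ φ '' modelBall = φ '' ⋃ i, modelDisk i)
      (h₁₂ : C₁₂.carrier = tubed φ C.carrier 0 1)
      (h₃₄ : C₃₄.carrier = tubed φ C.carrier 3 2)
      (h₁₃ : C₁₃.carrier = tubed φ C.carrier 0 2)
      (h₂₄ : C₂₄.carrier = tubed φ C.carrier 3 1) :
      LocalRelator O O' (C₁₂.hom + C₃₄.hom - C₁₃.hom - C₂₄.hom)

/-- The ideal of `Cob(B)` generated by the local relators. -/
noncomputable def localIdeal (X Y : Cob W B) : AddSubgroup (X ⟶ Y) :=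
  AddSubgroup.closure {f | ∃ (O O' : Smoothing W B) (a : X ⟶ Free.of ℤ O)
    (r : Free.of ℤ O ⟶ Free.of ℤ O') (b : Free.of ℤ O' ⟶ Y), LocalRelator O O' r ∧ f = a ≫ r ≫ b}

/-- Two morphisms of `Cob(B)` are identified if they differ by an element of the ideal. -/
def localRel (W : Set Plane) (B : Finset Plane) : HomRel (Cob W B) :=
  fun X Y f g => f - g ∈ localIdeal X Y

theorem comp_mem_localIdeal {X Y Z : Cob W B} (f : X ⟶ Y) {g : Y ⟶ Z} (hg : g ∈ localIdeal Y Z) :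
    f ≫ g ∈ localIdeal X Z := by
  refine AddSubgroup.closure_induction (p := fun g _ => f ≫ g ∈ localIdeal X Z) ?_ ?_ ?_ ?_ hg
  · rintro _ ⟨O, O', a, r, b, hr, rfl⟩
    exact AddSubgroup.subset_closure ⟨O, O', f ≫ a, r, b, hr, by simp⟩
  · rw [Limits.comp_zero]; exact zero_mem _
  · intro x y _ _ hx hy; rw [Preadditive.comp_add]; exact add_mem hx hy
  · intro x _ hx; rw [Preadditive.comp_neg]; exact neg_mem hx

theorem mem_localIdeal_comp {X Y Z : Cob W B} {f : X ⟶ Y} (g : Y ⟶ Z) (hf : f ∈ localIdeal X Y) :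
    f ≫ g ∈ localIdeal X Z := by
  refine AddSubgroup.closure_induction (p := fun f _ => f ≫ g ∈ localIdeal X Z) ?_ ?_ ?_ ?_ hf
  · rintro _ ⟨O, O', a, r, b, hr, rfl⟩
    exact AddSubgroup.subset_closure ⟨O, O', a, r, b ≫ g, hr, by simp⟩
  · rw [Limits.zero_comp]; exact zero_mem _
  · intro x y _ _ hx hy; rw [Preadditive.add_comp]; exact add_mem hx hy
  · intro x _ hx; rw [Preadditive.neg_comp]; exact neg_mem hx

instance : Congruence (localRel W B) where
  comp_left f g g' h := by
    show _ - _ ∈ _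
    rw [← Preadditive.comp_sub]; exact comp_mem_localIdeal f h
  comp_right g h := by
    show _ - _ ∈ _
    rw [← Preadditive.sub_comp]; exact mem_localIdeal_comp g h
  equivalence :=
    { refl := fun f => by show _ - _ ∈ _; rw [sub_self]; exact zero_mem _
      symm := fun {f g} h => by
        show _ - _ ∈ _
        rw [← neg_sub]; exact neg_mem h
      trans := fun {f g k} h h' => by
        show _ - _ ∈ _
        rw [← sub_add_sub_cancel f g k]; exact add_mem h h' }

/-- The category `Cob_{/l}(B)`, the quotient of `Cob(B)` by the local relations. -/
abbrev CobL (W : Set Plane) (B : Finset Plane) : Type := Quotient (localRel W B)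

theorem localRel_add ⦃X Y : Cob W B⦄ (f₁ f₂ g₁ g₂ : X ⟶ Y) (h : localRel W B f₁ f₂)
    (h' : localRel W B g₁ g₂) : localRel W B (f₁ + g₁) (f₂ + g₂) := by
  show _ - _ ∈ _
  rw [add_sub_add_comm]; exact add_mem h h'

noncomputable instance : Preadditive (CobL W B) := Quotient.preadditive _ localRel_add

instance : (Quotient.functor (localRel W B)).Additive :=
  Quotient.functor_additive _ localRel_add

/-! Gradings -/

/-- The morphisms of degree `d` of `Cob(B)`: the combinations of cobordisms of degree `d`. -/
noncomputable def Cob.grading (X Y : Cob W B) (d : ℤ) : AddSubgroup (X ⟶ Y) :=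
  AddSubgroup.closure {f | ∃ C : Cobordism (W := W) (B := B) X Y, C.degree = d ∧ f = C.hom}

/-- The morphisms of degree `d` of the quotient: the classes of those of `Cob(B)`. -/
noncomputable def CobL.grading (X Y : CobL W B) (d : ℤ) : AddSubgroup (X ⟶ Y) :=
  (Cob.grading X.as Y.as d).map ((Quotient.functor (localRel W B)).mapAddHom (X := X.as) (Y := Y.as))

section graded
variable {𝒞 : Type*} [Category 𝒞] [Preadditive 𝒞]

/-- The Hom-sets are graded abelian groups, composition respects the gradings and the identities
have degree 0. -/
structure IsGradedHom (gr : ∀ X Y : 𝒞, ℤ → AddSubgroup (X ⟶ Y)) : Prop where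
  isInternal : ∀ X Y, DirectSum.IsInternal (gr X Y)
  comp_mem : ∀ {X Y Z} {d e : ℤ} {f : X ⟶ Y} {g : Y ⟶ Z}, f ∈ gr X Y d → g ∈ gr Y Z e →
    f ≫ g ∈ gr X Z (d + e)
  id_mem : ∀ X, 𝟙 X ∈ gr X X 0

/-- A graded category: the Hom-sets are graded, and there is an action of the integers on the
objects which leaves the morphisms as they are (`shiftHom`) but shifts the degrees. -/
structure IsGradedCategory [AddAction ℤ 𝒞] (gr : ∀ X Y : 𝒞, ℤ → AddSubgroup (X ⟶ Y))
    (shiftHom : ∀ (m n : ℤ) (X Y : 𝒞), (X ⟶ Y) ≃+ (m +ᵥ X ⟶ n +ᵥ Y)) : Prop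
    extends IsGradedHom gr where
  shiftHom_id : ∀ m X, shiftHom m m X X (𝟙 X) = 𝟙 (m +ᵥ X)
  shiftHom_comp : ∀ {l m n X Y Z} (f : X ⟶ Y) (g : Y ⟶ Z),
    shiftHom l n X Z (f ≫ g) = shiftHom l m X Y f ≫ shiftHom m n Y Z g
  shiftHom_mem : ∀ {m n X Y} {d : ℤ} {f : X ⟶ Y}, f ∈ gr X Y d →
    shiftHom m n X Y f ∈ gr (m +ᵥ X) (n +ᵥ Y) (d + n - m)

variable (𝒞) in
/-- The objects `X{m}`: copies of the objects of a category with integers attached. -/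
structure Shifted where
  obj : 𝒞
  deg : ℤ

namespace Shifted

instance : Category (Shifted 𝒞) where
  Hom X Y := X.obj ⟶ Y.obj
  id X := 𝟙 X.obj
  comp f g := f ≫ g
  id_comp f := Category.id_comp (X := _) (Y := _) f
  comp_id f := Category.comp_id (X := _) (Y := _) f
  assoc f g h := Category.assoc (W := _) (X := _) (Y := _) (Z := _) f g h

instance : Preadditive (Shifted 𝒞) where
  homGroup X Y := inferInstanceAs (AddCommGroup (X.obj ⟶ Y.obj))
  add_comp X Y Z f f' g := Preadditive.add_comp X.obj Y.obj Z.obj f f' g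
  comp_add X Y Z f g g' := Preadditive.comp_add X.obj Y.obj Z.obj f g g'

instance : AddAction ℤ (Shifted 𝒞) where
  vadd m X := ⟨X.obj, m + X.deg⟩
  zero_vadd X := by
    show Shifted.mk X.obj (0 + X.deg) = X
    rw [zero_add]
  add_vadd m n X := by
    show Shifted.mk X.obj (m + n + X.deg) = Shifted.mk X.obj (m + (n + X.deg))
    rw [add_assoc]

/-- A morphism of degree `d` has degree `d + n - m` as a morphism `X{m} ⟶ Y{n}`. -/
def grading (gr : ∀ X Y : 𝒞, ℤ → AddSubgroup (X ⟶ Y)) (X Y : Shifted 𝒞) (d : ℤ) :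
    AddSubgroup (X ⟶ Y) :=
  gr X.obj Y.obj (d - Y.deg + X.deg)

/-- As plain abelian groups, morphisms are unchanged by the shifts. -/
def shiftHom (m n : ℤ) (X Y : Shifted 𝒞) : (X ⟶ Y) ≃+ (m +ᵥ X ⟶ n +ᵥ Y) :=
  AddEquiv.refl (X.obj ⟶ Y.obj)

end Shifted
end graded

end Khovanov

/-! The proof treats the Euler characteristic as a valuation. In the group of integer functions
spanned by the indicators of nonempty compact convex sets, a combination is assigned the sum of its
coefficients. That this sum depends only on the function is proved by induction on the dimension: on
the line it is the sum of the one-sided jumps, and in `E × ℝ` it is obtained by evaluating first on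
horizontal slices and then along the height. `HasEuler A n` says that the indicator of `A` lies in
this group with value `n`. `A` need not be closed, so a set may be cut into disjoint pieces, and
inclusion-exclusion and invariance under injective piecewise linear maps (`HasEuler.image_pl`)
become formal.

Two facts connect the valuation with triangulations. The open faces of a finite complex partition
its space, and an open face with `k` vertices has value `(-1)^(k-1)`; hence the alternating number
of simplices equals the valuation for every triangulation (`hasEuler_space`). Every compact
polyhedron has a triangulation: take all hyperplanes bounding its convex pieces, choose one point in
each relatively open cell, and use the chains of cells as simplices
(`exists_triangulation_of_cells`).

The degree is additive because a compact polygonal curve has Euler characteristic half the number of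
its end points (`IsCurve.hasEuler`, a handshake count in which the half-space charts exclude tripods
and isolated points). Two stacked cobordisms overlap in a smoothing, whose value `|B| / 2` is
exactly the correction in the degree. In a planar composition the curtains overlap the inserted
cobordisms in vertical lines over the end points, and the same count applies.

The local relations are homogeneous because a torus has value 0, and replacing two disks by a tube
changes the value by -2 whichever two disks are chosen (`hasEuler_tubed`). A single cobordism is
homogeneous in any case. The ideal is therefore generated by homogeneous elements, so the degree
projections of `Cob(B)` descend to the quotient (`HasComponents.map`). -/

namespace PL

/-! The Euler characteristic as a valuation -/

section valuation
variable (E : Type*) [NormedAddCommGroup E] [NormedSpace ℝ E]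

/-- The pairs of a combination of indicator functions of nonempty compact convex sets and the sum
of its coefficients. -/
def eulerGroup : AddSubgroup ((E → ℤ) × ℤ) :=
  AddSubgroup.closure
    {p | ∃ K : Set E, IsCompact K ∧ Convex ℝ K ∧ K.Nonempty ∧ p = (K.indicator 1, 1)}

/-- The sum of the coefficients depends only on the combination as a function. -/
class EulerUnique : Prop where
  eq_zero : ∀ n, (0, n) ∈ eulerGroup E → n = 0

variable {E} {F : Type*} [NormedAddCommGroup F] [NormedSpace ℝ F]

theorem mem_eulerGroup_of_convex {K : Set E} (hc : IsCompact K) (hK : Convex ℝ K)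
    (hn : K.Nonempty) : (K.indicator 1, 1) ∈ eulerGroup E :=
  AddSubgroup.subset_closure ⟨K, hc, hK, hn, rfl⟩

theorem exists_mem_eulerGroup_of_convex {K : Set E} (hc : IsCompact K) (hK : Convex ℝ K) :
    ∃ n, (K.indicator 1, n) ∈ eulerGroup E := by
  rcases K.eq_empty_or_nonempty with rfl | hn
  · exact ⟨0, by rw [indicator_empty]; exact zero_mem _⟩
  · exact ⟨1, mem_eulerGroup_of_convex hc hK hn⟩

/-- All constructions below are additive in the function, so they need to be carried out for one
compact convex set only. Splitting the pair into two arguments keeps the function and its value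
separately available. -/
theorem eulerGroup_induction {p : (E → ℤ) → ℤ → Prop}
    (conv : ∀ K : Set E, IsCompact K → Convex ℝ K → K.Nonempty → p (K.indicator 1) 1)
    (zero : p 0 0) (add : ∀ f g m n, p f m → p g n → p (f + g) (m + n))
    (neg : ∀ f n, p f n → p (-f) (-n)) {f : E → ℤ} {n : ℤ} (h : (f, n) ∈ eulerGroup E) :
    p f n := by
  refine AddSubgroup.closure_induction (p := fun q _ => p q.1 q.2) ?_ zero
    (fun x y _ _ hx hy => add _ _ _ _ hx hy) (fun x _ hx => neg _ _ hx) h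
  rintro _ ⟨K, hc, hK, hn, rfl⟩
  exact conv K hc hK hn

theorem eulerGroup_unique [EulerUnique E] {f : E → ℤ} {m n : ℤ} (hm : (f, m) ∈ eulerGroup E)
    (hn : (f, n) ∈ eulerGroup E) : m = n := by
  have := sub_mem hm hn
  rw [Prod.mk_sub_mk, sub_self] at this
  exact sub_eq_zero.1 (EulerUnique.eq_zero _ this)

/-- Integration along the fibres of a continuous affine map. -/
theorem eulerGroup_fiber {L : E → F} (hL : Continuous L)
    (hconv : ∀ K, Convex ℝ K → Convex ℝ (L '' K)) (hfib : ∀ y, Convex ℝ (L ⁻¹' {y}))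
    {f : E → ℤ} {n : ℤ} (hf : (f, n) ∈ eulerGroup E) :
    ∃ g : F → ℤ, (g, n) ∈ eulerGroup F ∧
      ∀ y, ((L ⁻¹' {y}).indicator f, g y) ∈ eulerGroup E := by
  refine eulerGroup_induction (p := fun f n => ∃ g : F → ℤ, (g, n) ∈ eulerGroup F ∧
      ∀ y, ((L ⁻¹' {y}).indicator f, g y) ∈ eulerGroup E) ?_ ?_ ?_ ?_ hf
  · intro K hc hK hn
    -- A fibre of a compact convex set is again compact and convex. It has value 1 where it is
    -- nonempty, that is over `L '' K`, and value 0 elsewhere.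
    refine ⟨(L '' K).indicator 1,
      mem_eulerGroup_of_convex (hc.image hL) (hconv K hK) (hn.image L), fun y => ?_⟩
    rw [indicator_indicator]
    by_cases hy : y ∈ L '' K
    · rw [indicator_of_mem hy]
      refine mem_eulerGroup_of_convex ?_ ((hfib y).inter hK) ?_
      · exact hc.inter_left (isClosed_singleton.preimage hL)
      · obtain ⟨x, hx, rfl⟩ := hy
        exact ⟨x, rfl, hx⟩
    · rw [indicator_of_notMem hy]
      have : L ⁻¹' {y} ∩ K = ∅ := by
        ext x
        simp only [mem_inter_iff, mem_preimage, mem_singleton_iff, mem_empty_iff_false, iff_false]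
        rintro ⟨rfl, hx⟩
        exact hy ⟨x, hx, rfl⟩
      rw [this, indicator_empty]
      exact zero_mem _
  · exact ⟨0, zero_mem _, fun y => by rw [indicator_zero']; exact zero_mem _⟩
  · rintro f g m n ⟨f', hf, hf'⟩ ⟨g', hg, hg'⟩
    exact ⟨f' + g', add_mem hf hg, fun y => by rw [indicator_add']; exact add_mem (hf' y) (hg' y)⟩
  · rintro f n ⟨f', hf, hf'⟩
    exact ⟨-f', neg_mem hf, fun y => by rw [indicator_neg']; exact neg_mem (hf' y)⟩

/-- Restriction to a horizontal slice. -/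
theorem eulerGroup_slice {f : E × ℝ → ℤ} {n : ℤ} (hf : (f, n) ∈ eulerGroup (E × ℝ)) :
    ∃ g : ℝ → ℤ, (g, n) ∈ eulerGroup ℝ ∧ ∀ t, (fun x => f (x, t), g t) ∈ eulerGroup E := by
  refine eulerGroup_induction (p := fun f n => ∃ g : ℝ → ℤ, (g, n) ∈ eulerGroup ℝ ∧
      ∀ t, (fun x => f (x, t), g t) ∈ eulerGroup E) ?_ ?_ ?_ ?_ hf
  · intro K hc hK hn
    -- The heights of the nonempty slices form the projection of `K`. The slices are regarded as
    -- subsets of `E`, not of `E × ℝ`, because the induction on the dimension knows uniqueness only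
    -- there.
    refine ⟨(Prod.snd '' K).indicator 1, mem_eulerGroup_of_convex (hc.image continuous_snd)
      (hK.linear_image (LinearMap.snd ℝ E ℝ)) (hn.image _), fun t => ?_⟩
    have key : (fun x => K.indicator (1 : E × ℝ → ℤ) (x, t)) =
        (Prod.fst '' (Prod.snd ⁻¹' {t} ∩ K)).indicator 1 := by
      ext x
      by_cases h : (x, t) ∈ K
      · have hx : x ∈ Prod.fst '' (Prod.snd ⁻¹' {t} ∩ K) := ⟨(x, t), ⟨rfl, h⟩, rfl⟩
        rw [indicator_of_mem h, indicator_of_mem hx]; rfl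
      · rw [indicator_of_notMem h, indicator_of_notMem]
        rintro ⟨⟨x', t'⟩, ⟨h1, h2⟩, rfl⟩
        obtain rfl : t' = t := h1
        exact h h2
    rw [key]
    by_cases ht : t ∈ Prod.snd '' K
    · rw [indicator_of_mem ht]
      refine mem_eulerGroup_of_convex ?_ (Convex.linear_image ?_ (LinearMap.fst ℝ E ℝ)) ?_
      · exact (hc.inter_left (isClosed_singleton.preimage continuous_snd)).image continuous_fst
      · exact ((convex_singleton t).linear_preimage (LinearMap.snd ℝ E ℝ)).inter hK
      · obtain ⟨x, hx, rfl⟩ := ht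
        exact ⟨x.1, x, ⟨rfl, hx⟩, rfl⟩
    · rw [indicator_of_notMem ht]
      have : Prod.snd ⁻¹' {t} ∩ K = ∅ := by
        ext x
        simp only [mem_inter_iff, mem_preimage, mem_singleton_iff, mem_empty_iff_false, iff_false]
        rintro ⟨rfl, hx⟩
        exact ht ⟨x, hx, rfl⟩
      rw [this, image_empty, indicator_empty]
      exact zero_mem _
  · exact ⟨0, zero_mem _, fun y => zero_mem _⟩
  · rintro f g m n ⟨f', hf, hf'⟩ ⟨g', hg, hg'⟩
    exact ⟨f' + g', add_mem hf hg, fun y => add_mem (hf' y) (hg' y)⟩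
  · rintro f n ⟨f', hf, hf'⟩
    exact ⟨-f', neg_mem hf, fun y => neg_mem (hf' y)⟩

/-- On the line the sum of the coefficients is the sum of the jumps. -/
theorem eulerGroup_real_jump {f : ℝ → ℤ} {n : ℤ} (hf : (f, n) ∈ eulerGroup ℝ) :
    ∃ j : ℝ →₀ ℤ, n = j.sum (fun _ k => k) ∧
      ∀ t, ∀ᶠ s in nhdsWithin t (Ioi t), f t - f s = j t := by
  refine eulerGroup_induction (p := fun f n => ∃ j : ℝ →₀ ℤ, n = j.sum (fun _ k => k) ∧
      ∀ t, ∀ᶠ s in nhdsWithin t (Ioi t), f t - f s = j t) ?_ ?_ ?_ ?_ hf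
  · intro K hc hK hn
    have hI : K = Icc (sInf K) (sSup K) :=
      eq_Icc_of_connected_compact ⟨hn, hK.isPreconnected⟩ hc
    generalize sInf K = a at hI
    generalize sSup K = b at hI
    subst hI
    have hab : a ≤ b := nonempty_Icc.1 hn
    -- Compared with values immediately to the right, the indicator of `[a,b]` drops only at `b`.
    -- The rise at `a` is not seen, since `a` itself belongs to the interval.
    refine ⟨Finsupp.single b 1, by simp, fun t => ?_⟩
    rcases lt_or_ge t a with h1 | h1
    · filter_upwards [nhdsWithin_le_nhds (Iio_mem_nhds h1)] with s hs
      have hs : s < a := hs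
      rw [indicator_of_notMem (fun h => not_le.2 h1 h.1),
        indicator_of_notMem (fun h => not_le.2 hs h.1), Finsupp.single_eq_of_ne (by linarith)]
      rfl
    rcases lt_trichotomy t b with h2 | rfl | h2
    · filter_upwards [nhdsWithin_le_nhds (Iio_mem_nhds h2), self_mem_nhdsWithin] with s hs hs'
      have hs : s < b := hs
      have hs' : t < s := hs'
      rw [indicator_of_mem (show t ∈ Icc a b from ⟨h1, h2.le⟩),
        indicator_of_mem (show s ∈ Icc a b from ⟨by linarith, hs.le⟩),
        Finsupp.single_eq_of_ne h2.ne]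
      rfl
    · filter_upwards [self_mem_nhdsWithin] with s hs'
      rw [indicator_of_mem (show t ∈ Icc a t from ⟨h1, le_rfl⟩),
        indicator_of_notMem (fun h => not_le.2 hs' h.2), Finsupp.single_eq_same]
      rfl
    · filter_upwards [self_mem_nhdsWithin] with s hs'
      have hs' : t < s := hs'
      rw [indicator_of_notMem (fun h => not_le.2 h2 h.2),
        indicator_of_notMem (fun h => not_le.2 (h2.trans hs') h.2),
        Finsupp.single_eq_of_ne h2.ne']
      rfl
  · exact ⟨0, by simp, fun t => by simp⟩
  · rintro f g m n ⟨j, rfl, hj⟩ ⟨k, rfl, hk⟩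
    refine ⟨j + k, (Finsupp.sum_add_index' (fun _ => rfl) (fun _ _ _ => rfl)).symm, fun t => ?_⟩
    filter_upwards [hj t, hk t] with s h1 h2
    simp only [Pi.add_apply, Finsupp.add_apply]
    omega
  · rintro f n ⟨j, rfl, hj⟩
    refine ⟨-j, ?_, fun t => ?_⟩
    · rw [Finsupp.sum_neg_index (fun _ => rfl)]; simp [Finsupp.sum]
    · filter_upwards [hj t] with s h1
      simp only [Pi.neg_apply, Finsupp.neg_apply]
      omega

/-- The zero function has no jumps, and the value is the sum of the jumps. -/
instance : EulerUnique ℝ where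
  eq_zero n hn := by
    obtain ⟨j, rfl, hj⟩ := eulerGroup_real_jump hn
    have : j = 0 := by
      ext t
      obtain ⟨s, hs⟩ := (hj t).exists
      simpa using hs.symm
    rw [this, Finsupp.sum_zero_index]

/-- All slices of the zero function vanish, so by uniqueness on `E` the function that records their
values vanishes as well. Uniqueness on the line then gives the total. Together with the instance for
the line this covers the plane and three-space. -/
instance [EulerUnique E] : EulerUnique (E × ℝ) where
  eq_zero n hn := by
    obtain ⟨g, hg, hg'⟩ := eulerGroup_slice hn
    have : g = 0 := by
      ext t
      exact EulerUnique.eq_zero (E := E) _ (hg' t)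
    exact EulerUnique.eq_zero (E := ℝ) n (this ▸ hg)

/-! ### Calculus of sets with an Euler characteristic -/

/-- The set `A` is a combination of compact convex sets, and `n` is its Euler characteristic. -/
def HasEuler (A : Set E) (n : ℤ) : Prop := (A.indicator 1, n) ∈ eulerGroup E

namespace HasEuler
variable {A B : Set E} {m n k : ℤ}

theorem unique [EulerUnique E] (h : HasEuler A m) (h' : HasEuler A n) : m = n :=
  eulerGroup_unique h h'

theorem of_convex (hc : IsCompact A) (hA : Convex ℝ A) (hn : A.Nonempty) : HasEuler A 1 :=
  mem_eulerGroup_of_convex hc hA hn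

theorem empty : HasEuler (∅ : Set E) 0 := by
  rw [HasEuler, indicator_empty]; exact zero_mem _

theorem singleton (x : E) : HasEuler {x} 1 :=
  of_convex isCompact_singleton (convex_singleton x) (singleton_nonempty x)

theorem union (hA : HasEuler A m) (hB : HasEuler B n) (hd : Disjoint A B) :
    HasEuler (A ∪ B) (m + n) := by
  rw [HasEuler, indicator_union_of_disjoint hd]
  exact add_mem hA hB

theorem sdiff (hA : HasEuler A m) (hB : HasEuler B n) (hBA : B ⊆ A) :
    HasEuler (A \ B) (m - n) := by
  have : (A \ B).indicator (1 : E → ℤ) = A.indicator 1 - B.indicator 1 := indicator_sdiff hBA 1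
  rw [HasEuler, this]
  exact sub_mem hA hB

/-- The part of `B` outside `A` has value `n - k` and is disjoint from `A`. The value of the
intersection is an input because in each application the intersection is identified explicitly. -/
theorem union_of_inter (hA : HasEuler A m) (hB : HasEuler B n) (hAB : HasEuler (A ∩ B) k) :
    HasEuler (A ∪ B) (m + n - k) := by
  have := hA.union (hB.sdiff hAB inter_subset_right) (by
    rw [disjoint_left]; rintro x hx ⟨h, h'⟩; exact h' ⟨hx, h⟩)
  rwa [sdiff_inter_self_eq_sdiff, union_sdiff_self, ← add_sub_assoc] at this

theorem iUnion {ι : Type*} {A : ι → Set E} {n : ι → ℤ}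
    (s : Finset ι) (h : ∀ i ∈ s, HasEuler (A i) (n i))
    (hd : (s : Set ι).PairwiseDisjoint A) :
    HasEuler (⋃ i ∈ s, A i) (∑ i ∈ s, n i) := by
  classical
  induction s using Finset.induction_on with
  | empty => simpa using empty
  | insert i s hi ih =>
    rw [Finset.set_biUnion_insert, Finset.sum_insert hi]
    refine (h i (by simp)).union (ih (fun j hj => h j (by simp [hj]))
      (hd.subset (by simp))) ?_
    rw [disjoint_iUnion₂_right]
    intro j hj
    exact hd (by simp) (by simp [hj]) (by rintro rfl; exact hi hj)

theorem finset (s : Finset E) : HasEuler (s : Set E) s.card := by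
  have := iUnion (A := fun x : E => {x}) (n := fun _ => 1) s (fun x _ => singleton x)
    (fun x _ y _ h => by simpa using h)
  simpa only [biUnion_of_singleton, Finset.sum_const, nsmul_eq_mul, mul_one, ← Finset.mem_coe]
    using this

/-- The product with an interval. -/
theorem prod_Icc (h : HasEuler A n) {a b : ℝ} (hab : a ≤ b) : HasEuler (A ×ˢ Icc a b) n := by
  -- Written as a product of functions, the indicator is additive in its first factor, so the claim
  -- reduces to a convex base.
  have key : (A ×ˢ Icc a b).indicator (1 : E × ℝ → ℤ) =
      fun q => A.indicator 1 q.1 * (Icc a b).indicator 1 q.2 := by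
    ext ⟨x, t⟩
    by_cases hx : x ∈ A <;> by_cases ht : t ∈ Icc a b <;> simp [indicator, hx, ht]
  rw [HasEuler, key]
  refine eulerGroup_induction (p := fun f n =>
    (fun q : E × ℝ => f q.1 * (Icc a b).indicator 1 q.2, n) ∈ eulerGroup (E × ℝ)) ?_ ?_ ?_ ?_ h
  · intro K hc hK hn
    convert mem_eulerGroup_of_convex (hc.prod isCompact_Icc) (hK.prod (convex_Icc a b))
      (hn.prod (nonempty_Icc.2 hab)) using 2
    ext ⟨x, t⟩
    by_cases hx : x ∈ K <;> by_cases ht : t ∈ Icc a b <;> simp [indicator, hx, ht]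
  · simp only [Pi.zero_apply, zero_mul]
    exact zero_mem _
  · intro f g m n hf hg
    simp only [Pi.add_apply, add_mul]
    exact add_mem hf hg
  · intro f n hf
    simp only [Pi.neg_apply, neg_mul]
    exact neg_mem hf

/-- Integration along the fibres preserves the total value. Since `L` is injective on `A`, each
fibre of `A` is a point or empty, so by uniqueness on `E` the integrated function is the indicator
of the image. -/
theorem image_affine [EulerUnique E] (h : HasEuler A n) (L : E →ᵃ[ℝ] F) (hL : Continuous L)
    (hinj : InjOn L A) : HasEuler (L '' A) n := by
  obtain ⟨g, hg, hg'⟩ := eulerGroup_fiber hL (fun K hK => hK.affine_image L)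
    (fun y => (convex_singleton y).affine_preimage L) h
  suffices (L '' A).indicator 1 = g by rwa [HasEuler, this]
  ext y
  by_cases hy : y ∈ L '' A
  · obtain ⟨x, hx, rfl⟩ := hy
    rw [indicator_of_mem (mem_image_of_mem L hx)]
    refine unique (singleton x) ?_
    convert hg' (L x) using 2
    rw [indicator_indicator]
    rw [HasEuler]
    congr! 3
    ext x'
    simp only [mem_singleton_iff, mem_inter_iff, mem_preimage]
    exact ⟨by rintro rfl; exact ⟨rfl, hx⟩, fun h => hinj h.2 hx h.1⟩
  · rw [indicator_of_notMem hy]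
    refine unique (A := (∅ : Set E)) empty ?_
    convert hg' y using 2
    rw [indicator_indicator]
    rw [HasEuler]
    congr! 3
    ext x'
    simp only [mem_empty_iff_false, mem_inter_iff, mem_preimage, mem_singleton_iff, false_iff]
    rintro ⟨rfl, h⟩
    exact hy ⟨x', h, rfl⟩

/-- Each generator meets `Q` in a compact convex set, possibly empty, so restriction to `Q` stays in
the group. This allows a set to be cut along the pieces of a piecewise linear map; the value of the
cut does not matter there. -/
theorem exists_inter_convex (h : HasEuler A n) {Q : Set E} (hQ : IsClosed Q)
    (hQ' : Convex ℝ Q) : ∃ k, HasEuler (A ∩ Q) k := by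
  have : (A ∩ Q).indicator (1 : E → ℤ) = Q.indicator (A.indicator 1) := by
    rw [indicator_indicator, inter_comm]
  rw [show (∃ k, HasEuler (A ∩ Q) k) ↔ ∃ k, (Q.indicator (A.indicator 1), k) ∈ eulerGroup E by
    simp only [HasEuler, this]]
  refine eulerGroup_induction (p := fun f _ => ∃ k, (Q.indicator f, k) ∈ eulerGroup E)
    ?_ ?_ ?_ ?_ h
  · intro K hc hK _
    rw [indicator_indicator]
    exact exists_mem_eulerGroup_of_convex (hc.inter_left hQ) (hQ'.inter hK)
  · exact ⟨0, by rw [indicator_zero']; exact zero_mem _⟩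
  · rintro f g _ _ ⟨k, hk⟩ ⟨l, hl⟩
    exact ⟨k + l, by rw [indicator_add']; exact add_mem hk hl⟩
  · rintro f _ ⟨k, hk⟩
    exact ⟨-k, by rw [indicator_neg']; exact neg_mem hk⟩

end HasEuler

/-! ### Invariance under piecewise linear maps -/

theorem IsConvexPolyhedron.convex {Q : Set E} (hQ : IsConvexPolyhedron Q) : Convex ℝ Q := by
  obtain ⟨A, -, rfl⟩ := hQ
  have : {x | ∀ f ∈ A, 0 ≤ f x} = ⋂ f ∈ A, f ⁻¹' Ici (0 : ℝ) := by ext; simp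
  rw [this]
  exact convex_iInter₂ fun f _ => (convex_Ici 0).affine_preimage f

theorem IsConvexPolyhedron.isClosed [FiniteDimensional ℝ E] {Q : Set E}
    (hQ : IsConvexPolyhedron Q) : IsClosed Q := by
  obtain ⟨A, -, rfl⟩ := hQ
  have : {x | ∀ f ∈ A, 0 ≤ f x} = ⋂ f ∈ A, f ⁻¹' Ici (0 : ℝ) := by ext; simp
  rw [this]
  exact isClosed_biInter fun f _ => isClosed_Ici.preimage f.continuous_of_finiteDimensional

/-- The Euler characteristic is invariant under injective piecewise linear maps. -/
theorem HasEuler.image_pl [FiniteDimensional ℝ E] [EulerUnique E] {A S : Set E} {n : ℤ}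
    (h : HasEuler A n) {f : E → F} (hf : IsPLOn f S) (hA : A ⊆ S) (hinj : InjOn f A) :
    HasEuler (f '' A) n := by
  obtain ⟨𝒬, hfin, hq, hc, hL⟩ := hf
  -- Induction on the number of affine pieces needed to cover `A`. The part of `A` in one piece is
  -- mapped affinely, the rest is covered by fewer pieces, and the two images are disjoint by
  -- injectivity. The set must vary in the induction, and the rest is in general not closed.
  have main : ∀ 𝒬' ⊆ 𝒬, 𝒬'.Finite → ∀ A ⊆ S, A ⊆ ⋃₀ 𝒬' → ∀ n, HasEuler A n → InjOn f A →
      HasEuler (f '' A) n := by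
    intro 𝒬' hsub hfin'
    induction 𝒬', hfin' using Set.Finite.induction_on with
    | empty =>
      intro A _ hA n hn _
      obtain rfl : A = ∅ := by simpa using hA
      simpa [hn.unique .empty] using HasEuler.empty
    | @insert Q 𝒬' _ _ ih =>
      intro A hAS hA n hn hinj
      have hQ := hsub (mem_insert _ _)
      obtain ⟨k, hk⟩ := hn.exists_inter_convex (hq Q hQ).isClosed (hq Q hQ).convex
      obtain ⟨L, hL⟩ := hL Q hQ
      have hEq : EqOn f L (A ∩ Q) := fun x hx => hL ⟨hAS hx.1, hx.2⟩
      have h1 : HasEuler (f '' (A ∩ Q)) k := by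
        rw [hEq.image_eq]
        refine hk.image_affine L L.continuous_of_finiteDimensional fun x hx y hy hxy => ?_
        rw [← hEq hx, ← hEq hy] at hxy
        exact hinj hx.1 hy.1 hxy
      have h2 : HasEuler (f '' (A \ (A ∩ Q))) (n - k) := by
        refine ih ((subset_insert _ _).trans hsub) _ (sdiff_subset.trans hAS) ?_ _
          (hn.sdiff hk inter_subset_left) (hinj.mono sdiff_subset)
        rintro x ⟨hx, hx'⟩
        obtain ⟨R, hR | hR, hxR⟩ := hA hx
        · exact absurd ⟨hx, hR ▸ hxR⟩ hx'
        · exact ⟨R, hR, hxR⟩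
      have h3 := h1.union h2 (by
        rw [disjoint_left]
        rintro _ ⟨x, hx, rfl⟩ ⟨y, hy, hxy⟩
        exact hy.2 (hinj hy.1 hx.1 hxy ▸ hx))
      rw [← image_union, union_sdiff_cancel inter_subset_left] at h3
      simpa using h3
  exact main 𝒬 subset_rfl hfin A hA (hA.trans hc) n h hinj

end valuation
end PL

namespace PL

/-! Triangulations -/

section complex
variable {E : Type*} [NormedAddCommGroup E] [NormedSpace ℝ E]

/-- The points of a face which are in no smaller face. -/
def openFace (K : Geometry.SimplicialComplex ℝ E) (s : Finset E) : Set E :=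
  {x | x ∈ convexHull ℝ (s : Set E) ∧ ∀ t ∈ K.faces, t ⊂ s → x ∉ convexHull ℝ (t : Set E)}

variable {K : Geometry.SimplicialComplex ℝ E}

/-- A common point lies in the hull of `s ∩ t`, which is then a face. Since the point is in no
smaller face of either simplex, the intersection equals both. -/
theorem disjoint_openFace {s t : Finset E} (hs : s ∈ K.faces) (ht : t ∈ K.faces) (hst : s ≠ t) :
    Disjoint (openFace K s) (openFace K t) := by
  classical
  rw [disjoint_left]
  rintro x ⟨hxs, hs'⟩ ⟨hxt, ht'⟩
  have hx := K.inter_subset_convexHull hs ht ⟨hxs, hxt⟩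
  rw [← Finset.coe_inter] at hx
  have hne : (s ∩ t).Nonempty := by
    rw [← Finset.coe_nonempty]; exact convexHull_nonempty_iff.1 ⟨x, hx⟩
  have hf := K.down_closed hs Finset.inter_subset_left hne
  rcases Finset.inter_subset_left.eq_or_ssubset (a := s ∩ t) (b := s) with h | h
  · rcases Finset.inter_subset_right.eq_or_ssubset (a := s ∩ t) (b := t) with h' | h'
    · exact hst (h.symm.trans h')
    · exact ht' _ hf h' hx
  · exact hs' _ hf h hx

/-- Descend to a minimal face whose hull contains the point. -/
theorem exists_mem_openFace {s : Finset E} (hs : s ∈ K.faces) {x : E}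
    (hx : x ∈ convexHull ℝ (s : Set E)) : ∃ t ∈ K.faces, t ⊆ s ∧ x ∈ openFace K t := by
  induction s using Finset.strongInduction with
  | H s ih =>
    by_cases h : ∃ t ∈ K.faces, t ⊂ s ∧ x ∈ convexHull ℝ (t : Set E)
    · obtain ⟨t, ht, hts, hxt⟩ := h
      obtain ⟨u, hu, hut, hxu⟩ := ih t hts ht hxt
      exact ⟨u, hu, hut.trans hts.subset, hxu⟩
    · push Not at h
      exact ⟨s, hs, subset_rfl, hx, h⟩

/-- A closed simplex has value 1 because it is convex, and it is the disjoint union of the open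
faces of its nonempty subsets. By induction the proper ones are known, and the vanishing of the
alternating sum over all subsets determines the remaining value. -/
theorem hasEuler_openFace {s : Finset E} (hs : s ∈ K.faces) :
    HasEuler (openFace K s) ((-1) ^ (s.card - 1)) := by
  classical
  induction s using Finset.strongInduction with
  | H s ih =>
    have hsne := K.nonempty_of_mem_faces hs
    have hmem : ∀ t ∈ s.ssubsets.erase ∅, t ⊂ s ∧ t ∈ K.faces := fun t ht => by
      rw [Finset.mem_erase, Finset.mem_ssubsets] at ht
      exact ⟨ht.2, K.down_closed hs ht.2.subset (Finset.nonempty_iff_ne_empty.2 ht.1)⟩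
    have h1 := HasEuler.iUnion (s.ssubsets.erase ∅) (fun t ht => ih t (hmem t ht).1 (hmem t ht).2)
      (fun t ht u hu htu => disjoint_openFace (hmem t ht).2 (hmem u hu).2 htu)
    have h2 : HasEuler (convexHull ℝ (s : Set E)) 1 :=
      .of_convex (s.finite_toSet.isCompact_convexHull ℝ) (convex_convexHull ℝ _)
        (convexHull_nonempty_iff.2 hsne)
    have h3 := h2.sdiff h1 (iUnion₂_subset fun t ht =>
      (fun x hx => by exact convexHull_mono (Finset.coe_subset.2 (hmem t ht).1.subset) hx.1))
    convert h3 using 1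
    · ext x
      simp only [mem_sdiff, mem_iUnion, not_exists]
      constructor
      · rintro ⟨hx, h⟩
        exact ⟨hx, fun t ht hxt => h t (hmem t ht).2 (hmem t ht).1 hxt.1⟩
      · rintro ⟨hx, h⟩
        refine ⟨hx, fun t ht hts hxt => ?_⟩
        obtain ⟨u, hu, hut, hxu⟩ := exists_mem_openFace ht hxt
        refine h u ?_ hxu
        rw [Finset.mem_erase, Finset.mem_ssubsets]
        exact ⟨(K.nonempty_of_mem_faces hu).ne_empty, hut.trans_ssubset hts⟩
    -- The terms for `s` and for the empty set are split off the alternating sum over the power set;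
    -- what remains is the sum over the proper nonempty faces. Nonemptiness matters for `pow`, where
    -- the subtraction in the exponent is truncated.
    · have h4 := Finset.sum_powerset_neg_one_pow_card_of_nonempty hsne
      rw [← Finset.insert_erase (Finset.mem_powerset_self s), Finset.sum_insert (by simp),
        show s.powerset.erase s = s.ssubsets from rfl,
        ← Finset.insert_erase (Finset.empty_mem_ssubsets hsne), Finset.sum_insert (by simp)] at h4
      have pow : ∀ t : Finset E, t.Nonempty → (-1 : ℤ) ^ (t.card - 1) = - (-1) ^ t.card :=
        fun t ht => by
          obtain ⟨k, hk⟩ := Nat.exists_eq_succ_of_ne_zero ht.card_pos.ne'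
          rw [hk, Nat.succ_sub_one, pow_succ]; ring
      rw [Finset.sum_congr rfl fun t ht => pow t (K.nonempty_of_mem_faces (hmem t ht).2),
        pow s hsne, Finset.sum_neg_distrib]
      simp only [Finset.card_empty, pow_zero] at h4
      linarith

/-- The alternating number of simplices of a triangulation is determined by the space. -/
theorem hasEuler_space (hK : K.faces.Finite) :
    HasEuler K.space (∑ᶠ s ∈ K.faces, (-1) ^ (s.card - 1)) := by
  rw [finsum_mem_eq_finite_toFinset_sum _ hK]
  have := HasEuler.iUnion hK.toFinset (fun s hs => hasEuler_openFace (hK.mem_toFinset.1 hs))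
    (fun s hs t ht hst => disjoint_openFace (by simpa using hs) (by simpa using ht) hst)
  convert this using 1
  ext x
  simp only [Geometry.SimplicialComplex.mem_space_iff, mem_iUnion, Finite.mem_toFinset, exists_prop]
  constructor
  · rintro ⟨s, hs, hx⟩
    obtain ⟨t, ht, -, hxt⟩ := exists_mem_openFace hs hx
    exact ⟨t, ht, hxt⟩
  · rintro ⟨s, hs, hx⟩
    exact ⟨s, hs, hx.1⟩

end complex

/-! ### Triangulating unions of closed cells of a hyperplane arrangement -/

section triangulation
variable {E : Type*} [NormedAddCommGroup E] [NormedSpace ℝ E]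

/-- In the arrangement of the hyperplanes `f = 0`, `f ∈ A`, the point `y` is in the closure of the
cell of `x`. -/
def FaceLE (A : Set (E →ᵃ[ℝ] ℝ)) (y x : E) : Prop :=
  ∀ f ∈ A, (f x = 0 → f y = 0) ∧ (0 < f x → 0 ≤ f y) ∧ (f x < 0 → f y ≤ 0)

namespace FaceLE
variable {A : Set (E →ᵃ[ℝ] ℝ)} {x y z : E}

theorem refl (x : E) : FaceLE A x x := fun _ _ => ⟨id, le_of_lt, le_of_lt⟩

theorem trans (h : FaceLE A x y) (h' : FaceLE A y z) : FaceLE A x z := fun f hf => by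
  obtain ⟨h1, h2, h3⟩ := h f hf
  obtain ⟨h1', h2', h3'⟩ := h' f hf
  refine ⟨fun hz => h1 (h1' hz), fun hz => ?_, fun hz => ?_⟩
  · rcases (h2' hz).eq_or_lt with h | h
    exacts [(h1 h.symm).ge, h2 h]
  · rcases (h3' hz).eq_or_lt with h | h
    exacts [(h1 h).le, h3 h]

theorem sign_eq (h : FaceLE A x y) (h' : FaceLE A y x) {f : E →ᵃ[ℝ] ℝ} (hf : f ∈ A) :
    SignType.sign (f x) = SignType.sign (f y) := by
  obtain ⟨h1, h2, h3⟩ := h f hf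
  obtain ⟨h1', h2', h3'⟩ := h' f hf
  rcases lt_trichotomy (f y) 0 with hy | hy | hy
  · rw [sign_neg hy, sign_neg ((h3 hy).lt_of_ne fun h => hy.ne (h1' h))]
  · rw [hy, h1 hy]
  · rw [sign_pos hy, sign_pos ((h2 hy).lt_of_ne' fun h => hy.ne' (h1' h))]

theorem of_sign_eq (h : ∀ f ∈ A, SignType.sign (f x) = SignType.sign (f y)) : FaceLE A x y :=
  fun f hf => by
    have := h f hf
    refine ⟨fun hy => ?_, fun hy => ?_, fun hy => ?_⟩
    · rwa [hy, sign_zero, sign_eq_zero_iff] at this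
    · rw [sign_pos hy, sign_eq_one_iff] at this; exact this.le
    · rw [sign_neg hy, sign_eq_neg_one_iff] at this; exact this.le

theorem convex (x : E) : Convex ℝ {y | FaceLE A y x} := by
  intro y hy z hz a b ha hb hab f hf
  obtain ⟨h1, h2, h3⟩ := hy f hf
  obtain ⟨h1', h2', h3'⟩ := hz f hf
  rw [Convex.combo_affine_apply hab, smul_eq_mul, smul_eq_mul]
  refine ⟨fun h => by rw [h1 h, h1' h]; simp, fun h => ?_, fun h => ?_⟩
  · exact add_nonneg (mul_nonneg ha (h2 h)) (mul_nonneg hb (h2' h))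
  · exact add_nonpos (mul_nonpos_of_nonneg_of_nonpos ha (h3 h))
      (mul_nonpos_of_nonneg_of_nonpos hb (h3' h))

/-- `FaceLE` is only a preorder, so points of the same cell are below each other; a finite nonempty
chain still has a greatest element. -/
theorem exists_max {s : Finset E} (hs : s.Nonempty)
    (hc : ∀ a ∈ s, ∀ b ∈ s, FaceLE A a b ∨ FaceLE A b a) : ∃ m ∈ s, ∀ a ∈ s, FaceLE A a m := by
  classical
  induction hs using Finset.Nonempty.cons_induction with
  | singleton a => exact ⟨a, by simp, by simpa using refl a⟩
  | cons a s _ _ ih =>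
    obtain ⟨m, hm, h⟩ := ih fun a ha b hb => hc a (by simp [ha]) b (by simp [hb])
    rcases hc a (by simp) m (by simp [hm]) with h' | h'
    · refine ⟨m, by simp [hm], fun b hb => ?_⟩
      rcases Finset.mem_cons.1 hb with rfl | hb
      exacts [h', h b hb]
    · refine ⟨a, by simp, fun b hb => ?_⟩
      rcases Finset.mem_cons.1 hb with rfl | hb
      exacts [refl _, (h b hb).trans h']

/-- A weighted sum along a chain has the signs of the greatest element. -/
theorem sign_sum {T : Finset E} {w : E → ℝ} (hw : ∀ a ∈ T, 0 ≤ w a) {m : E} (hm : m ∈ T)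
    (hwm : 0 < w m) (hmax : ∀ a ∈ T, 0 < w a → FaceLE A a m) {f : E →ᵃ[ℝ] ℝ} (hf : f ∈ A) :
    SignType.sign (∑ a ∈ T, w a * f a) = SignType.sign (f m) := by
  have hle : ∀ a ∈ T, w a = 0 ∨ FaceLE A a m := fun a ha =>
    (hw a ha).eq_or_lt.imp Eq.symm (hmax a ha)
  rcases lt_trichotomy (f m) 0 with h | h | h
  · rw [sign_neg h, sign_eq_neg_one_iff]
    refine Finset.sum_neg' (fun a ha => ?_) ⟨m, hm, mul_neg_of_pos_of_neg hwm h⟩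
    rcases hle a ha with h' | h'
    · rw [h', zero_mul]
    · exact mul_nonpos_of_nonneg_of_nonpos (hw a ha) ((h' f hf).2.2 h)
  · rw [h, sign_zero, sign_eq_zero_iff]
    refine Finset.sum_eq_zero fun a ha => ?_
    rcases hle a ha with h' | h'
    · rw [h', zero_mul]
    · rw [(h' f hf).1 h, mul_zero]
  · rw [sign_pos h, sign_eq_one_iff]
    refine Finset.sum_pos' (fun a ha => ?_) ⟨m, hm, mul_pos hwm h⟩
    rcases hle a ha with h' | h'
    · rw [h', zero_mul]
    · exact mul_nonneg (hw a ha) ((h' f hf).2.1 h)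

end FaceLE

variable {A : Set (E →ᵃ[ℝ] ℝ)}

/-- The weighted sum of the values of an affine function depends only on the total weight and the
weighted sum of the points. Two representations of one point therefore give equal values, also when
the weights do not add up to 1. -/
theorem sum_mul_affine (f : E →ᵃ[ℝ] ℝ) (T : Finset E) (w : E → ℝ) :
    ∑ a ∈ T, w a * f a = f.linear (∑ a ∈ T, w a • a) + (∑ a ∈ T, w a) * f 0 := by
  have : ∀ a, f a = f.linear a + f 0 := fun a => by
    have := congrFun f.decomp a; simpa using this
  simp only [map_sum, map_smul, smul_eq_mul, Finset.sum_mul, ← Finset.sum_add_distrib]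
  refine Finset.sum_congr rfl fun a _ => ?_
  rw [this a]; ring

/-- Points are combinations of chains of cells in one way only. -/
theorem FaceLE.weights_unique {V : Set E}
    (hV : ∀ x ∈ V, ∀ y ∈ V, FaceLE A x y → FaceLE A y x → x = y) {T : Finset E} (hT : ↑T ⊆ V)
    (n : ℕ) : ∀ (w v : E → ℝ), (∀ a ∈ T, 0 ≤ w a) → (∀ a ∈ T, 0 ≤ v a) →
    (∀ a ∈ T, ∀ b ∈ T, 0 < w a → 0 < w b → FaceLE A a b ∨ FaceLE A b a) →
    (∀ a ∈ T, ∀ b ∈ T, 0 < v a → 0 < v b → FaceLE A a b ∨ FaceLE A b a) →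
    ∑ a ∈ T, w a = ∑ a ∈ T, v a → ∑ a ∈ T, w a • a = ∑ a ∈ T, v a • a →
    {a ∈ T | 0 < w a}.card + {a ∈ T | 0 < v a}.card ≤ n → ∀ a ∈ T, w a = v a := by
  classical
  induction n with
  | zero =>
    intro w v hw hv _ _ _ _ hn a ha
    have h1 : {a ∈ T | 0 < w a} = ∅ := Finset.card_eq_zero.1 (by omega)
    have h2 : {a ∈ T | 0 < v a} = ∅ := Finset.card_eq_zero.1 (by omega)
    have h1 := Finset.filter_eq_empty_iff.1 h1 ha
    have h2 := Finset.filter_eq_empty_iff.1 h2 ha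
    have := hw a ha
    have := hv a ha
    linarith
  | succ n ih =>
    intro w v hw hv hcw hcv hs hb hn
    -- If one of the two supports is empty, the common total weight is zero, and nonnegativity makes
    -- both families vanish.
    have aux : ∀ w v : E → ℝ, (∀ a ∈ T, 0 ≤ w a) → (∀ a ∈ T, 0 ≤ v a) →
        ∑ a ∈ T, w a = ∑ a ∈ T, v a → {a ∈ T | 0 < w a} = ∅ → ∀ a ∈ T, w a = v a := by
      intro w v hw hv hs h
      have hw0 : ∀ a ∈ T, w a = 0 := fun a ha =>
        le_antisymm (not_lt.1 (Finset.filter_eq_empty_iff.1 h ha)) (hw a ha)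
      rw [Finset.sum_eq_zero hw0] at hs
      intro a ha
      rw [hw0 a ha, (Finset.sum_eq_zero_iff_of_nonneg hv).1 hs.symm a ha]
    rcases Finset.eq_empty_or_nonempty {a ∈ T | 0 < w a} with h1 | h1
    · exact aux w v hw hv hs h1
    rcases Finset.eq_empty_or_nonempty {a ∈ T | 0 < v a} with h2 | h2
    · exact fun a ha => (aux v w hv hw hs.symm h2 a ha).symm
    obtain ⟨m, hm, hmax⟩ := exists_max (A := A) h1 fun a ha b hb => by
      rw [Finset.mem_filter] at ha hb; exact hcw a ha.1 b hb.1 ha.2 hb.2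
    obtain ⟨m', hm', hmax'⟩ := exists_max (A := A) h2 fun a ha b hb => by
      rw [Finset.mem_filter] at ha hb; exact hcv a ha.1 b hb.1 ha.2 hb.2
    rw [Finset.mem_filter] at hm hm'
    -- The signs of the combination are those of the greatest element of its support. The two
    -- combinations agree, so their greatest elements lie in the same cell and, being in `V`,
    -- coincide.
    have hsgn : ∀ f ∈ A, SignType.sign (f m) = SignType.sign (f m') := fun f hf => by
      rw [← sign_sum hw hm.1 hm.2 (fun a ha h => hmax a (Finset.mem_filter.2 ⟨ha, h⟩)) hf,
        ← sign_sum hv hm'.1 hm'.2 (fun a ha h => hmax' a (Finset.mem_filter.2 ⟨ha, h⟩)) hf,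
        sum_mul_affine, sum_mul_affine, hs, hb]
    obtain rfl : m = m' := hV m (hT hm.1) m' (hT hm'.1) (of_sign_eq hsgn)
      (of_sign_eq fun f hf => (hsgn f hf).symm)
    -- Subtracting the smaller of the two weights at the common greatest element preserves all
    -- hypotheses and removes `m` from at least one support. The total weight decreases, which is
    -- why it is not normalized to 1.
    set c := min (w m) (v m) with hc
    have hcpos : 0 < c := lt_min hm.2 hm'.2
    let w' : E → ℝ := fun a => w a - if a = m then c else 0
    let v' : E → ℝ := fun a => v a - if a = m then c else 0
    have le_w : ∀ a, w' a ≤ w a := fun a => by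
      simp only [w']; split_ifs <;> linarith
    have le_v : ∀ a, v' a ≤ v a := fun a => by
      simp only [v']; split_ifs <;> linarith
    have hlt : {a ∈ T | 0 < w' a}.card + {a ∈ T | 0 < v' a}.card <
        {a ∈ T | 0 < w a}.card + {a ∈ T | 0 < v a}.card := by
      have hw' : {a ∈ T | 0 < w' a} ⊆ {a ∈ T | 0 < w a} :=
        Finset.monotone_filter_right T fun a _ h => h.trans_le (le_w a)
      have hv' : {a ∈ T | 0 < v' a} ⊆ {a ∈ T | 0 < v a} :=
        Finset.monotone_filter_right T fun a _ h => h.trans_le (le_v a)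
      rcases min_choice (w m) (v m) with h | h
      · refine add_lt_add_of_lt_of_le (Finset.card_lt_card (hw'.ssubset_of_mem_notMem
          (a := m) (by simp [hm]) (by simp [w', hc, h]))) (Finset.card_le_card hv')
      · refine add_lt_add_of_le_of_lt (Finset.card_le_card hw') (Finset.card_lt_card
          (hv'.ssubset_of_mem_notMem (a := m) (by simp [hm']) (by simp [v', hc, h])))
    have key := ih w' v' ?_ ?_ ?_ ?_ ?_ ?_ (by omega)
    · intro a ha
      have := key a ha
      simp only [w', v'] at this
      linarith
    · intro a ha
      simp only [w']
      split_ifs with h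
      · rw [h, sub_nonneg]; exact min_le_left _ _
      · simpa using hw a ha
    · intro a ha
      simp only [v']
      split_ifs with h
      · rw [h, sub_nonneg]; exact min_le_right _ _
      · simpa using hv a ha
    · exact fun a ha b hb h h' => hcw a ha b hb (h.trans_le (le_w a)) (h'.trans_le (le_w b))
    · exact fun a ha b hb h h' => hcv a ha b hb (h.trans_le (le_v a)) (h'.trans_le (le_v b))
    · simp only [w', v', Finset.sum_sub_distrib, hs]
    · simp only [w', v', sub_smul, Finset.sum_sub_distrib, hb]

/-- Every point of a bounded union of closed cells is in the convex hull of a chain of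
representatives of cells. -/
theorem FaceLE.exists_chain [FiniteDimensional ℝ E] (hA : A.Finite) {P : Set E}
    (hP : Bornology.IsBounded P) (hdown : ∀ x ∈ P, ∀ y, FaceLE A y x → y ∈ P) {r : E → E}
    (hr : ∀ x ∈ P, FaceLE A (r x) x ∧ FaceLE A x (r x)) (n : ℕ) :
    ∀ x ∈ P, {f ∈ A | f x ≠ 0}.ncard ≤ n → ∃ s : Finset E, ↑s ⊆ r '' P ∧
      (∀ a ∈ s, ∀ b ∈ s, FaceLE A a b ∨ FaceLE A b a) ∧ (∀ a ∈ s, FaceLE A a x) ∧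
      x ∈ convexHull ℝ (s : Set E) := by
  classical
  induction n using Nat.strong_induction_on with
  | _ n ih =>
    intro x hx hn
    by_cases hxr : r x = x
    · refine ⟨{x}, by simpa using ⟨x, hx, hxr⟩, ?_, ?_, by simp⟩
      · simp only [Finset.mem_singleton]; rintro a rfl b rfl; exact .inl (refl _)
      · simp only [Finset.mem_singleton]; rintro a rfl; exact refl _
    set m := r x with hm
    obtain ⟨hmx, hxm⟩ := hr x hx
    rw [← hm] at hmx hxm
    -- The ray from the representative `m` through `x` is followed while it stays in the closed cell
    -- of `x`. The cell is bounded, so there is a last point `y`; it lies in a smaller cell to which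
    -- the induction applies, and `x` is on the segment from `m` to `y`.
    let S : Set ℝ := {t | 1 ≤ t ∧ FaceLE A (AffineMap.lineMap m x t) x}
    have hcont : ∀ f : E →ᵃ[ℝ] ℝ, Continuous fun t : ℝ => f (AffineMap.lineMap m x t) := fun f =>
      f.continuous_of_finiteDimensional.comp AffineMap.lineMap_continuous
    have himp : ∀ (p : Prop) (q : ℝ → Prop), IsClosed {t | q t} → IsClosed {t | p → q t} := by
      intro p q h
      by_cases hp : p <;> simp [hp, h]
    have hSc : IsClosed S := by
      have : S = Ici 1 ∩ ⋂ f ∈ A, {t : ℝ | (f x = 0 → f (AffineMap.lineMap m x t) = 0) ∧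
          (0 < f x → 0 ≤ f (AffineMap.lineMap m x t)) ∧
          (f x < 0 → f (AffineMap.lineMap m x t) ≤ 0)} := by
        ext t; simp [S, FaceLE]
      rw [this]
      refine isClosed_Ici.inter (isClosed_biInter fun f _ => ?_)
      refine .inter ?_ (.inter ?_ ?_)
      · exact himp _ _ (isClosed_eq (hcont f) continuous_const)
      · exact himp _ _ (isClosed_le continuous_const (hcont f))
      · exact himp _ _ (isClosed_le (hcont f) continuous_const)
    have h1S : (1 : ℝ) ∈ S := ⟨le_rfl, by rw [AffineMap.lineMap_apply_one]; exact refl x⟩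
    have hSb : BddAbove S := by
      obtain ⟨R, hR⟩ := hP.exists_norm_le
      have hpos : 0 < ‖x - m‖ := norm_pos_iff.2 (sub_ne_zero.2 (Ne.symm hxr))
      refine ⟨(R + ‖m‖) / ‖x - m‖, fun t ht => ?_⟩
      have h1 := hR _ (hdown x hx _ ht.2)
      have h2 : t • (x - m) = AffineMap.lineMap m x t - m := by
        simp [AffineMap.lineMap_apply]
      have h3 : ‖t • (x - m)‖ ≤ R + ‖m‖ := by
        rw [h2]; exact (norm_sub_le _ _).trans (by gcongr)
      rw [norm_smul, Real.norm_of_nonneg (zero_le_one.trans ht.1)] at h3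
      rwa [le_div_iff₀ hpos]
    set t := sSup S with ht
    have htS : t ∈ S := hSc.csSup_mem ⟨1, h1S⟩ hSb
    set y := AffineMap.lineMap m x t with hy
    have hyP := hdown x hx y htS.2
    -- At the exit point a new affine function must vanish: otherwise the strict signs would persist
    -- slightly beyond `t`. Functions vanishing at `x` vanish at `m` too, hence on the whole ray,
    -- and impose no condition.
    obtain ⟨f, hf, hfx, hfy⟩ : ∃ f ∈ A, f x ≠ 0 ∧ f y = 0 := by
      by_contra! hcon
      have hev : ∀ᶠ s in nhdsWithin t (Ioi t), FaceLE A (AffineMap.lineMap m x s) x := by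
        simp only [FaceLE]
        refine (Filter.eventually_all_finite hA).2 fun f hf => ?_
        rcases lt_trichotomy (f x) 0 with h | h | h
        · have h1 : f (AffineMap.lineMap m x t) < 0 :=
            ((htS.2 f hf).2.2 h).lt_of_ne (hcon f hf h.ne)
          have := nhdsWithin_le_nhds (s := Ioi t)
            ((hcont f).continuousAt.eventually (Iio_mem_nhds h1))
          filter_upwards [this] with s hs
          exact ⟨fun h' => absurd h' h.ne, fun h' => absurd h' h.le.not_gt, fun _ => le_of_lt hs⟩
        · refine Filter.Eventually.of_forall fun s => ⟨fun _ => ?_, fun h' => absurd h h'.ne',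
            fun h' => absurd h h'.ne⟩
          rw [f.apply_lineMap, h, (hmx f hf).1 h]; simp
        · have h1 : 0 < f (AffineMap.lineMap m x t) :=
            ((htS.2 f hf).2.1 h).lt_of_ne (hcon f hf h.ne').symm
          have := nhdsWithin_le_nhds (s := Ioi t)
            ((hcont f).continuousAt.eventually (Ioi_mem_nhds h1))
          filter_upwards [this] with s hs
          exact ⟨fun h' => absurd h' h.ne', fun _ => le_of_lt hs, fun h' => absurd h' h.le.not_gt⟩
      obtain ⟨s, hs, hs'⟩ := (hev.and self_mem_nhdsWithin).exists
      have hs' : t < s := hs'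
      exact not_lt.2 (le_csSup hSb ⟨htS.1.trans hs'.le, hs⟩) hs'
    have hlt : {f ∈ A | f y ≠ 0}.ncard < {f ∈ A | f x ≠ 0}.ncard := by
      refine ncard_lt_ncard ?_ (hA.subset (sep_subset _ _))
      refine (ssubset_iff_of_subset ?_).2 ⟨f, ⟨hf, hfx⟩, fun h => h.2 hfy⟩
      exact fun g hg => ⟨hg.1, fun h => hg.2 ((htS.2 g hg.1).1 h)⟩
    obtain ⟨s, hsV, hsc, hsy, hys⟩ := ih _ (hlt.trans_le hn) y hyP le_rfl
    have hsx : ∀ a ∈ s, FaceLE A a x := fun a ha => (hsy a ha).trans htS.2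
    refine ⟨insert m s, ?_, ?_, ?_, ?_⟩
    · rw [Finset.coe_insert]
      exact insert_subset ⟨x, hx, rfl⟩ hsV
    · intro a ha b hb
      rcases Finset.mem_insert.1 ha with rfl | ha <;> rcases Finset.mem_insert.1 hb with rfl | hb
      · exact .inl (refl _)
      · exact .inr ((hsx b hb).trans hxm)
      · exact .inl ((hsx a ha).trans hxm)
      · exact hsc a ha b hb
    · intro a ha
      rcases Finset.mem_insert.1 ha with rfl | ha
      exacts [hmx, hsx a ha]
    · have h1 : m ∈ convexHull ℝ ((insert m s : Finset E) : Set E) :=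
        subset_convexHull ℝ _ (by simp)
      have h2 : y ∈ convexHull ℝ ((insert m s : Finset E) : Set E) :=
        convexHull_mono (by simp) hys
      have htp : 0 < t := zero_lt_one.trans_le htS.1
      -- Since `y` has parameter `t ≥ 1` on the ray, `x` has parameter `t⁻¹ ≤ 1` on the segment from
      -- `m` to `y`.
      have h3 : AffineMap.lineMap m y t⁻¹ = x := by
        simp [hy, AffineMap.lineMap_apply, smul_smul, htp.ne']
      rw [← h3]
      exact (convex_convexHull ℝ _).lineMap_mem h1 h2
        ⟨by positivity, inv_le_one_of_one_le₀ htS.1⟩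

/-- A relatively open cell is a sign vector, and finitely many affine functions have finitely many
sign vectors. The representative is chosen through the sign vector, so it is the same for all points
of a cell. Any point of the cell will do; barycentres are not needed. -/
theorem exists_cell_representatives (hA : A.Finite) (P : Set E) : ∃ r : E → E,
    (∀ x ∈ P, r x ∈ P ∧ FaceLE A (r x) x ∧ FaceLE A x (r x)) ∧
    (∀ x y, FaceLE A x y → FaceLE A y x → r x = r y) ∧ (r '' P).Finite := by
  classical
  have := hA.to_subtype
  let σ : E → A → SignType := fun x f => SignType.sign (f.1 x)
  let c : (A → SignType) → E := fun s => if h : ∃ z ∈ P, σ z = s then h.choose else 0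
  have hc : ∀ x ∈ P, c (σ x) ∈ P ∧ σ (c (σ x)) = σ x := fun x hx => by
    have h : ∃ z ∈ P, σ z = σ x := ⟨x, hx, rfl⟩
    rw [show c (σ x) = h.choose from dif_pos h]
    exact h.choose_spec
  refine ⟨fun x => c (σ x), fun x hx => ⟨(hc x hx).1, ?_, ?_⟩, fun x y h h' => ?_, ?_⟩
  · exact .of_sign_eq fun f hf => congrFun (hc x hx).2 ⟨f, hf⟩
  · exact .of_sign_eq fun f hf => (congrFun (hc x hx).2 ⟨f, hf⟩).symm
  · exact congrArg c (funext fun f => h.sign_eq h' f.2)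
  · exact (finite_range c).subset (by rintro _ ⟨x, _, rfl⟩; exact ⟨_, rfl⟩)

theorem sum_extend {α M : Type*} [AddCommMonoid M] {s T : Finset α} [DecidablePred (· ∈ s)]
    (h : s ⊆ T) (g : α → M) : ∑ a ∈ T, (if a ∈ s then g a else 0) = ∑ a ∈ s, g a := by
  classical
  rw [← Finset.sum_filter, Finset.filter_mem_eq_inter, Finset.inter_eq_right.2 h]

-- Affine independence of a face is stated with weights on the subtype of its vertices. Extension by
-- zero turns these sums into sums over the face itself.
open Classical in
theorem sum_extend_smul {α M : Type*} [AddCommGroup M] [Module ℝ M] {s : Finset α}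
    (u : Finset s) (w : s → ℝ) (q : α → M) :
    ∑ a ∈ s, (if h : a ∈ s then (if ⟨a, h⟩ ∈ u then w ⟨a, h⟩ else 0) else 0) • q a =
      ∑ i ∈ u, w i • q i := by
  rw [← Finset.sum_coe_sort s]
  simp only [Finset.coe_mem, dite_true, Subtype.coe_eta, ite_smul, zero_smul]
  rw [Finset.sum_ite_mem, Finset.univ_inter]

/-- A bounded union of closed cells of an arrangement of hyperplanes has a finite triangulation. -/
theorem exists_triangulation_of_cells [FiniteDimensional ℝ E] (hA : A.Finite) {P : Set E}
    (hP : Bornology.IsBounded P) (hdown : ∀ x ∈ P, ∀ y, FaceLE A y x → y ∈ P) :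
    ∃ K : Geometry.SimplicialComplex ℝ E, K.faces.Finite ∧ K.space = P := by
  classical
  obtain ⟨r, hr, hr', hfin⟩ := exists_cell_representatives hA P
  have hV : ∀ x ∈ r '' P, ∀ y ∈ r '' P, FaceLE A x y → FaceLE A y x → x = y := by
    rintro _ ⟨x, hx, rfl⟩ _ ⟨y, hy, rfl⟩ h h'
    exact hr' x y (((hr x hx).2.2.trans h).trans (hr y hy).2.1)
      (((hr y hy).2.2.trans h').trans (hr x hx).2.1)
  -- The simplices are the nonempty chains of representatives, as in a barycentric subdivision. Both
  -- geometric axioms follow from the uniqueness of weights along chains.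
  let K : Geometry.SimplicialComplex ℝ E :=
    { faces := {s | s.Nonempty ∧ ↑s ⊆ r '' P ∧ ∀ a ∈ s, ∀ b ∈ s, FaceLE A a b ∨ FaceLE A b a}
      isRelLowerSet_faces := fun s hs => ⟨hs.1, fun t hts htn => ⟨htn,
        (Finset.coe_subset.2 hts).trans hs.2.1, fun a ha b hb => hs.2.2 a (hts ha) b (hts hb)⟩⟩
      indep := by
        rintro s ⟨-, hsV, hsc⟩
        rw [affineIndependent_iff]
        intro u w hw hw' i hi
        let g : E → ℝ := fun a => if h : a ∈ s then (if ⟨a, h⟩ ∈ u then w ⟨a, h⟩ else 0) else 0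
        have hg : ∀ i : s, g i = if i ∈ u then w i else 0 := fun i => by
          simp only [g, dif_pos i.2]
        have g1 : ∑ a ∈ s, g a = 0 := by
          have := sum_extend_smul u w (fun _ => (1 : ℝ))
          simp only [smul_eq_mul, mul_one, hw] at this
          exact this
        have g2 : ∑ a ∈ s, g a • a = 0 := (sum_extend_smul u w id).trans hw'
        have hpn : ∀ a, max (g a) 0 - max (-g a) 0 = g a := fun a => by
          rcases le_total (g a) 0 with h | h
          · rw [max_eq_right h, max_eq_left (by linarith)]; ring
          · rw [max_eq_left h, max_eq_right (by linarith)]; ring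
        -- An affine relation is split into its positive and negative parts: two nonnegative
        -- combinations with equal total weight and equal value, both supported in the chain. They
        -- coincide, so the relation is trivial.
        have key := FaceLE.weights_unique hV hsV _ (fun a => max (g a) 0) (fun a => max (-g a) 0)
          (fun a _ => le_max_right _ _) (fun a _ => le_max_right _ _)
          (fun a ha b hb _ _ => hsc a ha b hb) (fun a ha b hb _ _ => hsc a ha b hb)
          (by rw [← sub_eq_zero, ← Finset.sum_sub_distrib]; simpa only [hpn] using g1)
          (by rw [← sub_eq_zero, ← Finset.sum_sub_distrib]
              simpa only [← sub_smul, hpn] using g2) le_rfl i i.2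
        have h0 : g i = 0 := by rw [← hpn, key, sub_self]
        rwa [hg, if_pos hi] at h0
      inter_subset_convexHull := by
        rintro s t ⟨-, hsV, hsc⟩ ⟨-, htV, htc⟩ x ⟨hxs, hxt⟩
        obtain ⟨w, hw, hw1, hwx⟩ := Finset.mem_convexHull'.1 hxs
        obtain ⟨v, hv, hv1, hvx⟩ := Finset.mem_convexHull'.1 hxt
        have hTV : ((s ∪ t : Finset E) : Set E) ⊆ r '' P := by
          rw [Finset.coe_union]; exact union_subset hsV htV
        -- The two expressions of `x` by the vertices of `s` and of `t`, extended by zero to the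
        -- union, coincide. Hence only common vertices carry weight. The union need not be a chain:
        -- only the two supports must be.
        have key := FaceLE.weights_unique hV hTV _ (fun a => if a ∈ s then w a else 0)
          (fun a => if a ∈ t then v a else 0)
          (fun a _ => by split_ifs with h; exacts [hw a h, le_rfl])
          (fun a _ => by split_ifs with h; exacts [hv a h, le_rfl])
          (fun a _ b _ ha hb => by
            have ha' : a ∈ s := by by_contra h; simp [h] at ha
            have hb' : b ∈ s := by by_contra h; simp [h] at hb
            exact hsc a ha' b hb')
          (fun a _ b _ ha hb => by
            have ha' : a ∈ t := by by_contra h; simp [h] at ha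
            have hb' : b ∈ t := by by_contra h; simp [h] at hb
            exact htc a ha' b hb')
          (by rw [sum_extend Finset.subset_union_left,
            sum_extend Finset.subset_union_right, hw1, hv1])
          (by
            simp only [ite_smul, zero_smul]
            rw [sum_extend Finset.subset_union_left (fun a => w a • a),
              sum_extend Finset.subset_union_right (fun a => v a • a), hwx, hvx])
          le_rfl
        rw [← Finset.coe_inter, Finset.mem_convexHull']
        have h0 : ∀ a ∈ s, a ∉ s ∩ t → w a = 0 := fun a ha hat => by
          have := key a (by simp [ha])
          simpa [ha, show a ∉ t from fun h => hat (by simp [ha, h])] using this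
        refine ⟨w, fun a ha => hw a (Finset.mem_inter.1 ha).1, ?_, ?_⟩
        · rw [← hw1]; exact Finset.sum_subset Finset.inter_subset_left h0
        · rw [← hwx]
          exact Finset.sum_subset Finset.inter_subset_left fun a ha hat => by
            rw [h0 a ha hat, zero_smul] }
  refine ⟨K, ?_, ?_⟩
  · refine hfin.toFinset.powerset.finite_toSet.subset fun s hs => ?_
    rw [Finset.mem_coe, Finset.mem_powerset]
    exact fun a ha => hfin.mem_toFinset.2 (hs.2.1 ha)
  · ext x
    rw [Geometry.SimplicialComplex.mem_space_iff]
    constructor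
    · rintro ⟨s, ⟨hsn, hsV, hsc⟩, hx⟩
      obtain ⟨m, hm, hmax⟩ := FaceLE.exists_max hsn hsc
      obtain ⟨z, hz, rfl⟩ := hsV hm
      exact hdown _ (hr z hz).1 x (convexHull_min hmax (FaceLE.convex _) hx)
    · intro hx
      obtain ⟨s, h1, h2, -, h3⟩ := FaceLE.exists_chain hA hP hdown (fun x hx => (hr x hx).2) _ x hx
        le_rfl
      exact ⟨s, ⟨Finset.coe_nonempty.1 (convexHull_nonempty_iff.1 ⟨x, h3⟩), h1, h2⟩, h3⟩

/-- The arrangement consists of all affine functions defining the convex pieces. A piece is given by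
weak inequalities in functions of the arrangement, so with a point it contains the closed cell of
that point. -/
theorem IsPolyhedron.exists_triangulation [FiniteDimensional ℝ E] {P : Set E}
    (hP : IsPolyhedron P) :
    ∃ K : Geometry.SimplicialComplex ℝ E, K.faces.Finite ∧ K.space = P := by
  obtain ⟨hc, 𝒬, hf, hq, rfl⟩ := hP
  choose! A hA hQA using hq
  refine exists_triangulation_of_cells (A := ⋃ Q ∈ 𝒬, A Q) (hf.biUnion hA) hc.isBounded ?_
  rintro x ⟨Q, hQ, hx⟩ y hyx
  refine ⟨Q, hQ, ?_⟩
  rw [hQA Q hQ] at hx ⊢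
  intro f hfQ
  obtain ⟨h1, h2, -⟩ := hyx f (mem_biUnion hQ hfQ)
  rcases (show 0 ≤ f x from hx f hfQ).eq_or_lt with h | h
  exacts [(h1 h.symm).ge, h2 h]

/-- `eulerChar` is computed from an arbitrarily chosen triangulation and is 0 by default when there
is none. Existence excludes the default, and the valuation makes the choice irrelevant. -/
theorem IsPolyhedron.hasEuler_eulerChar [FiniteDimensional ℝ E] {P : Set E}
    (hP : IsPolyhedron P) : HasEuler P (eulerChar P) := by
  have h := hP.exists_triangulation
  rw [eulerChar, dif_pos h]
  have := hasEuler_space h.choose_spec.1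
  rwa [h.choose_spec.2] at this

end triangulation
end PL

namespace PL

/-! The Euler characteristic of a curve -/

section curve
variable {E : Type*} [NormedAddCommGroup E] [NormedSpace ℝ E]

/-- If `f b` were at least `f a`, the intermediate value theorem would give a point of the second
arm with the value `f a`. By injectivity it would be `a`, but the arms meet only in `p`. -/
theorem not_le_le_of_injOn {f : E → ℝ} {p a b : E}
    (hf : ContinuousOn f (segment ℝ p b)) (hi : InjOn f (segment ℝ p a ∪ segment ℝ p b))
    (ha : a ≠ p) (hab : segment ℝ p a ∩ segment ℝ p b ⊆ {p}) (h1 : f p ≤ f a) : f b < f a := by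
  by_contra! h2
  obtain ⟨q, hq, hqa⟩ := (convex_segment p b).isPreconnected.intermediate_value
    (left_mem_segment ℝ p b) (right_mem_segment ℝ p b) hf ⟨h1, h2⟩
  have := hi (.inr hq) (.inl (right_mem_segment ℝ p a)) hqa
  exact ha (hab ⟨right_mem_segment ℝ p a, this ▸ hq⟩)

/-- A continuous injective function on a bent segment is monotone. -/
theorem lt_lt_or_of_injOn {f : E → ℝ} {p a b : E}
    (hf : ContinuousOn f (segment ℝ p a ∪ segment ℝ p b))
    (hi : InjOn f (segment ℝ p a ∪ segment ℝ p b)) (ha : a ≠ p) (hb : b ≠ p)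
    (hab : segment ℝ p a ∩ segment ℝ p b ⊆ {p}) :
    (f a < f p ∧ f p < f b) ∨ (f b < f p ∧ f p < f a) := by
  have hfa := hf.mono subset_union_left
  have hfb := hf.mono subset_union_right
  have hi' : InjOn f (segment ℝ p b ∪ segment ℝ p a) := by rwa [union_comm]
  have hba : segment ℝ p b ∩ segment ℝ p a ⊆ {p} := by rwa [inter_comm]
  have hni : ∀ {S : Set E}, InjOn f S → InjOn (fun x => - f x) S := fun h x hx y hy hxy =>
    h hx hy (neg_injective hxy)
  have na : f a ≠ f p := fun h => ha (hi (.inl (right_mem_segment ℝ p a))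
    (.inl (left_mem_segment ℝ p a)) h)
  have nb : f b ≠ f p := fun h => hb (hi (.inr (right_mem_segment ℝ p b))
    (.inl (left_mem_segment ℝ p a)) h)
  rcases na.lt_or_gt with h | h <;> rcases nb.lt_or_gt with h' | h'
  -- If both arms go the same way from `p`, then by symmetry each of the two end values strictly
  -- exceeds the other. The downward case is the upward one for `-f`.
  · have h1 := not_le_le_of_injOn hfb.neg (hni hi) ha hab (by simpa using h.le)
    have h2 := not_le_le_of_injOn hfa.neg (hni hi') hb hba (by simpa using h'.le)
    linarith
  · exact .inl ⟨h, h'⟩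
  · exact .inr ⟨h', h⟩
  · have h1 := not_le_le_of_injOn hfb hi ha hab h.le
    have h2 := not_le_le_of_injOn hfa hi' hb hba h'.le
    linarith

/-- Shortening an arm at `p` brings it into the domain of a chart without creating new
intersections. -/
theorem exists_segment_subset {S U : Set E} {p a : E} (hS : segment ℝ p a ⊆ S) (hU : IsOpen U)
    (hp : p ∈ U) (ha : a ≠ p) : ∃ a' ≠ p, segment ℝ p a' ⊆ segment ℝ p a ∧
      segment ℝ p a' ⊆ S ∩ U := by
  obtain ⟨ε, hε, hεU⟩ := Metric.isOpen_iff.1 hU p hp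
  have h1 : ContinuousAt (fun t : ℝ => AffineMap.lineMap p a t) 0 :=
    AffineMap.lineMap_continuous.continuousAt
  have h2 : ∀ᶠ t : ℝ in nhdsWithin 0 (Ioi 0), AffineMap.lineMap p a t ∈ Metric.ball p ε :=
    nhdsWithin_le_nhds (h1.eventually (by
      simp only [AffineMap.lineMap_apply_zero]; exact Metric.ball_mem_nhds p hε))
  have h3 : ∀ᶠ t : ℝ in nhdsWithin 0 (Ioi 0), t < 1 :=
    nhdsWithin_le_nhds (Iio_mem_nhds one_pos)
  obtain ⟨t, h3, h4, h5⟩ := (h2.and (h3.and self_mem_nhdsWithin)).exists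
  have h4 : t < 1 := h4
  have h5 : 0 < t := h5
  have hmem : AffineMap.lineMap p a t ∈ segment ℝ p a := by
    rw [segment_eq_image_lineMap]; exact ⟨t, ⟨h5.le, h4.le⟩, rfl⟩
  have hsub := (convex_segment p a).segment_subset (left_mem_segment ℝ p a) hmem
  refine ⟨AffineMap.lineMap p a t, fun h => ?_, hsub, subset_inter (hsub.trans hS) ?_⟩
  · rcases AffineMap.lineMap_eq_left_iff.1 h with h | h
    exacts [ha h.symm, h5.ne' h]
  · exact ((convex_ball p ε).segment_subset (Metric.mem_ball_self hε) h3).trans hεU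

variable {S D : Set E} {p a b c : E}

theorem HalfChart.injOn {X M : Type*} [TopologicalSpace X] [TopologicalSpace M] {h : M → ℝ}
    {S D U : Set X} (c : HalfChart h S D U) : InjOn c.f (S ∩ U) := fun x hx y hy hxy => by
  rw [← c.gf x hx, ← c.gf y hy, hxy]

/-- An inner point of an arc is not a boundary point. -/
theorem IsCurve.notMem_boundary (hS : IsCurve S D) (hpa : segment ℝ p a ⊆ S)
    (hpb : segment ℝ p b ⊆ S) (ha : a ≠ p) (hb : b ≠ p)
    (hab : segment ℝ p a ∩ segment ℝ p b ⊆ {p}) : p ∉ D := fun hpD => by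
  have hpS := hpa (left_mem_segment ℝ p a)
  obtain ⟨U, -, hU, hpU, H⟩ := (hS.2 p hpS).exists_halfChart hpS isOpen_univ (mem_univ p)
  obtain ⟨c⟩ := H U subset_rfl hU hpU
  obtain ⟨a', ha', haa', hSa⟩ := exists_segment_subset hpa hU hpU ha
  obtain ⟨b', hb', hbb', hSb⟩ := exists_segment_subset hpb hU hpU hb
  have h0 := (c.bd p ⟨hpS, hpU⟩).1 hpD
  have h1 : 0 ≤ c.f a' := (c.mf a' (hSa (right_mem_segment ℝ p a'))).2
  have h2 : 0 ≤ c.f b' := (c.mf b' (hSb (right_mem_segment ℝ p b'))).2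
  -- At a boundary point the chart coordinate is 0, yet it would have to be negative at the end of
  -- one of the arms.
  rcases lt_lt_or_of_injOn (c.cf.mono (union_subset hSa hSb)) (c.injOn.mono (union_subset hSa hSb))
    ha' hb' ((inter_subset_inter haa' hbb').trans hab) with h | h <;> linarith

/-- A curve contains no tripod. -/
theorem IsCurve.no_tripod (hS : IsCurve S D) (hpa : segment ℝ p a ⊆ S)
    (hpb : segment ℝ p b ⊆ S) (hpc : segment ℝ p c ⊆ S) (ha : a ≠ p) (hb : b ≠ p) (hc : c ≠ p)
    (hab : segment ℝ p a ∩ segment ℝ p b ⊆ {p}) (hac : segment ℝ p a ∩ segment ℝ p c ⊆ {p})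
    (hbc : segment ℝ p b ∩ segment ℝ p c ⊆ {p}) : False := by
  have hpS := hpa (left_mem_segment ℝ p a)
  obtain ⟨U, -, hU, hpU, H⟩ := (hS.2 p hpS).exists_halfChart hpS isOpen_univ (mem_univ p)
  obtain ⟨e⟩ := H U subset_rfl hU hpU
  obtain ⟨a', ha', haa', hSa⟩ := exists_segment_subset hpa hU hpU ha
  obtain ⟨b', hb', hbb', hSb⟩ := exists_segment_subset hpb hU hpU hb
  obtain ⟨c', hc', hcc', hSc⟩ := exists_segment_subset hpc hU hpU hc
  have key : ∀ {x y : E}, segment ℝ p x ⊆ S ∩ U → segment ℝ p y ⊆ S ∩ U → x ≠ p → y ≠ p →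
      segment ℝ p x ∩ segment ℝ p y ⊆ {p} →
      (e.f x < e.f p ∧ e.f p < e.f y) ∨ (e.f y < e.f p ∧ e.f p < e.f x) :=
    fun hx hy hx' hy' hxy => lt_lt_or_of_injOn (e.cf.mono (union_subset hx hy))
      (e.injOn.mono (union_subset hx hy)) hx' hy' hxy
  have h1 := key hSa hSb ha' hb' ((inter_subset_inter haa' hbb').trans hab)
  have h2 := key hSa hSc ha' hc' ((inter_subset_inter haa' hcc').trans hac)
  have h3 := key hSb hSc hb' hc' ((inter_subset_inter hbb' hcc').trans hbc)
  -- Three real numbers cannot lie pairwise on opposite sides of `e.f p`.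
  rcases h1 with h1 | h1 <;> rcases h2 with h2 | h2 <;> rcases h3 with h3 | h3 <;> linarith

/-- An end of a segment is a boundary point. -/
theorem IsCurve.mem_boundary (hS : IsCurve S D) (hp : p ∈ S) {N : Set E} (hN : IsOpen N)
    (hpN : p ∈ N) (h : S ∩ N ⊆ segment ℝ p a) : p ∈ D := by
  by_contra hpD
  obtain ⟨U, hUN, hU, hpU, H⟩ := (hS.2 p hp).exists_halfChart hp hN hpN
  obtain ⟨c⟩ := H U subset_rfl hU hpU
  have h1 := c.mf p ⟨hp, hpU⟩
  have hpos : 0 < c.f p :=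
    lt_of_le_of_ne h1.2 fun h => hpD ((c.bd p ⟨hp, hpU⟩).2 h.symm)
  obtain ⟨ε, hε, hεV⟩ := Metric.isOpen_iff.1 (c.isOpen_V.inter isOpen_Ioi) (c.f p) ⟨h1.1, hpos⟩
  set x := c.f p with hx
  have hball : ∀ y ∈ Metric.ball x ε, y ∈ c.V ∩ {y | 0 ≤ y} := fun y hy =>
    ⟨(hεV hy).1, (show 0 < y from (hεV hy).2).le⟩
  have hsub : ∀ z, |z - x| < ε → segment ℝ x z ⊆ Metric.ball x ε := fun z hz =>
    (convex_ball x ε).segment_subset (Metric.mem_ball_self hε) (by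
      rw [Metric.mem_ball, Real.dist_eq]; exact hz)
  have hs1 := hsub (x - ε / 2) (by rw [sub_sub_cancel_left, abs_neg, abs_of_pos] <;> linarith)
  have hs2 := hsub (x + ε / 2) (by rw [add_sub_cancel_left, abs_of_pos] <;> linarith)
  have hss := union_subset hs1 hs2
  have hgS : ∀ y ∈ Metric.ball x ε, c.g y ∈ segment ℝ p a := fun y hy =>
    h ⟨(c.mg y (hball y hy)).1, hUN (c.mg y (hball y hy)).2⟩
  have hgp : c.g x = p := c.gf p ⟨hp, hpU⟩
  -- The distance from its end point is an injective coordinate on a segment, including the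
  -- degenerate segment with `a = p`, which is used for isolated points.
  have hseg : ∀ u ∈ segment ℝ p a, ∀ v ∈ segment ℝ p a, dist u p = dist v p → u = v := by
    rw [segment_eq_image_lineMap]
    rintro _ ⟨s, hs, rfl⟩ _ ⟨t, ht, rfl⟩ hst
    rw [dist_lineMap_left, dist_lineMap_left, Real.norm_of_nonneg hs.1,
      Real.norm_of_nonneg ht.1] at hst
    rcases mul_eq_mul_right_iff.1 hst with h | h
    · rw [h]
    · rw [dist_eq_zero.1 h]; simp
  -- If `p` were not in `D`, the inverse chart would map a two-sided interval about `x` into the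
  -- segment. Its distance from `p` would be continuous and injective there, hence monotone at `x`,
  -- although it has its minimum 0 at `x`.
  have key := lt_lt_or_of_injOn (f := fun y => dist (c.g y) p) (p := x) (a := x - ε / 2)
    (b := x + ε / 2) ?_ ?_ (by linarith) (by linarith) ?_
  · simp only [hgp, dist_self] at key
    have h1 : 0 ≤ dist (c.g (x - ε / 2)) p := dist_nonneg
    have h2 : 0 ≤ dist (c.g (x + ε / 2)) p := dist_nonneg
    rcases key with h | h <;> linarith
  · exact (continuous_id.dist continuous_const).comp_continuousOn (c.cg.mono (hss.trans hball))
  · intro y hy z hz hyz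
    have h1 := hball y (hss hy)
    have h2 := hball z (hss hz)
    rw [← c.fg y h1, ← c.fg z h2, hseg _ (hgS y (hss hy)) _ (hgS z (hss hz)) hyz]
  · rw [segment_symm, segment_eq_Icc (by linarith), segment_eq_Icc (by linarith)]
    rintro y ⟨⟨_, h1⟩, ⟨h2, _⟩⟩
    exact le_antisymm h1 h2

/-- A curve has no isolated points. -/
theorem IsCurve.not_isolated (hS : IsCurve S D) (hp : p ∈ S) {N : Set E} (hN : IsOpen N)
    (hpN : p ∈ N) (h : S ∩ N ⊆ {p}) : False := by
  have hpD := hS.mem_boundary hp hN hpN (a := p) (by rwa [segment_same])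
  obtain ⟨U, hUN, hU, hpU, H⟩ := (hS.2 p hp).exists_halfChart hp hN hpN
  obtain ⟨c⟩ := H U subset_rfl hU hpU
  have h1 := c.mf p ⟨hp, hpU⟩
  have h0 := (c.bd p ⟨hp, hpU⟩).1 hpD
  rw [h0] at h1
  obtain ⟨ε, hε, hεV⟩ := Metric.isOpen_iff.1 c.isOpen_V 0 h1.1
  -- Even at a boundary point the chart has further values: the inverse chart sends `ε / 2` to a
  -- point of the curve near `p`, hence to `p`, whose coordinate is 0.
  have hy : ε / 2 ∈ c.V ∩ {y | 0 ≤ y} := ⟨hεV (by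
    rw [Metric.mem_ball, Real.dist_eq, sub_zero, abs_of_pos] <;> linarith), by
    show 0 ≤ ε / 2; linarith⟩
  have h2 := c.mg _ hy
  have h3 : c.g (ε / 2) = p := h ⟨h2.1, hUN h2.2⟩
  have h4 := c.fg _ hy
  rw [h3, h0] at h4
  linarith

/-- An inner point cuts a segment into two arms with opposite directions. This puts a point inside
an edge into the situation of `IsCurve.notMem_boundary`. -/
theorem segment_inter_segment_subset {u w x : E} (hx : x ∈ segment ℝ u w) (hxu : x ≠ u)
    (hxw : x ≠ w) : segment ℝ x u ∩ segment ℝ x w ⊆ {x} := by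
  have huw : w - u ≠ 0 := by
    intro h
    rw [sub_eq_zero] at h
    subst h
    rw [segment_same] at hx
    exact hxu hx
  simp only [segment_eq_image_lineMap] at hx ⊢
  obtain ⟨t, ht, rfl⟩ := hx
  rintro _ ⟨⟨r, hr, rfl⟩, ⟨s, hs, hrs⟩⟩
  have h1 : (s * (1 - t) + r * t) • (w - u) = 0 := by
    simp only [AffineMap.lineMap_apply_module'] at hrs
    rw [← sub_eq_zero] at hrs
    rw [← hrs]
    module
  have h2 := (smul_eq_zero.1 h1).resolve_right huw
  have ht0 : t ≠ 0 := by rintro rfl; simp at hxu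
  have h3 : 0 ≤ s * (1 - t) := mul_nonneg hs.1 (by linarith [ht.2])
  have h4 : 0 ≤ r * t := mul_nonneg hr.1 ht.1
  have h5 : r = 0 := (mul_eq_zero.1 (by linarith : r * t = 0)).resolve_right ht0
  simp [h5]

/-! ### Vertices and edges of a triangulated curve -/

open Geometry in
/-- A triangulated curve has only vertices and edges. -/
theorem card_face_le_two {K : SimplicialComplex ℝ E} (hS : IsCurve K.space D) {s : Finset E}
    (hs : s ∈ K.faces) : s.card ≤ 2 := by
  by_contra! h
  obtain ⟨x, hx, y, hy, z, hz, hxy, hxz, hyz⟩ := Finset.two_lt_card.1 h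
  have hind : AffineIndependent ℝ ![x, y, z] := by
    have := (K.indep hs).comp_embedding (ι2 := Fin 3) ⟨![⟨x, hx⟩, ⟨y, hy⟩, ⟨z, hz⟩], by
      intro i j hij
      fin_cases i <;> fin_cases j <;> simp_all [Subtype.ext_iff]⟩
    have e : ![x, y, z] = fun i => ((![⟨x, hx⟩, ⟨y, hy⟩, ⟨z, hz⟩] : Fin 3 → s) i : E) := by
      funext i; fin_cases i <;> rfl
    rw [e]
    exact this
  have hlin : ∀ u v : ℝ, u • (y - x) + v • (z - x) = 0 → u = 0 ∧ v = 0 := fun u v huv => by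
    have := affineIndependent_iff.1 hind Finset.univ ![-u - v, u, v]
      (by simp only [Fin.sum_univ_three, Matrix.cons_val]; ring) (by
        simp only [Fin.sum_univ_three, Matrix.cons_val]
        rw [← huv]; module)
    exact ⟨this 1 (Finset.mem_univ _), this 2 (Finset.mem_univ _)⟩
  have hK := SimplicialComplex.convexHull_subset_space hs
  have hsub : ∀ u ∈ convexHull ℝ (s : Set E), segment ℝ x u ⊆ K.space := fun u hu =>
    ((convex_convexHull ℝ _).segment_subset (subset_convexHull ℝ _ hx) hu).trans hK
  have hy' := subset_convexHull ℝ (s : Set E) hy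
  have hz' := subset_convexHull ℝ (s : Set E) hz
  -- In the coordinates given by `y - x` and `z - x`, two arms from `x` meet only in `x` when no
  -- nonzero multiple of the first direction is a multiple of the second.
  have key : ∀ u₁ v₁ u₂ v₂ : ℝ, (∀ r t : ℝ, r * u₁ = t * u₂ → r * v₁ = t * v₂ → r = 0) →
      segment ℝ x (x + (u₁ • (y - x) + v₁ • (z - x))) ∩
      segment ℝ x (x + (u₂ • (y - x) + v₂ • (z - x))) ⊆ {x} := by
    intro u₁ v₁ u₂ v₂ h
    simp only [segment_eq_image_lineMap]
    rintro _ ⟨⟨r, hr, rfl⟩, ⟨t, ht, hrt⟩⟩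
    simp only [AffineMap.lineMap_apply_module'] at hrt ⊢
    rw [← sub_eq_zero] at hrt
    have := hlin (t * u₂ - r * u₁) (t * v₂ - r * v₁) (by rw [← hrt]; module)
    rw [h r t (by linarith [this.1]) (by linarith [this.2])]
    simp
  have ey : y = x + ((1 : ℝ) • (y - x) + (0 : ℝ) • (z - x)) := by module
  have ez : z = x + ((0 : ℝ) • (y - x) + (1 : ℝ) • (z - x)) := by module
  have em : (1 / 2 : ℝ) • y + (1 / 2 : ℝ) • z =
    x + ((1 / 2 : ℝ) • (y - x) + (1 / 2 : ℝ) • (z - x)) := by module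
  have hm : (1 / 2 : ℝ) • y + (1 / 2 : ℝ) • z ≠ x := fun h => by
    have := (hlin (1 / 2) (1 / 2) (by
      rw [← sub_eq_zero] at h; rw [← h]; module)).1
    norm_num at this
  -- A triangle contains a tripod at `x`: its two sides and the median to the midpoint of the
  -- opposite side.
  refine hS.no_tripod (hsub y hy') (hsub z hz') (hsub ((1 / 2 : ℝ) • y + (1 / 2 : ℝ) • z)
    (convex_convexHull ℝ _ hy' hz' (by norm_num) (by norm_num) (by norm_num)))
    hxy.symm hxz.symm hm ?_ ?_ ?_
  · have := key 1 0 0 1 (fun r t h1 h2 => by linarith)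
    rwa [← ey, ← ez] at this
  · have := key 1 0 (1 / 2) (1 / 2) (fun r t h1 h2 => by linarith)
    rwa [← ey, ← em] at this
  · have := key 0 1 (1 / 2) (1 / 2) (fun r t h1 h2 => by linarith)
    rwa [← ez, ← em] at this

theorem exists_eq_pair {α : Type*} [DecidableEq α] {s : Finset α} (hs : s.card = 2) {v : α}
    (hv : v ∈ s) : ∃ w ≠ v, s = {v, w} := by
  obtain ⟨x, y, hxy, rfl⟩ := Finset.card_eq_two.1 hs
  rcases Finset.mem_insert.1 hv with rfl | h
  · exact ⟨y, hxy.symm, rfl⟩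
  · rw [Finset.mem_singleton.1 h]; exact ⟨x, hxy, Finset.pair_comm _ _⟩

open Geometry Classical in
/-- In a triangulated curve the boundary points have degree one, the other vertices degree two. -/
theorem vertex_degree {K : SimplicialComplex ℝ E} (hK : K.faces.Finite) (hS : IsCurve K.space D)
    {v : E} (hv : {v} ∈ K.faces) :
    {s ∈ hK.toFinset | s.card = 2 ∧ v ∈ s}.card = if v ∈ D then 1 else 2 := by
  set F := {s ∈ hK.toFinset | s.card = 2 ∧ v ∈ s} with hF
  have memF : ∀ {s}, s ∈ F ↔ s ∈ K.faces ∧ s.card = 2 ∧ v ∈ s := by simp [hF]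
  have edge : ∀ s ∈ F, ∃ w ≠ v, s = {v, w} ∧ segment ℝ v w ⊆ K.space ∧
      convexHull ℝ (s : Set E) = segment ℝ v w := fun s hs => by
    obtain ⟨h1, h2, h3⟩ := memF.1 hs
    obtain ⟨w, hw, rfl⟩ := exists_eq_pair h2 h3
    have : convexHull ℝ (({v, w} : Finset E) : Set E) = segment ℝ v w := by
      rw [Finset.coe_pair, convexHull_pair]
    exact ⟨w, hw, rfl, this ▸ SimplicialComplex.convexHull_subset_space h1, this⟩
  have meet : ∀ s ∈ F, ∀ t ∈ F, s ≠ t →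
      convexHull ℝ (s : Set E) ∩ convexHull ℝ (t : Set E) ⊆ {v} := fun s hs t ht hst => by
    refine (K.inter_subset_convexHull (memF.1 hs).1 (memF.1 ht).1).trans ?_
    obtain ⟨w, hw, rfl, -⟩ := edge s hs
    obtain ⟨w', hw', rfl, -⟩ := edge t ht
    have hww : w ≠ w' := by rintro rfl; exact hst rfl
    refine convexHull_min ?_ (convex_singleton v)
    intro x
    simp only [Finset.coe_insert, Finset.coe_singleton, mem_inter_iff, mem_insert_iff,
      mem_singleton_iff]
    rintro ⟨rfl | rfl, h | h⟩ <;> simp_all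
  have hvS : v ∈ K.space := SimplicialComplex.vertices_subset_space hv
  have hle : F.card ≤ 2 := by
    by_contra! h
    obtain ⟨s, hs, t, ht, u, hu, hst, hsu, htu⟩ := Finset.two_lt_card.1 h
    have h1 := meet s hs t ht hst
    have h2 := meet s hs u hu hsu
    have h3 := meet t ht u hu htu
    obtain ⟨a, ha, -, ha', ea⟩ := edge s hs
    obtain ⟨b, hb, -, hb', eb⟩ := edge t ht
    obtain ⟨c, hc, -, hc', ec⟩ := edge u hu
    rw [ea, eb] at h1
    rw [ea, ec] at h2
    rw [eb, ec] at h3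
    exact hS.no_tripod ha' hb' hc' ha hb hc h1 h2 h3
  -- The open star of `v`: with all faces away from `v` removed, the curve is contained in the union
  -- of `{v}` and the edges at `v`.
  let N : Set E := (⋃ s ∈ {s ∈ K.faces | v ∉ s}, convexHull ℝ (s : Set E))ᶜ
  have hN : IsOpen N := by
    refine (Finite.isClosed_biUnion (hK.subset (sep_subset _ _)) fun s _ => ?_).isOpen_compl
    exact (s.finite_toSet.isCompact_convexHull ℝ).isClosed
  have hvN : v ∈ N := by
    simp only [N, mem_compl_iff, mem_iUnion, not_exists]
    exact fun s hs h => hs.2 ((SimplicialComplex.vertex_mem_convexHull_iff hv hs.1).1 h)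
  have hSN : ∀ x ∈ K.space ∩ N, x = v ∨ ∃ s ∈ F, x ∈ convexHull ℝ (s : Set E) := by
    rintro x ⟨hx, hxN⟩
    obtain ⟨s, hs, hxs⟩ := SimplicialComplex.mem_space_iff.1 hx
    have hvs : v ∈ s := by
      by_contra h
      exact hxN (mem_biUnion (show s ∈ {s ∈ K.faces | v ∉ s} from ⟨hs, h⟩) hxs)
    have hc := card_face_le_two hS hs
    have hc0 := (K.nonempty_of_mem_faces hs).card_pos
    rcases (by omega : s.card = 1 ∨ s.card = 2) with h | h
    · obtain ⟨y, rfl⟩ := Finset.card_eq_one.1 h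
      rw [Finset.mem_singleton] at hvs
      subst hvs
      left; simpa using hxs
    · exact .inr ⟨s, memF.2 ⟨hs, h, hvs⟩, hxs⟩
  -- No edge would make `v` isolated; one edge makes the curve near `v` part of a segment ending
  -- there, so `v` is a boundary point; two edges make `v` an inner point of an arc.
  rcases (by omega : F.card = 0 ∨ F.card = 1 ∨ F.card = 2) with h | h | h
  · refine (hS.not_isolated hvS hN hvN fun x hx => ?_).elim
    rcases hSN x hx with h' | ⟨s, hs, -⟩
    · exact h'
    · rw [Finset.card_eq_zero.1 h] at hs; simp at hs
  · obtain ⟨s, hs⟩ := Finset.card_eq_one.1 h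
    obtain ⟨w, hw, -, -, ew⟩ := edge s (by simp [hs])
    rw [h, if_pos]
    refine hS.mem_boundary hvS hN hvN (a := w) fun x hx => ?_
    rcases hSN x hx with rfl | ⟨t, ht, hxt⟩
    · exact left_mem_segment ℝ _ _
    · rw [hs, Finset.mem_singleton] at ht
      rwa [ht, ew] at hxt
  · obtain ⟨s, hs, t, ht, hst⟩ := Finset.one_lt_card.1 (by omega : 1 < F.card)
    have h1 := meet s hs t ht hst
    obtain ⟨a, ha, -, ha', ea⟩ := edge s hs
    obtain ⟨b, hb, -, hb', eb⟩ := edge t ht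
    rw [ea, eb] at h1
    rw [h, if_neg]
    exact hS.notMem_boundary ha' hb' ha hb h1

-- The smallest face containing a boundary point is a vertex or an edge. In an edge the point would
-- be different from both ends and so inside an arc.
open Geometry in
theorem IsCurve.boundary_subset_vertices {K : SimplicialComplex ℝ E} (hS : IsCurve K.space D)
    {v : E} (hv : v ∈ D) : {v} ∈ K.faces := by
  classical
  obtain ⟨s, hs, hvs⟩ := SimplicialComplex.mem_space_iff.1 (hS.1 hv)
  obtain ⟨t, ht, -, hvt, hmin⟩ := exists_mem_openFace hs hvs
  have hc := card_face_le_two hS ht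
  have hc0 := (K.nonempty_of_mem_faces ht).card_pos
  rcases (by omega : t.card = 1 ∨ t.card = 2) with h | h
  · obtain ⟨y, rfl⟩ := Finset.card_eq_one.1 h
    rw [Finset.coe_singleton, convexHull_singleton] at hvt
    rwa [mem_singleton_iff.1 hvt]
  · obtain ⟨u, w, huw, rfl⟩ := Finset.card_eq_two.1 h
    have hsp := SimplicialComplex.convexHull_subset_space ht
    have ne : ∀ z ∈ ({u, w} : Finset E), z ≠ v := by
      rintro z hz rfl
      have hzs : ({z} : Finset E) ⊂ {u, w} := by
        refine (Finset.singleton_subset_iff.2 hz).ssubset_of_ne fun h' => ?_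
        rw [← h', Finset.card_singleton] at h; omega
      exact hmin {z} (K.down_closed ht hzs.subset (by simp)) hzs (by simp)
    have hu := ne u (by simp)
    have hw := ne w (by simp)
    rw [Finset.coe_pair, convexHull_pair] at hvt hsp
    refine (hS.notMem_boundary (((convex_segment u w).segment_subset hvt
      (left_mem_segment ℝ u w)).trans hsp) (((convex_segment u w).segment_subset hvt
      (right_mem_segment ℝ u w)).trans hsp) hu hw
      (segment_inter_segment_subset hvt hu.symm hw.symm) hv).elim

/-- The Euler characteristic of a compact polygonal curve is half the number of its end points. -/
theorem IsCurve.hasEuler [FiniteDimensional ℝ E] {P : Set E} (hP : IsPolyhedron P) {B : Finset E}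
    (hS : IsCurve P B) : ∃ n, HasEuler P n ∧ 2 * n = B.card := by
  classical
  obtain ⟨K, hK, rfl⟩ := hP.exists_triangulation
  refine ⟨_, hasEuler_space hK, ?_⟩
  rw [finsum_mem_eq_finite_toFinset_sum _ hK]
  set F := hK.toFinset with hF
  have memF : ∀ {s}, s ∈ F ↔ s ∈ K.faces := by simp [hF]
  set F2 := {s ∈ F | s.card = 2} with hF2
  set V := F.biUnion id with hV
  have memV : ∀ {v}, v ∈ V ↔ {v} ∈ K.faces := by
    intro v
    simp only [hV, Finset.mem_biUnion, memF, id]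
    exact ⟨fun ⟨s, hs, hvs⟩ => K.down_closed hs (by simpa using hvs) (by simp),
      fun h => ⟨_, h, by simp⟩⟩
  have hF1 : {s ∈ F | ¬ s.card = 2} = V.image fun v => {v} := by
    ext s
    simp only [Finset.mem_filter, memF, Finset.mem_image, memV]
    constructor
    · rintro ⟨hs, h2⟩
      have hc := card_face_le_two hS hs
      have hc0 := (K.nonempty_of_mem_faces hs).card_pos
      obtain ⟨y, rfl⟩ := Finset.card_eq_one.1 (by omega : s.card = 1)
      exact ⟨y, hs, rfl⟩
    · rintro ⟨y, hy, rfl⟩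
      exact ⟨hy, by simp⟩
  have hsum : ∑ s ∈ F, (-1 : ℤ) ^ (s.card - 1) = V.card - F2.card := by
    rw [← Finset.sum_filter_add_sum_filter_not F (fun s => s.card = 2), hF1,
      Finset.sum_image (fun x _ y _ h => Finset.singleton_injective h),
      Finset.sum_congr rfl (g := fun _ => (-1 : ℤ)) (fun s hs => by
        rw [(Finset.mem_filter.1 hs).2]; norm_num)]
    simp only [Finset.sum_const, Finset.card_singleton, hF2]
    simp; ring
  have hcount : ∑ v ∈ V, {s ∈ F2 | v ∈ s}.card = ∑ s ∈ F2, {v ∈ V | v ∈ s}.card :=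
    Finset.sum_card_bipartiteAbove_eq_sum_card_bipartiteBelow (fun v s => v ∈ s)
  have h2 : ∑ s ∈ F2, {v ∈ V | v ∈ s}.card = 2 * F2.card := by
    rw [Finset.sum_congr rfl (g := fun _ => 2), Finset.sum_const, smul_eq_mul, mul_comm]
    intro s hs
    obtain ⟨hsF, hs2⟩ := Finset.mem_filter.1 hs
    rw [← hs2]
    congr 1
    ext v
    simp only [Finset.mem_filter, and_iff_right_iff_imp]
    exact fun hv => Finset.mem_biUnion.2 ⟨s, hsF, hv⟩
  have h1 : ∀ v ∈ V, {s ∈ F2 | v ∈ s}.card = if v ∈ B then 1 else 2 := fun v hv => by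
    have := vertex_degree hK hS (memV.1 hv)
    simp only [Finset.mem_coe] at this
    rw [← this, hF2, Finset.filter_filter]
  -- The handshake count reads `|B| + 2 (|V| - |B|) = 2 |F2|`, that is `2 (|V| - |F2|) = |B|`.
  rw [h2, Finset.sum_congr rfl h1, Finset.sum_ite] at hcount
  have hB : {v ∈ V | v ∈ B} = B := by
    ext v
    simp only [Finset.mem_filter, and_iff_right_iff_imp]
    exact fun hv => memV.2 (hS.boundary_subset_vertices hv)
  have hVc := Finset.card_filter_add_card_filter_not (s := V) (fun v => v ∈ B)
  simp only [hB, Finset.sum_const, smul_eq_mul] at hcount hVc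
  rw [hsum]
  omega

end curve
end PL

namespace Khovanov
open PL

variable {W : Set Plane} {B : Finset Plane}

/-! Additivity of the degree -/

/-- Besides the value of a smoothing this shows that `|B|` is even, so the integer division in the
degree is exact. -/
theorem Smoothing.exists_hasEuler (O : Smoothing W B) :
    ∃ n, HasEuler O.carrier n ∧ 2 * n = B.card :=
  O.isCurve.hasEuler O.isPolyhedron

theorem Cobordism.hasEuler {O O' : Smoothing W B} (C : Cobordism O O') :
    HasEuler C.carrier (C.degree + (B.card : ℤ) / 2) := by
  rw [degree, sub_add_cancel]
  exact C.isPolyhedron.hasEuler_eulerChar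

theorem Cobordism.degree_eq {O O' : Smoothing W B} (C : Cobordism O O') {n : ℤ}
    (h : HasEuler C.carrier n) : C.degree = n - (B.card : ℤ) / 2 := by
  have := h.unique C.hasEuler; omega

/-- Only the final map of the isotopy is needed: it is piecewise linear and injective on the
cylinder. -/
theorem Isotopic.hasEuler {A A' : Set Space} (h : Isotopic W A A') (hA : A ⊆ cyl W) {n : ℤ}
    (hn : HasEuler A n) : HasEuler A' n := by
  obtain ⟨H, rfl⟩ := h
  have one : (1 : ℝ) ∈ Icc (0 : ℝ) 1 := by simp
  exact hn.image_pl (H.isPLOn 1 one) hA ((H.bijOn 1 one).injOn.mono hA)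

theorem Cobordism.degree_eq_of_isotopic {O O' : Smoothing W B} {C C' : Cobordism O O'}
    (h : Isotopic W C.carrier C'.carrier) : C.degree = C'.degree := by
  rw [C'.degree_eq (h.hasEuler C.subset C.hasEuler), add_sub_cancel_right]

theorem Cobordism.degree_id (O : Smoothing W B) : (Cobordism.id O).degree = 0 := by
  obtain ⟨n, hn, h2⟩ := O.exists_hasEuler
  rw [(Cobordism.id O).degree_eq (hn.prod_Icc zero_le_one)]
  omega

theorem hasEuler_squeeze {A : Set Space} {n : ℤ} (h : HasEuler A n) {a b : ℝ} (hab : a < b) :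
    HasEuler (squeeze a b '' A) n := by
  let L : Space →ᵃ[ℝ] Space := (LinearMap.fst ℝ Plane ℝ).toAffineMap.prod
    (AffineMap.const ℝ Space a + (b - a) • (LinearMap.snd ℝ Plane ℝ).toAffineMap)
  exact h.image_affine L (continuous_squeeze a b) (squeezeHomeo hab).injective.injOn

/-- The two halves overlap in a copy of the middle smoothing. Inclusion-exclusion subtracts its
value `|B| / 2`, so of the two corrections contained in the degrees exactly one remains. -/
theorem Cobordism.degree_comp {O O' O'' : Smoothing W B} (C : Cobordism O O')
    (D : Cobordism O' O'') : (C.comp D).degree = C.degree + D.degree := by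
  obtain ⟨n, hn, h2⟩ := O'.exists_hasEuler
  have hlt : (0 : ℝ) < 1 / 2 := by norm_num
  have hlt' : (1 / 2 : ℝ) < 1 := by norm_num
  -- The middle level is written as a degenerate interval so that the product formula applies to it.
  -- The collars show that both halves meet this level in `O'`.
  have hinter : squeeze 0 (1 / 2) '' C.carrier ∩ squeeze (1 / 2) 1 '' D.carrier =
      O'.carrier ×ˢ Icc (1 / 2 : ℝ) (1 / 2) := by
    obtain ⟨ε, h0, h1, -, hC⟩ := C.exists_collar
    obtain ⟨δ, h0', h1', hD, -⟩ := D.exists_collar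
    ext ⟨x, t⟩
    have e1 : unsqueeze 0 (1 / 2) (x, t) = (x, 2 * t) := by
      rw [unsqueeze_apply]; ext <;> simp
    have e2 : unsqueeze (1 / 2) 1 (x, t) = (x, 2 * t - 1) := by
      rw [unsqueeze_apply]; ext <;> simp; ring
    rw [mem_inter_iff, mem_squeeze_image hlt, mem_squeeze_image hlt', e1, e2, Icc_self]
    constructor
    · rintro ⟨h, h'⟩
      have ht : t = 1 / 2 := by linarith [(C.height h).2, (D.height h').1]
      subst ht
      exact ⟨((hC x _ (by linarith)).1 h).1, rfl⟩
    · rintro ⟨hx, ht⟩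
      obtain rfl : t = 1 / 2 := ht
      exact ⟨(hC x _ (by linarith)).2 ⟨hx, by norm_num⟩, (hD x _ (by linarith)).2 ⟨hx, by norm_num⟩⟩
  have h := (hasEuler_squeeze C.hasEuler hlt).union_of_inter (hasEuler_squeeze D.hasEuler hlt')
    (hinter ▸ hn.prod_Icc le_rfl)
  rw [(C.comp D).degree_eq h]
  omega

/-- With `e` the set of all end points on the input disks, the curtains have value `(|B| + |e|) /
2`, the inserted cobordisms together have value `∑ deg + |e| / 2`, and the overlap consists of
vertical lines over `e` and has value `|e|`. The terms in `e` cancel. -/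
theorem PlanarArcDiagram.degree_map {n : ℕ} (D : PlanarArcDiagram W B n)
    {O O' : ∀ i, Smoothing (D.inputDisk i) (D.ends i)} (C : ∀ i, Cobordism (O i) (O' i)) :
    (D.map C).degree = ∑ i, (C i).degree := by
  classical
  set e : Finset Plane := Finset.univ.biUnion D.ends with he
  have mem_e : ∀ {x}, x ∈ e ↔ ∃ i, x ∈ D.ends i := by simp [he]
  have hcurve : IsCurve D.curves ((B ∪ e : Finset Plane) : Set Plane) := by
    have := D.isCurve
    rwa [show (B : Set Plane) ∪ ⋃ i, (D.ends i : Set Plane) =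
      ((B ∪ e : Finset Plane) : Set Plane) by
      rw [Finset.coe_union, he, Finset.coe_biUnion]; simp] at this
  obtain ⟨k, hk, hk2⟩ := hcurve.hasEuler D.isPolyhedron
  have hBe : Disjoint B e := by
    rw [Finset.disjoint_left]
    intro x hx hxe
    obtain ⟨i, hi⟩ := mem_e.1 hxe
    exact D.notMem_boundary ((D.ends_iff i x).1 hi).2 hx
  have hecard : e.card = ∑ i, (D.ends i).card := Finset.card_biUnion fun i _ j _ hij => by
    rw [Function.onFun, Finset.disjoint_left]
    intro x hi hj
    exact hij (D.eq_of_mem ((D.ends_iff i x).1 hi).2 ((D.ends_iff j x).1 hj).2)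
  rw [Finset.card_union_of_disjoint hBe] at hk2
  have hunion := HasEuler.iUnion Finset.univ (fun i _ => (C i).hasEuler) (by
    intro i _ j _ hij
    rw [Function.onFun, disjoint_left]
    intro x hi hj
    exact hij (D.eq_of_mem ((C i).subset hi).1 ((C j).subset hj).1))
  have hunion' : (⋃ i ∈ Finset.univ, (C i).carrier) = ⋃ i, (C i).carrier := by simp
  rw [hunion'] at hunion
  have hinter : D.curves ×ˢ Icc (0 : ℝ) 1 ∩ ⋃ i, (C i).carrier =
      (e : Set Plane) ×ˢ Icc (0 : ℝ) 1 := by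
    ext ⟨x, t⟩
    simp only [mem_inter_iff, mem_prod, mem_iUnion, Finset.mem_coe, mem_e]
    constructor
    · rintro ⟨⟨hx, ht⟩, i, hi⟩
      exact ⟨⟨i, (D.ends_iff i x).2 ⟨hx, ((C i).subset hi).1⟩⟩, ht⟩
    · rintro ⟨⟨i, hi⟩, ht⟩
      exact ⟨⟨((D.ends_iff i x).1 hi).1, ht⟩, i, (C i).isSurface.1 (.inl (.inr ⟨hi, ht⟩))⟩
  have h := (hk.prod_Icc zero_le_one).union_of_inter hunion
    (hinter ▸ (HasEuler.finset e).prod_Icc zero_le_one)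
  -- Halving is compatible with the sum over the input disks because each of them carries a
  -- smoothing, so each number of end points is even.
  have heven : ∀ i, ((D.ends i).card : ℤ) = 2 * (((D.ends i).card : ℤ) / 2) := fun i => by
    obtain ⟨m, -, hm⟩ := (O i).exists_hasEuler
    omega
  have hsum : (e.card : ℤ) = 2 * ∑ i, ((D.ends i).card : ℤ) / 2 := by
    rw [hecard, Nat.cast_sum, Finset.mul_sum]
    exact Finset.sum_congr rfl fun i _ => heven i
  rw [(D.map C).degree_eq h, Finset.sum_add_distrib]
  push_cast at hk2
  omega

/-! Homogeneity of the local relations -/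

/-- In the sup norm the circle is the boundary of a square: two vertical and two horizontal sides
overlapping in four corners, `2 + 2 - 4 = 0`. -/
theorem hasEuler_sphere (c : Plane) {r : ℝ} (hr : 0 < r) : HasEuler (Metric.sphere c r) 0 := by
  classical
  have pair : ∀ a : ℝ, HasEuler ({a - r, a + r} : Set ℝ) 2 := fun a => by
    have := HasEuler.finset ({a - r, a + r} : Finset ℝ)
    rw [Finset.card_pair (by linarith)] at this
    simpa using this
  have hI : ∀ a : ℝ, HasEuler (Icc (a - r) (a + r)) 1 := fun a =>
    .of_convex isCompact_Icc (convex_Icc _ _) (nonempty_Icc.2 (by linarith))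
  have h1 := (pair c.1).prod_Icc (a := c.2 - r) (b := c.2 + r) (by linarith)
  have corner : ∀ {A : Set ℝ} {n : ℤ}, HasEuler A n →
      HasEuler (A ×ˢ {c.2 - r, c.2 + r}) (n + n) := fun {A n} h => by
    have := (h.prod_Icc (le_refl (c.2 - r))).union (h.prod_Icc (le_refl (c.2 + r))) (by
      rw [disjoint_left]
      rintro x ⟨-, h⟩ ⟨-, h'⟩
      simp only [Icc_self, mem_singleton_iff] at h h'
      linarith)
    rwa [Icc_self, Icc_self, ← prod_union, ← insert_eq] at this
  have h2 := h1.union_of_inter (corner (hI c.1)) (k := 4) (by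
    rw [prod_inter_prod, inter_eq_left.2, inter_eq_right.2]
    · exact corner (pair c.1)
    · rintro x (rfl | rfl) <;> constructor <;> linarith
    · rintro x (rfl | rfl) <;> constructor <;> linarith)
  rw [show (2 : ℤ) + (1 + 1) - 4 = 0 by norm_num] at h2
  convert h2 using 1
  ext ⟨x, y⟩
  simp only [Metric.mem_sphere, Prod.dist_eq, Real.dist_eq, mem_union, mem_prod, mem_insert_iff,
    mem_singleton_iff, mem_Icc]
  have ex : |x - c.1| = r ↔ x = c.1 - r ∨ x = c.1 + r := by
    rw [abs_eq hr.le, or_comm, sub_eq_iff_eq_add, sub_eq_iff_eq_add]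
    constructor <;> rintro (h | h) <;> [left; right; left; right] <;> linarith
  have ey : |y - c.2| = r ↔ y = c.2 - r ∨ y = c.2 + r := by
    rw [abs_eq hr.le, or_comm, sub_eq_iff_eq_add, sub_eq_iff_eq_add]
    constructor <;> rintro (h | h) <;> [left; right; left; right] <;> linarith
  have lx : |x - c.1| ≤ r ↔ c.1 - r ≤ x ∧ x ≤ c.1 + r := by
    rw [abs_le]; constructor <;> rintro ⟨h, h'⟩ <;> constructor <;> linarith
  have ly : |y - c.2| ≤ r ↔ c.2 - r ≤ y ∧ y ≤ c.2 + r := by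
    rw [abs_le]; constructor <;> rintro ⟨h, h'⟩ <;> constructor <;> linarith
  rw [← ex, ← ey, ← lx, ← ly]
  constructor
  · intro h
    rcases max_choice |x - c.1| |y - c.2| with h' | h'
    · exact .inl ⟨h'.symm.trans h, (le_max_right _ _).trans h.le⟩
    · exact .inr ⟨(le_max_left _ _).trans h.le, h'.symm.trans h⟩
  · rintro (⟨h, h'⟩ | ⟨h, h'⟩)
    · rw [h, max_eq_left h']
    · rw [h', max_eq_right h]

theorem hasEuler_closedBall (c : Plane) {r : ℝ} (hr : 0 < r) :
    HasEuler (Metric.closedBall c r) 1 :=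
  .of_convex (isCompact_closedBall c r) (convex_closedBall c r) (Metric.nonempty_closedBall.2 hr.le)

/-- A closed disk minus an open one; the open disk, a closed disk without its circle, has value 1 as
well. -/
theorem hasEuler_annulus (c : Plane) {r R : ℝ} (hr : 0 < r) (hR : r < R) :
    HasEuler {p | r ≤ dist p c ∧ dist p c ≤ R} 0 := by
  have h := (hasEuler_closedBall c (hr.trans hR)).sdiff
    ((hasEuler_closedBall c hr).sdiff (hasEuler_sphere c hr) Metric.sphere_subset_closedBall)
    (sdiff_subset.trans (Metric.closedBall_subset_closedBall hR.le))
  rw [show (1 : ℤ) - (1 - 0) = 0 by norm_num] at h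
  convert h using 1
  ext p
  simp only [mem_ofPred_eq, mem_sdiff, Metric.mem_closedBall, Metric.mem_sphere]
  constructor
  · rintro ⟨h1, h2⟩; exact ⟨h2, fun h => h.2 (le_antisymm h.1 h1)⟩
  · rintro ⟨h1, h2⟩
    refine ⟨?_, h1⟩
    by_contra! h
    exact h2 ⟨h.le, h.ne⟩

/-- Two cylindrical walls and two horizontal annuli overlap in four circles, and all of these have
value 0. -/
theorem hasEuler_stdTorus (c : Space) {r R h : ℝ} (hr : 0 < r) (hR : r < R) (hh : 0 < h) :
    HasEuler (stdTorus c r R h) 0 := by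
  have hS := (hasEuler_sphere c.1 hr).union (hasEuler_sphere c.1 (hr.trans hR)) (by
    rw [disjoint_left]
    intro p h1 h2
    rw [Metric.mem_sphere] at h1 h2
    linarith)
  have hA := hasEuler_annulus c.1 hr hR
  have ends : ∀ {A : Set Plane}, HasEuler A 0 → HasEuler (A ×ˢ {c.2 - h, c.2 + h}) 0 :=
    fun {A} hA => by
      have := (hA.prod_Icc (le_refl (c.2 - h))).union (hA.prod_Icc (le_refl (c.2 + h))) (by
        rw [disjoint_left]
        rintro x ⟨-, h⟩ ⟨-, h'⟩
        simp only [Icc_self, mem_singleton_iff] at h h'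
        linarith)
      rwa [Icc_self, Icc_self, ← prod_union, ← insert_eq, add_zero] at this
  have h2 := (hS.prod_Icc (a := c.2 - h) (b := c.2 + h) (by linarith)).union_of_inter (ends hA)
    (k := 0) (by
      rw [prod_inter_prod, inter_eq_left.2, inter_eq_right.2]
      · exact ends hS
      · rintro x (rfl | rfl) <;> constructor <;> linarith
      · rintro p (hp | hp) <;> rw [Metric.mem_sphere] at hp <;>
          exact ⟨by linarith, by linarith⟩)
  rw [show (0 : ℤ) + 0 + 0 - 0 = 0 by norm_num] at h2
  convert h2 using 1
  ext ⟨x, t⟩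
  simp only [stdTorus, mem_ofPred_eq, mem_union, mem_prod, Metric.mem_sphere, mem_Icc,
    mem_insert_iff, mem_singleton_iff]
  have et : |t - c.2| = h ↔ t = c.2 - h ∨ t = c.2 + h := by
    rw [abs_eq hh.le, or_comm]
    constructor <;> rintro (h | h) <;> [left; right; left; right] <;> linarith
  have lt : |t - c.2| ≤ h ↔ c.2 - h ≤ t ∧ t ≤ c.2 + h := by
    rw [abs_le]; constructor <;> rintro ⟨h, h'⟩ <;> constructor <;> linarith
  rw [← et, ← lt]
  constructor
  · rintro ⟨h1, h2, h3, h4 | h4 | h4⟩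
    · exact .inl ⟨.inl h4, h3⟩
    · exact .inl ⟨.inr h4, h3⟩
    · exact .inr ⟨⟨h1, h2⟩, h4⟩
  · rintro (⟨h1 | h1, h3⟩ | ⟨⟨h1, h2⟩, h4⟩)
    · exact ⟨h1.ge, by linarith, h3, .inl h1⟩
    · exact ⟨by linarith, h1.le, h3, .inr (.inl h1)⟩
    · exact ⟨h1, h2, h4.le, .inr (.inr h4)⟩

/-- The component is the difference of two polyhedra with known values, so it has a value without
being shown to be a polyhedron itself. By isotopy invariance that value is the one of the torus. -/
theorem Cobordism.degree_sdiff_torus {O O' : Smoothing W B} {C C' : Cobordism O O'} {p : Space}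
    (hT : IsIsotopicToTorus W (connectedComponentIn C.carrier p))
    (h : C'.carrier = C.carrier \ connectedComponentIn C.carrier p) : C.degree = C'.degree := by
  obtain ⟨c, r, R, k, hr, hR, hk, -, hiso⟩ := hT
  have hsub := connectedComponentIn_subset C.carrier p
  have hcomp : connectedComponentIn C.carrier p = C.carrier \ C'.carrier := by
    rw [h, sdiff_sdiff_cancel_left hsub]
  have h1 := C.hasEuler.sdiff C'.hasEuler (h ▸ sdiff_subset)
  rw [← hcomp] at h1
  have h2 := (hiso.hasEuler (hsub.trans C.subset) h1).unique (hasEuler_stdTorus c hr hR hk)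
  linarith

/-! ### The model disks and tubes of the four-tube relation -/

theorem abs_le_of_dist_le {p q : Space} {r : ℝ} (h : dist p q ≤ r) :
    |p.1.1 - q.1.1| ≤ r ∧ |p.1.2 - q.1.2| ≤ r ∧ |p.2 - q.2| ≤ r := by
  rw [Prod.dist_eq, Prod.dist_eq, max_le_iff, max_le_iff] at h
  exact ⟨h.1.1, h.1.2, h.2⟩

/-- Half the surface of a cube is a cylindrical wall of height 1 and a square lid, overlapping in
the circle around the lid: `0 + 1 - 0 = 1`. -/
theorem hasEuler_modelDisk (i : Fin 4) : HasEuler (modelDisk i) 1 := by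
  have key : ∀ (x : Plane) (a b m : ℝ), a ≤ b → (m = a ∨ m = b) →
      HasEuler (Metric.sphere x 1 ×ˢ Icc a b ∪ Metric.closedBall x 1 ×ˢ {m}) 1 := by
    intro x a b m hab hm
    have hS := hasEuler_sphere x one_pos
    have h := (hS.prod_Icc hab).union_of_inter
      ((hasEuler_closedBall x one_pos).prod_Icc (le_refl m)) (k := 0) (by
        rw [prod_inter_prod, inter_eq_left.2 Metric.sphere_subset_closedBall, inter_eq_right.2]
        · exact hS.prod_Icc le_rfl
        · rw [Icc_self, singleton_subset_iff]
          rcases hm with rfl | rfl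
          exacts [left_mem_Icc.2 hab, right_mem_Icc.2 hab])
    simpa using h
  have hx : (modelCenter i).1 = (-2, 0) ∨ (modelCenter i).1 = (2, 0) := by
    fin_cases i <;> simp [modelCenter]
  -- The side walls of the model ball are far from the disks, so intersecting with the ball
  -- restricts the height only.
  have hx' : ∀ x : Plane, dist x (modelCenter i).1 ≤ 1 → dist x 0 ≤ 4 := fun x h => by
    refine (dist_triangle x (modelCenter i).1 0).trans ?_
    have : dist (modelCenter i).1 0 ≤ 2 := by
      rcases hx with h | h <;> rw [h, Prod.dist_eq] <;> norm_num [Real.dist_eq]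
    linarith
  have hmem : ∀ (x : Plane) (t : ℝ), (x, t) ∈ modelDisk i ↔
      max (dist x (modelCenter i).1) |t - (modelCenter i).2| = 1 ∧ |t| ≤ 4 := fun x t => by
    simp only [modelDisk, modelBall, mem_inter_iff, Metric.mem_sphere, Metric.mem_closedBall]
    rw [Prod.dist_eq, Prod.dist_eq (y := 0), max_le_iff]
    simp only [Prod.fst_zero, Prod.snd_zero, Real.dist_eq, sub_zero]
    constructor
    · rintro ⟨h1, -, h2⟩; exact ⟨h1, h2⟩
    · rintro ⟨h1, h2⟩; exact ⟨h1, hx' x (h1 ▸ le_max_left _ _), h2⟩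
  have hz : (modelCenter i).2 = -4 ∨ (modelCenter i).2 = 4 := by
    fin_cases i <;> simp [modelCenter]
  generalize (modelCenter i).1 = q at hmem
  rcases hz with h | h <;> rw [h] at hmem
  · convert key q (-4) (-3) (-3) (by norm_num) (.inr rfl) using 1
    ext ⟨x, t⟩
    rw [hmem]
    simp only [mem_union, mem_prod, Metric.mem_sphere, Metric.mem_closedBall, mem_Icc,
      mem_singleton_iff, abs_le]
    constructor
    · rintro ⟨h1, h2, h3⟩
      have h4 : |t - -4| ≤ 1 := h1 ▸ le_max_right _ _
      have h5 : dist x q ≤ 1 := h1 ▸ le_max_left _ _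
      rw [abs_of_nonneg (by linarith)] at h1 h4
      rcases max_choice (dist x q) (t - -4) with h' | h' <;> rw [h'] at h1
      · exact .inl ⟨h1, h2, by linarith⟩
      · exact .inr ⟨h5, by linarith⟩
    · rintro (⟨h1, h2, h3⟩ | ⟨h1, rfl⟩)
      · refine ⟨?_, h2, by linarith⟩
        rw [abs_of_nonneg (by linarith), h1, max_eq_left (by linarith)]
      · norm_num; exact h1
  · convert key q 3 4 3 (by norm_num) (.inl rfl) using 1
    ext ⟨x, t⟩
    rw [hmem]
    simp only [mem_union, mem_prod, Metric.mem_sphere, Metric.mem_closedBall, mem_Icc,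
      mem_singleton_iff, abs_le]
    constructor
    · rintro ⟨h1, h2, h3⟩
      have h4 : |t - 4| ≤ 1 := h1 ▸ le_max_right _ _
      have h5 : dist x q ≤ 1 := h1 ▸ le_max_left _ _
      rw [abs_of_nonpos (by linarith)] at h1 h4
      rcases max_choice (dist x q) (-(t - 4)) with h' | h' <;> rw [h'] at h1
      · exact .inl ⟨h1, by linarith, h3⟩
      · exact .inr ⟨h5, by linarith⟩
    · rintro (⟨h1, h2, h3⟩ | ⟨h1, rfl⟩)
      · refine ⟨?_, by linarith, h3⟩
        rw [abs_of_nonpos (by linarith), h1, max_eq_left (by linarith)]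
      · norm_num; exact h1

/-- The centre of the horizontal section moves affinely with the height, so the tube is the image of
a straight cylinder under an injective affine shear. -/
theorem hasEuler_modelTube (i j : Fin 4) : HasEuler (modelTube i j) 0 := by
  have h := (hasEuler_sphere 0 one_pos).prod_Icc (show (-4 : ℝ) ≤ 4 by norm_num)
  let m : ℝ →ᵃ[ℝ] Plane := (AffineMap.lineMap (modelCenter i).1 (modelCenter j).1).comp
    ((1 / 8 : ℝ) • (AffineMap.id ℝ ℝ + AffineMap.const ℝ ℝ 4))
  have hm : ∀ t, m t = AffineMap.lineMap (modelCenter i).1 (modelCenter j).1 ((t + 4) / 8) :=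
    fun t => by
      show AffineMap.lineMap _ _ ((1 / 8 : ℝ) * (t + 4)) = _
      congr 1; ring
  let L : Space →ᵃ[ℝ] Space := ((LinearMap.fst ℝ Plane ℝ).toAffineMap +
    m.comp (LinearMap.snd ℝ Plane ℝ).toAffineMap).prod (LinearMap.snd ℝ Plane ℝ).toAffineMap
  have hL : ∀ p, L p = (p.1 + m p.2, p.2) := fun p => rfl
  have hinj : Function.Injective L := fun p q hpq => by
    rw [hL, hL, Prod.mk.injEq] at hpq
    have h2 := hpq.2
    rw [h2, add_left_inj] at hpq
    exact Prod.ext hpq.1 h2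
  convert h.image_affine L L.continuous_of_finiteDimensional hinj.injOn using 1
  ext ⟨x, t⟩
  simp only [modelTube, mem_ofPred_eq, ← hm, mem_image, mem_prod, hL, Metric.mem_sphere]
  constructor
  · rintro ⟨h1, h2⟩
    exact ⟨(x - m t, t), ⟨by rwa [dist_zero_right, ← dist_eq_norm], h1⟩, by simp⟩
  · rintro ⟨⟨y, s⟩, ⟨h1, h2⟩, h3⟩
    simp only [Prod.mk.injEq] at h3
    obtain ⟨rfl, rfl⟩ := h3
    exact ⟨h2, by simpa using h1⟩

theorem mem_modelDisk_bounds {k : Fin 4} {p : Space} (h : p ∈ modelDisk k) :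
    |p.1.1 - (modelCenter k).1.1| ≤ 1 ∧ |p.2 - (modelCenter k).2| ≤ 1 := by
  have := abs_le_of_dist_le (Metric.mem_sphere.1 h.1).le
  exact ⟨this.1, this.2.2⟩

theorem disjoint_modelDisk {i j : Fin 4} (hij : i ≠ j) : Disjoint (modelDisk i) (modelDisk j) := by
  rw [disjoint_left]
  intro p hi hj
  have h1 := mem_modelDisk_bounds hi
  have h2 := mem_modelDisk_bounds hj
  simp only [abs_le] at h1 h2
  fin_cases i <;> fin_cases j <;> first
    | exact hij rfl
    | (simp [modelCenter] at h1 h2; linarith)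

theorem mem_modelTube_bounds {i j : Fin 4} {p : Space} (h : p ∈ modelTube i j) :
    -4 ≤ p.2 ∧ p.2 ≤ 4 ∧ |p.1.1 - ((modelCenter i).1.1 +
      ((modelCenter j).1.1 - (modelCenter i).1.1) * ((p.2 + 4) / 8))| ≤ 1 ∧ |p.1.2| ≤ 1 := by
  obtain ⟨h1, h2⟩ := h
  have h3 : ∀ k, (modelCenter k).1.2 = 0 := fun k => by fin_cases k <;> simp [modelCenter]
  have h4 := h2.le
  rw [Prod.dist_eq, max_le_iff, Real.dist_eq, Real.dist_eq] at h4
  simp only [AffineMap.lineMap_apply_module', Prod.fst_add, Prod.snd_add, Prod.smul_fst,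
    Prod.smul_snd, Prod.fst_sub, Prod.snd_sub, h3, smul_eq_mul, sub_self, mul_zero, add_zero,
    sub_zero] at h4
  refine ⟨h1.1, h1.2, ?_, h4.2⟩
  rw [mul_comm, add_comm]
  exact h4.1

theorem modelTube_subset (i j : Fin 4) : modelTube i j ⊆ modelBall := fun p hp => by
  obtain ⟨h1, h2, h3, h4⟩ := mem_modelTube_bounds hp
  rw [modelBall, Metric.mem_closedBall, Prod.dist_eq, Prod.dist_eq, max_le_iff, max_le_iff]
  simp only [Prod.fst_zero, Prod.snd_zero, Real.dist_eq, sub_zero, abs_le] at h3 h4 ⊢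
  have key : ∀ k, -2 ≤ (modelCenter k).1.1 ∧ (modelCenter k).1.1 ≤ 2 := fun k => by
    fin_cases k <;> simp [modelCenter]
  have hi := key i
  have hj := key j
  have h5 : 0 ≤ (p.2 + 4) / 8 := by linarith
  have h6 : (p.2 + 4) / 8 ≤ 1 := by linarith
  generalize (p.2 + 4) / 8 = s at *
  refine ⟨⟨⟨?_, ?_⟩, by linarith, by linarith⟩, h1, h2⟩ <;> nlinarith

/-- Replacing two disks by a tube lowers the Euler characteristic by two. -/
theorem hasEuler_tubed {A : Set Space} {n : ℤ} (hA : HasEuler A n) {φ : Space → Space}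
    (hφ : IsPLOn φ modelBall) (hφ' : InjOn φ modelBall)
    (hC : A ∩ φ '' modelBall = φ '' ⋃ i, modelDisk i) {i j : Fin 4} (hij : i ≠ j)
    (hd : ∀ k, k ≠ i → k ≠ j → Disjoint (modelDisk k) (modelTube i j)) :
    HasEuler (tubed φ A i j) (n - 2) := by
  have hdisk : ∀ k, modelDisk k ⊆ modelBall := fun k => inter_subset_right
  have h1 := ((hasEuler_modelDisk i).union (hasEuler_modelDisk j) (disjoint_modelDisk hij)).image_pl
    hφ (union_subset (hdisk i) (hdisk j)) (hφ'.mono (union_subset (hdisk i) (hdisk j)))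
  have h2 := (hasEuler_modelTube i j).image_pl hφ (modelTube_subset i j)
    (hφ'.mono (modelTube_subset i j))
  have hsub : φ '' (modelDisk i ∪ modelDisk j) ⊆ A := by
    refine (image_mono (union_subset ?_ ?_)).trans (hC ▸ inter_subset_left) <;>
      exact subset_iUnion _ _
  -- The disks are removed with their boundary circles, which the tube restores; hence the union is
  -- disjoint. Elsewhere in the ball `A` consists of the other two disks, which the tube avoids.
  have h3 := (hA.sdiff h1 hsub).union h2 (by
    rw [disjoint_left]
    rintro _ ⟨hpA, hp'⟩ ⟨p, hp, rfl⟩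
    have hpB := modelTube_subset i j hp
    have hp2 : φ p ∈ A ∩ φ '' modelBall := ⟨hpA, p, hpB, rfl⟩
    rw [hC] at hp2
    obtain ⟨q, hq, hqp⟩ := hp2
    obtain ⟨k, hk⟩ := mem_iUnion.1 hq
    obtain rfl := hφ' (hdisk k hk) hpB hqp
    refine disjoint_left.1 (hd k ?_ ?_) hk hp
    · rintro rfl; exact hp' ⟨q, .inl hk, rfl⟩
    · rintro rfl; exact hp' ⟨q, .inr hk, rfl⟩)
  rwa [add_zero, one_add_one_eq_two] at h3

/-- The first horizontal coordinate separates the two sets: for a straight tube everywhere, for a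
slanted one at heights within 1 of the face that carries the disk. Only the four tubes of the
relation are considered, each running from the bottom to the top. -/
theorem disjoint_modelDisk_modelTube {i j k : Fin 4}
    (h : (i = 0 ∧ j = 1) ∨ (i = 3 ∧ j = 2) ∨ (i = 0 ∧ j = 2) ∨ (i = 3 ∧ j = 1))
    (hi : k ≠ i) (hj : k ≠ j) : Disjoint (modelDisk k) (modelTube i j) := by
  rw [disjoint_left]
  intro p hk hp
  have h1 := mem_modelDisk_bounds hk
  have h2 := mem_modelTube_bounds hp
  simp only [abs_le] at h1 h2
  rcases h with ⟨rfl, rfl⟩ | ⟨rfl, rfl⟩ | ⟨rfl, rfl⟩ | ⟨rfl, rfl⟩ <;> fin_cases k <;> first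
    | exact hi rfl
    | exact hj rfl
    | (simp [modelCenter] at h1 h2; linarith)

theorem Cobordism.degree_tubed {O O' : Smoothing W B} {C C' : Cobordism O O'} {φ : Space → Space}
    (hφ : IsPLOn φ modelBall) (hφ' : InjOn φ modelBall)
    (hC : C.carrier ∩ φ '' modelBall = φ '' ⋃ i, modelDisk i) {i j : Fin 4}
    (h : (i = 0 ∧ j = 1) ∨ (i = 3 ∧ j = 2) ∨ (i = 0 ∧ j = 2) ∨ (i = 3 ∧ j = 1))
    (hC' : C'.carrier = tubed φ C.carrier i j) : C'.degree = C.degree - 2 := by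
  have hij : i ≠ j := by rcases h with ⟨rfl, rfl⟩ | ⟨rfl, rfl⟩ | ⟨rfl, rfl⟩ | ⟨rfl, rfl⟩ <;> decide
  have := hasEuler_tubed C.hasEuler hφ hφ' hC hij
    fun k hi hj => disjoint_modelDisk_modelTube h hi hj
  rw [C'.degree_eq (hC' ▸ this)]
  ring

theorem Cobordism.hom_mem_grading {O O' : Smoothing W B} (C : Cobordism O O') {d : ℤ}
    (h : C.degree = d) : C.hom ∈ Cob.grading (Free.of ℤ O) (Free.of ℤ O') d :=
  AddSubgroup.subset_closure ⟨C, h, rfl⟩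

/-- Removing a torus leaves the degree unchanged, and all four tubings have degree two less than the
surface they start from. For the sphere relation nothing about spheres is needed, since the relator
is a single cobordism. -/
theorem LocalRelator.exists_mem_grading {O O' : Smoothing W B}
    {r : Free.of ℤ O ⟶ Free.of ℤ O'} (hr : LocalRelator O O' r) :
    ∃ d : ℤ, r ∈ Cob.grading _ _ d := by
  cases hr with
  | S C p hp hS => exact ⟨_, C.hom_mem_grading rfl⟩
  | T C C' p hp hT h =>
    exact ⟨_, sub_mem (C.hom_mem_grading rfl)
      (zsmul_mem (C'.hom_mem_grading (Cobordism.degree_sdiff_torus hT h).symm) 2)⟩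
  | fourTu C C₁₂ C₃₄ C₁₃ C₂₄ φ hφ hφ' hφW hC h₁₂ h₃₄ h₁₃ h₂₄ =>
    have d12 := Cobordism.degree_tubed hφ hφ' hC (by simp) h₁₂
    have d34 := Cobordism.degree_tubed hφ hφ' hC (by simp) h₃₄
    have d13 := Cobordism.degree_tubed hφ hφ' hC (by simp) h₁₃
    have d24 := Cobordism.degree_tubed hφ hφ' hC (by simp) h₂₄
    exact ⟨C.degree - 2, sub_mem (sub_mem (add_mem (C₁₂.hom_mem_grading d12)
      (C₃₄.hom_mem_grading d34)) (C₁₃.hom_mem_grading d13)) (C₂₄.hom_mem_grading d24)⟩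

end Khovanov

namespace Khovanov
open PL

variable {W : Set Plane} {B : Finset Plane}

/-! Gradings -/

section components
variable {M N : Type*} [AddCommGroup M] [AddCommGroup N]

/-- A family of subgroups which span and admit projections to the components. -/
def HasComponents (A : ℤ → AddSubgroup M) : Prop :=
  (∀ f, f ∈ ⨆ d, A d) ∧
    ∃ π : ℤ → M →+ M, ∀ d, ∀ f ∈ A d, π d f = f ∧ ∀ e, e ≠ d → π e f = 0

/-- The projections recover the components of a sum, which gives injectivity; spanning gives
surjectivity. This form is preferred because projections pass directly to quotients. -/
theorem HasComponents.isInternal {A : ℤ → AddSubgroup M} (h : HasComponents A) :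
    DirectSum.IsInternal A := by
  classical
  obtain ⟨hs, π, hπ⟩ := h
  refine ⟨?_, ?_⟩
  · rw [injective_iff_map_eq_zero]
    intro x hx
    have key : ∀ (x : DirectSum ℤ fun d => A d) (d : ℤ),
        π d (DirectSum.coeAddMonoidHom A x) = x d := by
      intro x d
      induction x using DirectSum.induction_on with
      | zero => simp
      | of e f =>
        rw [DirectSum.coeAddMonoidHom_of]
        rcases eq_or_ne d e with rfl | hde
        · rw [(hπ d f f.2).1, DirectSum.of_eq_same]
        · rw [(hπ e f f.2).2 d hde, DirectSum.of_eq_of_ne _ _ _ hde]; rfl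
      | add x y hx hy => rw [map_add, map_add, hx, hy]; rfl
    ext d
    rw [← key, hx, map_zero]; rfl
  · intro f
    have : ⨆ d, A d ≤ (DirectSum.coeAddMonoidHom A).range := iSup_le fun d f hf =>
      ⟨DirectSum.of (fun d => A d) d ⟨f, hf⟩, DirectSum.coeAddMonoidHom_of _ _ _⟩
    exact this (hs f)

/-- Formal shifts of the objects only renumber the degrees of a Hom-group. -/
theorem HasComponents.comp {A : ℤ → AddSubgroup M} (h : HasComponents A) (e : ℤ ≃ ℤ) :
    HasComponents fun d => A (e d) := by
  obtain ⟨hs, π, hπ⟩ := h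
  refine ⟨fun f => by rw [e.iSup_comp (g := A)]; exact hs f, fun d => π (e d), fun d f hf => ?_⟩
  exact ⟨(hπ _ f hf).1, fun d' hd => (hπ _ f hf).2 _ (e.injective.ne hd)⟩

/-- The quotient by a subgroup generated by homogeneous elements is graded. -/
theorem HasComponents.map {A : ℤ → AddSubgroup M} (h : HasComponents A) {q : M →+ N}
    (hq : Function.Surjective q)
    (hker : ∀ f, q f = 0 → f ∈ AddSubgroup.closure {g | q g = 0 ∧ ∃ d, g ∈ A d}) :
    HasComponents fun d => (A d).map q := by
  obtain ⟨hs, π, hπ⟩ := h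
  -- The kernel is stable under the projections: on a homogeneous element of the kernel each
  -- projection is the identity or zero, and such elements generate it.
  have hd : ∀ d f, q f = 0 → q (π d f) = 0 := by
    intro d f hf
    refine AddSubgroup.closure_induction (p := fun f _ => q (π d f) = 0) ?_ (by simp)
      (fun x y _ _ hx hy => by rw [map_add, map_add, hx, hy, add_zero])
      (fun x _ hx => by rw [map_neg, map_neg, hx, neg_zero]) (hker f hf)
    rintro g ⟨hg, e, hge⟩
    rcases eq_or_ne d e with rfl | hde
    · rwa [(hπ d g hge).1]
    · rw [(hπ e g hge).2 d hde, map_zero]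
  refine ⟨fun f => ?_, fun d => q.liftOfSurjective hq ⟨q.comp (π d), fun f hf => hd d f hf⟩, ?_⟩
  · obtain ⟨f, rfl⟩ := hq f
    rw [← AddSubgroup.map_iSup]
    exact AddSubgroup.mem_map_of_mem q (hs f)
  · rintro d _ ⟨f, hf, rfl⟩
    have key : ∀ e, q.liftOfSurjective hq ⟨q.comp (π e), fun f hf => hd e f hf⟩ (q f) =
        q (π e f) := fun e => AddMonoidHom.liftOfRightInverse_comp_apply _ _ _ _ _
    refine ⟨by rw [key, (hπ d f hf).1], fun e he => by rw [key, (hπ d f hf).2 e he, map_zero]⟩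

end components

section shifted
variable {𝒞 : Type*} [Category 𝒞] [Preadditive 𝒞]

/-- A graded preadditive category, with formal shifts adjoined, is a graded category. -/
theorem isGradedCategory_shifted {gr : ∀ X Y : 𝒞, ℤ → AddSubgroup (X ⟶ Y)}
    (h : ∀ X Y, HasComponents (gr X Y))
    (hcomp : ∀ {X Y Z} {d e : ℤ} {f : X ⟶ Y} {g : Y ⟶ Z}, f ∈ gr X Y d → g ∈ gr Y Z e →
      f ≫ g ∈ gr X Z (d + e))
    (hid : ∀ X, 𝟙 X ∈ gr X X 0) :
    IsGradedCategory (𝒞 := Shifted 𝒞) (Shifted.grading gr) Shifted.shiftHom where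
  isInternal X Y := ((h X.obj Y.obj).comp
    ((Equiv.subRight Y.deg).trans (Equiv.addRight X.deg))).isInternal
  comp_mem {X Y Z d e f g} hf hg := by
    have := hcomp (X := X.obj) (Y := Y.obj) (Z := Z.obj) hf hg
    rw [show d - Y.deg + X.deg + (e - Z.deg + Y.deg) = d + e - Z.deg + X.deg by ring] at this
    exact this
  id_mem X := by
    show 𝟙 X.obj ∈ gr X.obj X.obj (0 - X.deg + X.deg)
    rw [zero_sub, neg_add_cancel]
    exact hid X.obj
  shiftHom_id _ _ := rfl
  shiftHom_comp _ _ := rfl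
  shiftHom_mem {m n X Y d f} hf := by
    show f ∈ gr X.obj Y.obj (d + n - m - (n + Y.deg) + (m + X.deg))
    rw [show d + n - m - (n + Y.deg) + (m + X.deg) = d - Y.deg + X.deg by ring]
    exact hf

end shifted

/-! ### The gradings of the cobordism category and of its quotient -/

/-- The degree of an isotopy class of cobordisms. -/
noncomputable def degreeClass {O O' : Smoothing W B} (f : O ⟶ O') : ℤ :=
  Quot.lift (fun C : Cobordism O O' => C.degree) (fun _ _ h => Cobordism.degree_eq_of_isotopic h) f

/-- A morphism is a finitely supported integer function on isotopy classes, and every class has a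
representative. Additive statements thus reduce to single cobordisms. -/
theorem mem_closure_hom {O O' : Smoothing W B} (f : Free.of ℤ O ⟶ Free.of ℤ O') :
    f ∈ AddSubgroup.closure (range fun C : Cobordism O O' => C.hom) := by
  let single (g : O ⟶ O') (n : ℤ) : Free.of ℤ O ⟶ Free.of ℤ O' := Finsupp.single g n
  refine Finsupp.induction_linear (M := ℤ) (motive := fun f : (O ⟶ O') →₀ ℤ =>
    Membership.mem (AddSubgroup.closure (range fun C : Cobordism O O' => C.hom)) f)
    f (zero_mem _) (fun f g hf hg => add_mem hf hg) ?_
  rintro ⟨C⟩ n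
  have h : single (Quot.mk _ C) n = n • C.hom :=
    (Finsupp.smul_single_one (Quot.mk _ C : O ⟶ O') n).symm
  show single (Quot.mk _ C) n ∈ _
  rw [h]
  exact zsmul_mem (AddSubgroup.subset_closure (mem_range_self C)) n

/-- The projection to the combinations of cobordisms of degree `d`. -/
noncomputable def degreePart (O O' : Smoothing W B) (d : ℤ) :
    (Free.of ℤ O ⟶ Free.of ℤ O') →+ (Free.of ℤ O ⟶ Free.of ℤ O') :=
  @Finsupp.filterAddHom (O ⟶ O') ℤ _ (fun g => degreeClass g = d) fun _ => Int.instDecidableEq _ _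

theorem degreePart_hom {O O' : Smoothing W B} (C : Cobordism O O') (d : ℤ) :
    degreePart O O' d C.hom = if C.degree = d then C.hom else 0 := by
  let a : O ⟶ O' := Quot.mk _ C
  have key : Finsupp.filter (fun g : O ⟶ O' => degreeClass g = d) (Finsupp.single a (1 : ℤ)) =
      if C.degree = d then Finsupp.single a (1 : ℤ) else 0 := by
    by_cases hd : C.degree = d
    · rw [if_pos hd]
      exact Finsupp.filter_single_of_pos _ hd
    · rw [if_neg hd]
      exact Finsupp.filter_single_of_neg _ hd
  exact key

/-- Isotopy classes form a basis and each has a well-defined degree, so the projections restrict a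
finitely supported function to the classes of the given degree. -/
theorem Cob.hasComponents (O O' : Smoothing W B) :
    HasComponents (Cob.grading (Free.of ℤ O) (Free.of ℤ O')) := by
  refine ⟨fun f => ?_, degreePart O O', fun d f hf => ?_⟩
  · refine (AddSubgroup.closure_le _).2 ?_ (mem_closure_hom f)
    rintro _ ⟨C, rfl⟩
    exact AddSubgroup.mem_iSup_of_mem C.degree (C.hom_mem_grading rfl)
  · refine AddSubgroup.closure_induction (p := fun f _ =>
      degreePart O O' d f = f ∧ ∀ e, e ≠ d → degreePart O O' e f = 0) ?_ ?_ ?_ ?_ hf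
    · rintro _ ⟨C, hC, rfl⟩
      exact ⟨(degreePart_hom C d).trans (if_pos hC), fun e he =>
        (degreePart_hom C e).trans (if_neg fun h => he (h.symm.trans hC))⟩
    · exact ⟨map_zero _, fun e _ => map_zero _⟩
    · rintro f g _ _ ⟨hf, hf'⟩ ⟨hg, hg'⟩
      exact ⟨by rw [map_add, hf, hg], fun e he => by rw [map_add, hf' e he, hg' e he, add_zero]⟩
    · rintro f _ ⟨hf, hf'⟩
      exact ⟨by rw [map_neg, hf], fun e he => by rw [map_neg, hf' e he, neg_zero]⟩

theorem Cobordism.hom_comp {O O' O'' : Smoothing W B} (C : Cobordism O O')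
    (D : Cobordism O' O'') : C.hom ≫ D.hom = (C.comp D).hom :=
  ((Free.embedding ℤ (Smoothing W B)).map_comp (X := O) (Y := O') (Z := O'')
    (Quot.mk _ C) (Quot.mk _ D)).symm

theorem Cob.comp_mem_grading {X Y Z : Cob W B} {d e : ℤ} {f : X ⟶ Y} {g : Y ⟶ Z}
    (hf : f ∈ Cob.grading X Y d) (hg : g ∈ Cob.grading Y Z e) :
    f ≫ g ∈ Cob.grading X Z (d + e) := by
  refine AddSubgroup.closure_induction (p := fun f _ => f ≫ g ∈ Cob.grading X Z (d + e))
    ?_ ?_ ?_ ?_ hf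
  · rintro _ ⟨C, hC, rfl⟩
    refine AddSubgroup.closure_induction
      (p := fun g _ => C.hom ≫ g ∈ Cob.grading X Z (d + e)) ?_ ?_ ?_ ?_ hg
    · rintro _ ⟨D, hD, rfl⟩
      exact AddSubgroup.subset_closure ⟨C.comp D,
        (C.degree_comp D).trans (by rw [hC, hD]), C.hom_comp D⟩
    · exact (Limits.comp_zero (f := C.hom)).symm ▸ zero_mem _
    · intro x y _ _ hx hy
      exact (Preadditive.comp_add _ _ _ C.hom x y).symm ▸ add_mem hx hy
    · intro x _ hx
      exact (Preadditive.comp_neg C.hom x).symm ▸ neg_mem hx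
  · rw [Limits.zero_comp]; exact zero_mem _
  · intro x y _ _ hx hy; rw [Preadditive.add_comp]; exact add_mem hx hy
  · intro x _ hx; rw [Preadditive.neg_comp]; exact neg_mem hx

theorem Cob.id_mem_grading (X : Cob W B) : 𝟙 X ∈ Cob.grading X X 0 :=
  AddSubgroup.subset_closure ⟨Cobordism.id (W := W) (B := B) X, Cobordism.degree_id X, rfl⟩

/-- The ideal of the local relations is generated, as a group, by homogeneous elements. -/
theorem mem_closure_homogeneous {X Y : Cob W B} {f : X ⟶ Y} (hf : f ∈ localIdeal X Y) :
    f ∈ AddSubgroup.closure {g | g ∈ localIdeal X Y ∧ ∃ d, g ∈ Cob.grading X Y d} := by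
  refine (AddSubgroup.closure_le _).2 ?_ hf
  rintro _ ⟨O, O', a, r, b, hr, rfl⟩
  obtain ⟨d, hd⟩ := hr.exists_mem_grading
  -- The outer factors `a` and `b` are expanded into cobordisms. Each resulting product is
  -- homogeneous because the relator in the middle is, and it remains in the ideal.
  refine AddSubgroup.closure_induction (p := fun a _ => a ≫ r ≫ b ∈ AddSubgroup.closure _)
    ?_ ?_ ?_ ?_ (mem_closure_hom (O := X) a)
  · rintro _ ⟨C, rfl⟩
    refine AddSubgroup.closure_induction (p := fun b _ => C.hom ≫ r ≫ b ∈ AddSubgroup.closure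
      {g | g ∈ localIdeal X Y ∧ ∃ d, g ∈ Cob.grading X Y d}) ?_ ?_ ?_ ?_
      (mem_closure_hom (O' := Y) b)
    · rintro _ ⟨D, rfl⟩
      exact AddSubgroup.subset_closure ⟨AddSubgroup.subset_closure ⟨O, O', _, r, _, hr, rfl⟩, _,
        Cob.comp_mem_grading (C.hom_mem_grading rfl)
          (Cob.comp_mem_grading hd (D.hom_mem_grading rfl))⟩
    · erw [Limits.comp_zero, Limits.comp_zero]; exact zero_mem _
    · intro x y _ _ hx hy
      erw [Preadditive.comp_add, Preadditive.comp_add]; exact add_mem hx hy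
    · intro x _ hx
      erw [Preadditive.comp_neg, Preadditive.comp_neg]; exact neg_mem hx
  · erw [Limits.zero_comp]; exact zero_mem _
  · intro x y _ _ hx hy; erw [Preadditive.add_comp]; exact add_mem hx hy
  · intro x _ hx; erw [Preadditive.neg_comp]; exact neg_mem hx

/-- The defining relation of the quotient is a congruence, so the morphisms that become zero are
exactly those of the ideal, and the ideal is generated by homogeneous elements. -/
theorem CobL.hasComponents (X Y : CobL W B) : HasComponents (CobL.grading X Y) := by
  refine (Cob.hasComponents X.as Y.as).map
    (q := (Quotient.functor (localRel W B)).mapAddHom (X := X.as) (Y := Y.as))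
    (fun f => (Quotient.functor (localRel W B)).map_surjective f) fun f hf => ?_
  have key : ∀ g : X.as ⟶ Y.as, (Quotient.functor (localRel W B)).map g = 0 ↔
      g ∈ localIdeal X.as Y.as := fun g => by
    rw [← (Quotient.functor (localRel W B)).map_zero, Quotient.functor_map_eq_iff]
    show g - 0 ∈ _ ↔ _
    rw [sub_zero]
  refine AddSubgroup.closure_mono ?_ (mem_closure_homogeneous ((key f).1 hf))
  rintro g ⟨hg, hd⟩
  exact ⟨(key g).2 hg, hd⟩

theorem CobL.comp_mem_grading {X Y Z : CobL W B} {d e : ℤ} {f : X ⟶ Y} {g : Y ⟶ Z}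
    (hf : f ∈ CobL.grading X Y d) (hg : g ∈ CobL.grading Y Z e) :
    f ≫ g ∈ CobL.grading X Z (d + e) := by
  obtain ⟨f, hf, rfl⟩ := hf
  obtain ⟨g, hg, rfl⟩ := hg
  exact ⟨f ≫ g, Cob.comp_mem_grading hf hg, (Quotient.functor (localRel W B)).map_comp f g⟩

theorem CobL.id_mem_grading (X : CobL W B) : 𝟙 X ∈ CobL.grading X X 0 :=
  ⟨𝟙 X.as, Cob.id_mem_grading X.as, (Quotient.functor (localRel W B)).map_id X.as⟩

end Khovanov

theorem mainTheorem2 (W : Set Khovanov.Plane) (hW : W = Set.univ ∨ Khovanov.IsDisk W)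
    (B : Finset Khovanov.Plane) (hB : (B : Set Khovanov.Plane) ⊆ frontier W) :
    -- the degree is well defined
    (∀ (O O' : Khovanov.Smoothing W B) (C : Khovanov.Cobordism O O'),
      (C.degree : ℚ) = (PL.eulerChar C.carrier : ℚ) - (B.card : ℚ) / 2 ∧
      (∃ K : Geometry.SimplicialComplex ℝ Khovanov.Space,
        K.faces.Finite ∧ K.space = C.carrier) ∧
      (∀ K : Geometry.SimplicialComplex ℝ Khovanov.Space,
        K.faces.Finite → K.space = C.carrier →
          PL.eulerChar C.carrier = ∑ᶠ s ∈ K.faces, (-1 : ℤ) ^ (s.card - 1)) ∧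
      ∀ C' : Khovanov.Cobordism O O', Khovanov.Isotopic W C.carrier C'.carrier →
        C.degree = C'.degree) ∧
    -- it is additive under vertical composition
    (∀ (O O' O'' : Khovanov.Smoothing W B) (C : Khovanov.Cobordism O O')
      (C' : Khovanov.Cobordism O' O''), (C.comp C').degree = C.degree + C'.degree) ∧
    -- it is additive under planar composition
    (∀ (n : ℕ) (D : Khovanov.PlanarArcDiagram W B n)
      (O O' : ∀ i, Khovanov.Smoothing (D.inputDisk i) (D.ends i))
      (C : ∀ i, Khovanov.Cobordism (O i) (O' i)), (D.map C).degree = ∑ i, (C i).degree) ∧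
    -- the local relations are homogeneous
    (∀ (O O' : Khovanov.Smoothing W B)
      (r : CategoryTheory.Free.of ℤ O ⟶ CategoryTheory.Free.of ℤ O'),
      Khovanov.LocalRelator O O' r → ∃ d : ℤ, r ∈ Khovanov.Cob.grading _ _ d) ∧
    -- the category and its quotient are graded categories
    Khovanov.IsGradedCategory (𝒞 := Khovanov.Shifted (Khovanov.Cob W B))
      (Khovanov.Shifted.grading Khovanov.Cob.grading) Khovanov.Shifted.shiftHom ∧
    Khovanov.IsGradedCategory (𝒞 := Khovanov.Shifted (Khovanov.CobL W B))
      (Khovanov.Shifted.grading Khovanov.CobL.grading) Khovanov.Shifted.shiftHom := by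
  refine ⟨fun O O' C => ⟨?_, C.isPolyhedron.exists_triangulation, ?_, fun C' h =>
    Khovanov.Cobordism.degree_eq_of_isotopic h⟩, fun O O' O'' C C' => C.degree_comp C',
    fun n D O O' C => D.degree_map C, fun O O' r hr => hr.exists_mem_grading,
    Khovanov.isGradedCategory_shifted (gr := Khovanov.Cob.grading)
      (fun X Y => Khovanov.Cob.hasComponents X Y) Khovanov.Cob.comp_mem_grading
      Khovanov.Cob.id_mem_grading,
    Khovanov.isGradedCategory_shifted Khovanov.CobL.hasComponents
      Khovanov.CobL.comp_mem_grading Khovanov.CobL.id_mem_grading⟩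
  -- A smoothing with boundary `B` makes `|B|` even, so the integer and the rational halves agree.
  · obtain ⟨n, -, hn⟩ := O.exists_hasEuler
    have h : (B.card : ℤ) / 2 = n := by omega
    have h' : (B.card : ℚ) = 2 * n := by exact_mod_cast hn.symm
    rw [Khovanov.Cobordism.degree, h, h']
    push_cast
    ring
  · intro K hK hKC
    -- Both numbers are the value of the same indicator function, so the given triangulation agrees
    -- with the chosen one.
    exact C.isPolyhedron.hasEuler_eulerChar.unique (hKC ▸ PL.hasEuler_space hK)
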